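/- Let $n\ge 2$ and let $U=U(\mathfrak{gl}_n)$ over $\mathbb C$, with elementary matrices $E_{ij}$. For $m\le n$ let $U_m=U(\mathfrak{gl}_m)\subset U$ be generated by the $E_{ij}$, $1\le i,j\le m$, let $Z_m$ be the center of $U_m$, and let $\Gamma\subset U$ be the (commutative) Gelfand–Tsetlin subalgebra generated by $Z_1,\dots,Z_n$. A Gelfand–Tsetlin module is a finitely generated $U$-module $M$ with $M=\bigoplus_{\mathfrak m\in\mathrm{Specm}\,\Gamma}M(\mathfrak m)$, where $M(\mathfrak m)=\{v\in M\mid \mathfrak m^kv=0\text{ for some }k\ge 0\}$. Let $\mathfrak V=\{(i,j)\mid 1\le j\le i\le n\}$. A tableau $T(L)$ is given by $L=(l_{ij})_{(i,j)\in\mathfrak V}$, $l_{ij}\in\mathbb C$. It is noncritical if $l_{ki}\ne l_{kj}$ whenever $1\le i<j\le k\le n-1$. It satisfies the relation $(i,j)\ge(s,t)$ (respectively $(i,j)>(s,t)$) if $l_{ij}-l_{st}\in\mathbb Z_{\ge 0}$ (respectively $\mathbb Z_{>0}$). Let $$\mathcal R=\{(i,j)\ge(i-1,j'),\ (i-1,j')>(i,j)\mid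 1\le j\le i\le n,\ 1\le j'\le i-1\},\qquad \mathcal R^0=\{(n,i)\ge(n,j)\mid 1\le i\ne j\le n\},$$ and let $\mathcal C\subseteq\mathcal R\cup\mathcal R^0$. Decompose $\mathcal C$ into its connected (indecomposable) pieces, two relations being connected when they are joined by a chain of relations of $\mathcal C$ in which consecutive ones share an element of $\mathfrak V$. A tableau $T(L)$ is a $\mathcal C$-realization if it satisfies all relations of $\mathcal C$ and, for all $1\le k\le n$ and $i\ne j$, one has $l_{ki}-l_{kj}\in\mathbb Z$ if and only if $(k,i)$ and $(k,j)$ occur in the same indecomposable piece of $\mathcal C$. Let $\mathcal B_{\mathcal C}(T(L))$ be the set of all tableaux $T(L+z)$ satisfying $\mathcal C$, where $z$ is an integral vector that vanishes in row $n$, and let $V_{\mathcal C}(T(L))$ be the complex vector space with basis $\mathcal B_{\mathcal C}(T(L))$. The set $\mathcal C$ is admissible if for every $\mathcal C$-realization $T(L)$ all tableaux in $\mathcal B_{\mathcal C}(T(L))$ are noncritical and $V_{\mathcal C}(T(L))$ is a $\mathfrak{gl}_n$-module under the Gelfand–Tsetlin formulas $$E_{k,k+1}T(R)=-\sum_{i=1}^{k}\frac{\prod_{j=1}^{k+1}(r_{ki}-r_{k+1,j})}{\prod_{j\ne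 i}(r_{ki}-r_{kj})}T(R+\delta^{ki}),\qquad E_{k+1,k}T(R)=\sum_{i=1}^{k}\frac{\prod_{j=1}^{k-1}(r_{ki}-r_{k-1,j})}{\prod_{j\ne i}(r_{ki}-r_{kj})}T(R-\delta^{ki}),$$ $$E_{kk}T(R)=\Bigl(k-1+\sum_{i=1}^{k}r_{ki}-\sum_{i=1}^{k-1}r_{k-1,i}\Bigr)T(R),$$ where $T(R\pm\delta^{ki})$ is read as $0$ if it is not in $\mathcal B_{\mathcal C}(T(L))$, and $\delta^{ki}$ has entry $1$ at $(k,i)$ and $0$ elsewhere. For $1\le k\le m\le n$ let $$c_{mk}=\sum_{(i_1,\dots,i_k)\in\{1,\dots,m\}^k}E_{i_1i_2}E_{i_2i_3}\cdots E_{i_ki_1}\in U,$$ the standard generators of $\Gamma$, and let $\gamma_{mk}$ be the polynomial in $\lambda_{m1},\dots,\lambda_{mm}$ which equals $$\sum_{i=1}^{m}(\lambda_{mi}+m-1)^k\prod_{j\ne i}\Bigl(1-\frac1{\lambda_{mi}-\lambda_{mj}}\Bigr)$$ wherever $\lambda_{m1},\dots,\lambda_{mm}$ are pairwise distinct. **Theorem.**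 Let $\mathcal C\subseteq\mathcal R\cup\mathcal R^0$ be admissible and let $T(L)$ be a $\mathcal C$-realization. Then the $\mathfrak{gl}_n$-module $V_{\mathcal C}(T(L))$ is a Gelfand–Tsetlin module, and $$c_{mk}\,T(R)=\gamma_{mk}(r_{m1},\dots,r_{mm})\,T(R)\qquad\text{for all } T(R)\in\mathcal B_{\mathcal C}(T(L)),\ 1\le k\le m\le n.$$ -/

import Mathlib

open scoped Classical
open UniversalEnvelopingAlgebra

attribute [local instance 100] LieRing.ofAssociativeRing

noncomputable section

namespace GelfandTsetlin

/-! ### Tableaux -/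

/-- The index set `𝔙 = {(i, j) | 1 ≤ j ≤ i ≤ n}`; `p.1` is the row, `p.2` the place in the row. -/
abbrev Vertex (n : ℕ) : Type := {p : ℕ × ℕ // 1 ≤ p.2 ∧ p.2 ≤ p.1 ∧ p.1 ≤ n}

/-- The row `i` of a vertex `(i, j)`. -/
abbrev Vertex.row {n : ℕ} (v : Vertex n) : ℕ := v.1.1

/-- A Gelfand-Tsetlin tableau `T(L)` of height `n`, i.e. a vector `L = (l_{ij})`. -/
abbrev Tableau (n : ℕ) : Type := Vertex n → ℂ

/-- The entry `l_{ij}`, for `1 ≤ j ≤ i ≤ n` (zero for other pairs of indices, which never occur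
below). -/
def Tableau.entry {n : ℕ} (L : Tableau n) (i j : ℕ) : ℂ :=
  if h : 1 ≤ j ∧ j ≤ i ∧ i ≤ n then L ⟨(i, j), h⟩ else 0

/-- `δ^{ij}`: the entry at `(i, j)` is `1`, all others are `0`. -/
def delta (n i j : ℕ) : Tableau n := fun v => if v.1 = (i, j) then 1 else 0

/-- `T(L)` is noncritical: no two equal entries in a row different from the top row. -/
def Noncritical {n : ℕ} (L : Tableau n) : Prop :=
  ∀ v w : Vertex n, v.row = w.row → v.row ≤ n - 1 → v ≠ w → L v ≠ L w

/-! ### Relations -/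

/-- A relation `src ≥ tgt` (`strict = false`) or `src > tgt` (`strict = true`) between vertices. -/
structure Relation (n : ℕ) where
  strict : Bool
  src : Vertex n
  tgt : Vertex n

/-- `T(L)` satisfies `a ≥ b` if `l_a - l_b ∈ ℤ_{≥ 0}` and `a > b` if `l_a - l_b ∈ ℤ_{> 0}`. -/
def SatisfiesRel {n : ℕ} (L : Tableau n) (r : Relation n) : Prop :=
  ∃ d : ℤ, L r.src - L r.tgt = (d : ℂ) ∧ 0 ≤ d ∧ (r.strict = true → 0 < d)

/-- `T(L)` satisfies all relations in `C`. -/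
def Satisfies {n : ℕ} (L : Tableau n) (C : Set (Relation n)) : Prop :=
  ∀ r ∈ C, SatisfiesRel L r

/-- `ℛ`: the relations `(i, j) ≥ (i-1, j')` and `(i-1, j') > (i, j)`. -/
def relR (n : ℕ) : Set (Relation n) :=
  {r | (r.strict = false ∧ r.src.row = r.tgt.row + 1) ∨
       (r.strict = true ∧ r.tgt.row = r.src.row + 1)}

/-- `ℛ⁰`: the relations `(n, i) ≥ (n, j)` with `i ≠ j`. -/
def relR0 (n : ℕ) : Set (Relation n) :=
  {r | r.strict = false ∧ r.src.row = n ∧ r.tgt.row = n ∧ r.src ≠ r.tgt}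

/-- `v` and `w` are linked by a chain of relations of `C`. For `v ≠ w` this says that both belong to
`𝔙(C_s)` for the same member `C_s` of the decomposition of `C` into pairwise disconnected
indecomposable subsets. -/
def Linked {n : ℕ} (C : Set (Relation n)) : Vertex n → Vertex n → Prop :=
  Relation.EqvGen fun v w => ∃ r ∈ C, r.src = v ∧ r.tgt = w

/-- `T(L)` is a `C`-realization: it satisfies `C`, and two different entries of a row differ by an
integer if and only if they belong to the same indecomposable subset of `C`. -/
def IsRealization {n : ℕ} (C : Set (Relation n)) (L : Tableau n) : Prop :=
  Satisfies L C ∧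
    ∀ v w : Vertex n, v.row = w.row → v ≠ w →
      ((∃ d : ℤ, L v - L w = (d : ℂ)) ↔ Linked C v w)

/-- `𝓑_C(T(L))`: all tableaux `T(L + z)` satisfying `C`, where `z` is an integral vector which is
zero in the top row. -/
def tableaux {n : ℕ} (C : Set (Relation n)) (L : Tableau n) : Set (Tableau n) :=
  {R | (∃ z : Vertex n → ℤ, (∀ v, v.row = n → z v = 0) ∧ ∀ v, R v = L v + (z v : ℂ)) ∧
    Satisfies R C}

/-- `V_C(T(L))`: the complex vector space with basis `𝓑_C(T(L))`. -/
abbrev TableauSpace {n : ℕ} (C : Set (Relation n)) (L : Tableau n) : Type :=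
  tableaux C L →₀ ℂ

/-- `T(R)` as a vector of `V_C(T(L))`: a basis vector if `T(R) ∈ 𝓑_C(T(L))`, and zero otherwise. -/
def tab {n : ℕ} (C : Set (Relation n)) (L R : Tableau n) : TableauSpace C L :=
  if h : R ∈ tableaux C L then Finsupp.single ⟨R, h⟩ 1 else 0

/-! ### The Lie algebra and the Gelfand-Tsetlin formulas -/

/-- The Lie algebra `𝔤𝔩_n` of complex `n × n` matrices. -/
abbrev gln (n : ℕ) : Type := Matrix (Fin n) (Fin n) ℂ

/-- The elementary matrix `E_{ij}`, with indices counted from `1` to `n`. -/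
def E (n i j : ℕ) : gln n :=
  Matrix.of fun a b => if a.val + 1 = i ∧ b.val + 1 = j then 1 else 0

/-- The coefficient of `T(R + δ^{ki})` in `E_{k,k+1} T(R)`. -/
def eCoeff {n : ℕ} (R : Tableau n) (k i : ℕ) : ℂ :=
  -((∏ j ∈ Finset.Icc 1 (k + 1), (R.entry k i - R.entry (k + 1) j)) /
    (∏ j ∈ (Finset.Icc 1 k).erase i, (R.entry k i - R.entry k j)))

/-- The coefficient of `T(R - δ^{ki})` in `E_{k+1,k} T(R)`. -/
def fCoeff {n : ℕ} (R : Tableau n) (k i : ℕ) : ℂ :=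
  (∏ j ∈ Finset.Icc 1 (k - 1), (R.entry k i - R.entry (k - 1) j)) /
    (∏ j ∈ (Finset.Icc 1 k).erase i, (R.entry k i - R.entry k j))

/-- The eigenvalue of `E_{kk}` on `T(R)`. -/
def hCoeff {n : ℕ} (R : Tableau n) (k : ℕ) : ℂ :=
  (k : ℂ) - 1 + ∑ i ∈ Finset.Icc 1 k, R.entry k i - ∑ i ∈ Finset.Icc 1 (k - 1), R.entry (k - 1) i

/-- The `𝔤𝔩_n`-module structure `ρ` on `V_C(T(L))` is given by the Gelfand-Tsetlin formulas. -/
def ActsByGTFormulas {n : ℕ} (C : Set (Relation n)) (L : Tableau n)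
    (ρ : gln n →ₗ⁅ℂ⁆ Module.End ℂ (TableauSpace C L)) : Prop :=
  ∀ R ∈ tableaux C L,
    (∀ k : ℕ, 1 ≤ k → k ≤ n - 1 →
      ρ (E n k (k + 1)) (tab C L R) =
        ∑ i ∈ Finset.Icc 1 k, eCoeff R k i • tab C L (R + delta n k i)) ∧
    (∀ k : ℕ, 1 ≤ k → k ≤ n - 1 →
      ρ (E n (k + 1) k) (tab C L R) =
        ∑ i ∈ Finset.Icc 1 k, fCoeff R k i • tab C L (R - delta n k i)) ∧
    (∀ k : ℕ, 1 ≤ k → k ≤ n → ρ (E n k k) (tab C L R) = hCoeff R k • tab C L R)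

/-- `C` is admissible: for every `C`-realization `T(L)` the Gelfand-Tsetlin formulas are defined on
`V_C(T(L))` (all its basis tableaux are noncritical) and make it a `𝔤𝔩_n`-module. -/
def Admissible {n : ℕ} (C : Set (Relation n)) : Prop :=
  ∀ L : Tableau n, IsRealization C L →
    (∀ R ∈ tableaux C L, Noncritical R) ∧
      ∃ ρ : gln n →ₗ⁅ℂ⁆ Module.End ℂ (TableauSpace C L), ActsByGTFormulas C L ρ

/-! ### The Gelfand-Tsetlin subalgebra -/

/-- `U = U(𝔤𝔩_n)`. -/
abbrev UGL (n : ℕ) : Type := UniversalEnvelopingAlgebra ℂ (gln n)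

/-- `E_{ij}` as an element of `U(𝔤𝔩_n)`. -/
def uE (n i j : ℕ) : UGL n := ι ℂ (E n i j)

/-- `U_m = U(𝔤𝔩_m)` inside `U(𝔤𝔩_n)`, where `𝔤𝔩_m` is spanned by the `E_{ij}` with `i, j ≤ m`. -/
def subU (n m : ℕ) : Subalgebra ℂ (UGL n) :=
  Algebra.adjoin ℂ {x | ∃ i j : ℕ, 1 ≤ i ∧ i ≤ m ∧ 1 ≤ j ∧ j ≤ m ∧ x = uE n i j}

/-- `Z_m`, the center of `U_m`. -/
def centerU (n m : ℕ) : Set (UGL n) :=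
  {x | x ∈ subU n m ∧ ∀ y ∈ subU n m, x * y = y * x}

/-- The Gelfand-Tsetlin subalgebra `Γ`, generated by `Z_1, …, Z_n`. -/
def Gam (n : ℕ) : Subalgebra ℂ (UGL n) :=
  Algebra.adjoin ℂ {x | ∃ m : ℕ, 1 ≤ m ∧ m ≤ n ∧ x ∈ centerU n m}

theorem subU_mono (n : ℕ) {m m' : ℕ} (h : m ≤ m') : subU n m ≤ subU n m' := by
  apply Algebra.adjoin_mono
  rintro x ⟨i, j, h1, h2, h3, h4, rfl⟩
  exact ⟨i, j, h1, h2.trans h, h3, h4.trans h, rfl⟩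

theorem Gam_comm (n : ℕ) (a b : Gam n) : a * b = b * a := by
  have key : ∀ x ∈ {x | ∃ m : ℕ, 1 ≤ m ∧ m ≤ n ∧ x ∈ centerU n m},
      ∀ y ∈ {x | ∃ m : ℕ, 1 ≤ m ∧ m ≤ n ∧ x ∈ centerU n m}, x * y = y * x := by
    rintro x ⟨m, -, -, hx⟩ y ⟨m', -, -, hy⟩
    rcases le_total m m' with h | h
    · exact (hy.2 x (subU_mono n h hx.1)).symm
    · exact hx.2 y (subU_mono n h hy.1)
  exact (Algebra.isMulCommutative_adjoin ℂ key).is_comm.comm a b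

instance (n : ℕ) : CommRing (Gam n) :=
  { (inferInstance : Ring (Gam n)) with mul_comm := Gam_comm n }

/-! ### Gelfand-Tsetlin modules -/

section Modules

variable {n : ℕ} {V : Type*} [AddCommGroup V] [Module ℂ V]

/-- The action of `U(𝔤𝔩_n)` on a `𝔤𝔩_n`-module. -/
abbrev uAction (ρ : gln n →ₗ⁅ℂ⁆ Module.End ℂ V) : UGL n →ₐ[ℂ] Module.End ℂ V := lift ℂ ρ

/-- `M(𝔪) = {v | 𝔪^k v = 0 for some k ≥ 0}`. -/
def gtSpace (ρ : gln n →ₗ⁅ℂ⁆ Module.End ℂ V) (𝔪 : MaximalSpectrum (Gam n)) : Submodule ℂ V where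
  carrier := {v | ∃ k : ℕ, ∀ a ∈ 𝔪.asIdeal ^ k, uAction ρ (a : UGL n) v = 0}
  zero_mem' := ⟨0, fun a _ => map_zero _⟩
  add_mem' := by
    rintro v w ⟨k, hk⟩ ⟨l, hl⟩
    refine ⟨k + l, fun a ha => ?_⟩
    rw [map_add, hk a (Ideal.pow_le_pow_right (Nat.le_add_right k l) ha),
      hl a (Ideal.pow_le_pow_right (Nat.le_add_left l k) ha), add_zero]
  smul_mem' := by
    rintro c v ⟨k, hk⟩
    exact ⟨k, fun a ha => by rw [map_smul, hk a ha, smul_zero]⟩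

/-- A Gelfand-Tsetlin module: a finitely generated `U(𝔤𝔩_n)`-module `M` with
`M = ⨁ M(𝔪)` over the maximal ideals `𝔪` of `Γ`. -/
def IsGelfandTsetlinModule (ρ : gln n →ₗ⁅ℂ⁆ Module.End ℂ V) : Prop :=
  (∃ S : Finset V, Submodule.span ℂ {v | ∃ u : UGL n, ∃ s ∈ S, v = uAction ρ u s} = ⊤) ∧
    DirectSum.IsInternal (gtSpace ρ)

end Modules

/-! ### The elements `c_{mk}` and the polynomials `γ_{mk}` -/

/-- `c_{mk} = ∑ E_{i₁ i₂} E_{i₂ i₃} ⋯ E_{i_k i₁}`, over all `(i₁, …, i_k) ∈ {1, …, m}^k`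
(`finRotate` is the cyclic successor). -/
def cGen (n m k : ℕ) : UGL n :=
  ∑ f : Fin k → Fin m,
    (List.ofFn fun a : Fin k => uE n ((f a).val + 1) ((f (finRotate k a)).val + 1)).prod

/-- The expression `∑_i (x_i + m - 1)^k ∏_{j ≠ i} (1 - 1 / (x_i - x_j))`, meaningful for pairwise
distinct `x_1, …, x_m`. -/
def gammaExpr (m k : ℕ) (x : Fin m → ℂ) : ℂ :=
  ∑ i, (x i + (m : ℂ) - 1) ^ k * ∏ j ∈ Finset.univ.erase i, (1 - 1 / (x i - x j))

theorem exists_gammaPoly (m k : ℕ) : ∃ p : MvPolynomial (Fin m) ℂ,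
    ∀ x : Fin m → ℂ, Function.Injective x → MvPolynomial.eval x p = gammaExpr m k x := by
  let q : Polynomial (MvPolynomial (Fin m) ℂ) :=
    ∏ j, (Polynomial.X - Polynomial.C (MvPolynomial.X j))
  let h : Polynomial (MvPolynomial (Fin m) ℂ) :=
    (Polynomial.X + Polynomial.C (MvPolynomial.C ((m : ℂ) - 1))) ^ k *
      ∏ j, (Polynomial.X - Polynomial.C (MvPolynomial.X j + 1))
  have hq : q.Monic := Polynomial.monic_prod_of_monic _ _ fun j _ => Polynomial.monic_X_sub_C _
  refine ⟨-((h %ₘ q).coeff (m - 1)), fun x hx => ?_⟩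
  have hqx : q.map (MvPolynomial.eval x) = Lagrange.nodal Finset.univ x := by
    simp [q, Lagrange.nodal, Polynomial.map_prod]
  have hcoeff : MvPolynomial.eval x ((h %ₘ q).coeff (m - 1)) =
      ((h.map (MvPolynomial.eval x)) %ₘ (Lagrange.nodal Finset.univ x)).coeff (m - 1) := by
    rw [← hqx, ← Polynomial.map_modByMonic _ hq, Polynomial.coeff_map]
  have hdeg : ((h.map (MvPolynomial.eval x)) %ₘ (Lagrange.nodal Finset.univ x)).degree <
      (Finset.univ : Finset (Fin m)).card := by
    rw [← Lagrange.degree_nodal (v := x)]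
    exact Polynomial.degree_modByMonic_lt _ Lagrange.nodal_monic
  have hsum := Lagrange.coeff_eq_sum (hx.injOn) hdeg
  rw [Finset.card_univ, Fintype.card_fin] at hsum
  rw [map_neg, hcoeff, hsum, gammaExpr, ← Finset.sum_neg_distrib]
  refine Finset.sum_congr rfl fun i _ => ?_
  have hev : ((h.map (MvPolynomial.eval x)) %ₘ (Lagrange.nodal Finset.univ x)).eval (x i) =
      (h.map (MvPolynomial.eval x)).eval (x i) :=
    Polynomial.eval₂_modByMonic_eq_self_of_root (f := RingHom.id ℂ)
      (Lagrange.eval_nodal_at_node (Finset.mem_univ i))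
  have hval : (h.map (MvPolynomial.eval x)).eval (x i) =
      -((x i + (m : ℂ) - 1) ^ k * ∏ j ∈ Finset.univ.erase i, (x i - x j - 1)) := by
    simp only [h, Polynomial.map_mul, Polynomial.map_pow, Polynomial.map_prod, Polynomial.map_add,
      Polynomial.map_sub, Polynomial.map_X, Polynomial.map_C, Polynomial.eval_mul,
      Polynomial.eval_pow, Polynomial.eval_prod, Polynomial.eval_add, Polynomial.eval_sub,
      Polynomial.eval_X, Polynomial.eval_C]
    rw [← Finset.mul_prod_erase _ _ (Finset.mem_univ i)]
    simp only [map_add, map_one, MvPolynomial.eval_X, MvPolynomial.eval_C]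
    rw [Finset.prod_congr rfl fun j _ => (sub_sub (x i) (x j) 1).symm]
    ring
  rw [hev, hval, neg_div, neg_neg, mul_div_assoc, ← Finset.prod_div_distrib]
  congr 1
  refine Finset.prod_congr rfl fun j hj => ?_
  have : x i - x j ≠ 0 := sub_ne_zero.2 fun e => (Finset.ne_of_mem_erase hj) (hx e).symm
  field_simp

/-- The polynomial `γ_{mk}`: the polynomial that equals the above expression wherever the latter is
meaningful. -/
def gammaPoly (m k : ℕ) : MvPolynomial (Fin m) ℂ := (exists_gammaPoly m k).choose

theorem eval_gammaPoly (m k : ℕ) (x : Fin m → ℂ) (hx : Function.Injective x) :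
    MvPolynomial.eval x (gammaPoly m k) = gammaExpr m k x :=
  (exists_gammaPoly m k).choose_spec x hx

/-- `γ_{mk}` at the `m`-th row of `T(R)`. -/
def gammaAt {n : ℕ} (m k : ℕ) (R : Tableau n) : ℂ :=
  MvPolynomial.eval (fun i : Fin m => R.entry m (i.val + 1)) (gammaPoly m k)

end GelfandTsetlin

end

/-! Put `M_m = (E_ij)` with `i, j ≤ m`, so that `c_{mk}` is the trace of `M_m ^ k`. The eigenvalues
are found for whole generating series, by induction on `m`. Let `G` be the inverse of `1 - z (M_m +
b)` and let `Q` be the inverse of the lower right entry of the inverse of `1 - z (M_{m+1} + b)`. Two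
identities between power series over the enveloping algebra drive the induction.
`one_sub_traceSeries` passes from the trace series of `M_m` to that of `M_{m+1}` through `Q` at `b`
and `b + 1`. `quasidetSeries_succ` passes from one `Q` to the next through the commutators of
`E_{k+1,k}` with `∑_j ((M_k + b)^p)_{kj} E_{j,k+1}`.

On tableaux the latter element acts like `E_{k,k+1}`, with the coefficient of `T(R + δ^{ka})`
multiplied by `(r_{ka} + k + b)^p`. Indeed multiplication by `M_k` can be expressed by the
commutator with `tr(M_k²)`, whose eigenvalues are already known (`weighted_raising`). Its commutator
with `E_{k+1,k}` is therefore diagonal, and its eigenvalues are power sums weighted by residues of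
`N(t) / (q(t) q(t+1))`, where `q(t) = ∏ (t - r_{kj})` and `N(t) = ∏ (t - r_{k+1,j}) ∏ (t + 1 -
r_{k-1,j})` (`commutator_weighted`). Partial fractions sum them up, provided that the fraction has
no double poles.

A double pole could arise where `r_{kj} = r_{ka} + 1`; there `N` must have a double zero
(`sq_dvd_adjacentPoly`). This is where admissibility is used in full: stretching all distances
except the given unit distance yields another realization, with a single double node. Raising
`r_{ka}` there is forbidden, so `N` vanishes at the node, and the relation `[E_{k+1,k}, E_{k,k+1}] =
E_{k+1,k+1} - E_{kk}` forces the second zero.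

Finite generation: call two tableaux equivalent if the same inequalities hold between adjacent rows.
There are finitely many classes, and inside a class one can move by raising and lowering with
nonzero coefficients (`tab_mem_of_pattern_eq`). Decomposition: the lower right entries of the powers
of the `M_m` commute with `Γ` and separate the tableaux (`eq_of_cornerSeries_eq`), so every element
of `Γ` acts diagonally. It is not needed here that the `c_{mk}` generate `Γ`. -/

noncomputable section

namespace GelfandTsetlin

/-! ### Matrices satisfying the relations of `𝔤𝔩` -/

section Algebra

open Matrix

variable {κ K S : Type*} [Fintype κ] [DecidableEq κ] [CommRing K] [Ring S] [Algebra K S]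

/-- The entries of `N` transform under those of `M` like the elementary matrices do. -/
def IsTensorOperator (M N : Matrix κ κ S) : Prop :=
  ∀ i j k l, M i j * N k l - N k l * M i j =
    (if j = k then N i l else 0) - (if i = l then N k j else 0)

theorem single_one_mul_apply (N : Matrix κ κ S) (i j k l : κ) :
    (Matrix.single j i (1 : S) * N) k l = if j = k then N i l else 0 := by
  split_ifs with h
  · subst h; simp
  · exact Matrix.single_mul_apply_of_ne _ _ _ _ _ (Ne.symm h) _

theorem mul_single_one_apply (N : Matrix κ κ S) (i j k l : κ) :
    (N * Matrix.single j i (1 : S)) k l = if i = l then N k j else 0 := by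
  split_ifs with h
  · subst h; simp
  · exact Matrix.mul_single_apply_of_ne _ _ _ _ _ (Ne.symm h) _

/-- In this form the property is commutation with a fixed family of matrices, so it passes at once
to powers, sums, scalar multiples and inverses of `N`. -/
theorem isTensorOperator_iff_commute (M N : Matrix κ κ S) :
    IsTensorOperator M N ↔
      ∀ i j, Commute (Matrix.diagonal (fun _ => M i j) - Matrix.single j i (1 : S)) N := by
  have key : ∀ i j k l, ((((Matrix.diagonal (fun _ => M i j) - Matrix.single j i (1 : S)) * N :
        Matrix κ κ S) k l =
      (N * (Matrix.diagonal (fun _ => M i j) - Matrix.single j i (1 : S)) : Matrix κ κ S) k l) ↔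
      M i j * N k l - N k l * M i j =
    (if j = k then N i l else 0) - (if i = l then N k j else 0)) := by
    intro i j k l
    rw [sub_mul, mul_sub, Matrix.sub_apply, Matrix.sub_apply, single_one_mul_apply,
      mul_single_one_apply, Matrix.diagonal_mul, Matrix.mul_diagonal,
      sub_eq_sub_iff_sub_eq_sub]
  constructor
  · intro h i j
    ext k l
    exact (key i j k l).2 (h i j k l)
  · intro h i j k l
    exact (key i j k l).1 (congrFun (congrFun (h i j) k) l)

theorem IsTensorOperator.pow {M N : Matrix κ κ S} (h : IsTensorOperator M N) (p : ℕ) :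
    IsTensorOperator M (N ^ p) := by
  rw [isTensorOperator_iff_commute] at h ⊢
  exact fun i j => (h i j).pow_right p

theorem IsTensorOperator.one (M : Matrix κ κ S) : IsTensorOperator M 1 := by
  rw [isTensorOperator_iff_commute]
  exact fun i j => Commute.one_right _

theorem IsTensorOperator.add {M N N' : Matrix κ κ S} (h : IsTensorOperator M N)
    (h' : IsTensorOperator M N') : IsTensorOperator M (N + N') := by
  rw [isTensorOperator_iff_commute] at h h' ⊢
  exact fun i j => (h i j).add_right (h' i j)

theorem IsTensorOperator.smul {M N : Matrix κ κ S} (h : IsTensorOperator M N) (c : K) :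
    IsTensorOperator M (c • N) := by
  rw [isTensorOperator_iff_commute] at h ⊢
  exact fun i j => (h i j).smul_right c

/-- `G` is the inverse of `a - z M`. -/
structure IsResolvent (z a : K) (M G : Matrix κ κ S) : Prop where
  left : a • G - z • (M * G) = 1
  right : a • G - z • (G * M) = 1

variable {z a a' : K}

theorem IsResolvent.commute {M G T : Matrix κ κ S} (h : IsResolvent z a M G) (hT : Commute T M) :
    Commute T G := by
  set X : Matrix κ κ S := a • 1 - z • M with hX
  have h1 : X * G = 1 := by rw [hX, sub_mul, smul_mul_assoc, smul_mul_assoc, one_mul]; exact h.left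
  have h2 : G * X = 1 := by rw [hX, mul_sub, mul_smul_comm, mul_smul_comm, mul_one]; exact h.right
  have hTX : Commute T X := ((Commute.one_right T).smul_right a).sub_right (hT.smul_right z)
  calc T * G = G * X * T * G := by rw [h2, one_mul]
    _ = G * (T * X) * G := by rw [hTX.eq]; simp only [mul_assoc]
    _ = G * T := by rw [mul_assoc, mul_assoc, h1, mul_one]

theorem IsResolvent.isTensorOperator {M G : Matrix κ κ S} (h : IsResolvent z a M G)
    (hM : IsTensorOperator M M) : IsTensorOperator M G := by
  rw [isTensorOperator_iff_commute] at hM ⊢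
  exact fun i j => h.commute (hM i j)

theorem IsResolvent.entry_commute {M G : Matrix κ κ S} (h : IsResolvent z a M G) {x : S}
    (hx : ∀ i j, Commute x (M i j)) (i j : κ) : Commute x (G i j) := by
  have : Commute (Matrix.diagonal fun _ => x) M := by
    ext k l
    rw [Matrix.diagonal_mul, Matrix.mul_diagonal]
    exact hx k l
  have := congrFun (congrFun (h.commute this).eq i) j
  rwa [Matrix.diagonal_mul, Matrix.mul_diagonal] at this

/-- The resolvent identity. -/
theorem IsResolvent.mul_eq_sub {M G G' : Matrix κ κ S} (h : IsResolvent z a M G)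
    (h' : IsResolvent z (a - z) M G') : z • (G' * G) = G' - G := by
  have e1 : G' * (a • G - z • (M * G)) = G' := by rw [h.left, mul_one]
  have e2 : ((a - z) • G' - z • (G' * M)) * G = G := by rw [h'.right, one_mul]
  rw [mul_sub, mul_smul_comm, mul_smul_comm] at e1
  rw [sub_mul, smul_mul_assoc, smul_mul_assoc, mul_assoc, sub_smul] at e2
  calc z • (G' * G) = (a • (G' * G) - z • (G' * (M * G))) -
      (a • (G' * G) - z • (G' * G) - z • (G' * (M * G))) := by abel
    _ = G' - G := by rw [e1, e2]

theorem IsResolvent.mul_eq_sub' {M G G' : Matrix κ κ S} (h : IsResolvent z a M G)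
    (h' : IsResolvent z (a - z) M G') : z • (G * G') = G' - G := by
  have e1 : G * ((a - z) • G' - z • (M * G')) = G := by rw [h'.left, mul_one]
  have e2 : (a • G - z • (G * M)) * G' = G' := by rw [h.right, one_mul]
  rw [mul_sub, mul_smul_comm, mul_smul_comm, sub_smul] at e1
  rw [sub_mul, smul_mul_assoc, smul_mul_assoc, mul_assoc] at e2
  calc z • (G * G') = (a • (G * G') - z • (G * (M * G'))) -
      (a • (G * G') - z • (G * G') - z • (G * (M * G'))) := by abel
    _ = G' - G := by rw [e1, e2]

/-! ### Vector operators -/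

/-- The entries of `ψ` transform under those of `M` like a column of elementary matrices. -/
def IsVectorOperator (M : Matrix κ κ S) (ψ : κ → S) : Prop :=
  ∀ i j k, M i j * ψ k - ψ k * M i j = if j = k then ψ i else 0

/-- The entries of `φ` transform under those of `M` like a row of elementary matrices. -/
def IsCovectorOperator (M : Matrix κ κ S) (φ : κ → S) : Prop :=
  ∀ i j k, M i j * φ k - φ k * M i j = if i = k then -φ j else 0

theorem commutator_sum_mul {ι : Type*} (s : Finset ι) (x : S) (f g : ι → S) :
    x * (∑ i ∈ s, f i * g i) - (∑ i ∈ s, f i * g i) * x =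
      ∑ i ∈ s, ((x * f i - f i * x) * g i + f i * (x * g i - g i * x)) := by
  rw [Finset.mul_sum, Finset.sum_mul, ← Finset.sum_sub_distrib]
  exact Finset.sum_congr rfl fun i _ => by noncomm_ring

omit [DecidableEq κ] in
theorem vecMul_apply_eq_sum (φ : κ → S) (N : Matrix κ κ S) (k : κ) :
    (φ ᵥ* N) k = ∑ i, φ i * N i k := rfl

omit [DecidableEq κ] in
theorem mulVec_apply_eq_sum (N : Matrix κ κ S) (ψ : κ → S) (k : κ) :
    (N *ᵥ ψ) k = ∑ i, N k i * ψ i := rfl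

theorem IsVectorOperator.tensor_mulVec {M N : Matrix κ κ S} {ψ : κ → S}
    (h : IsVectorOperator M ψ) (hN : IsTensorOperator M N) : IsVectorOperator M (N *ᵥ ψ) := by
  intro i j k
  simp only [mulVec_apply_eq_sum]
  rw [commutator_sum_mul]
  simp only [hN i j k, h i j, sub_mul, ite_mul, zero_mul, mul_ite, mul_zero,
    Finset.sum_add_distrib, Finset.sum_sub_distrib, Finset.sum_ite_eq, Finset.mem_univ, if_true]
  split_ifs <;> simp

theorem IsCovectorOperator.vecMul_tensor {M N : Matrix κ κ S} {φ : κ → S}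
    (h : IsCovectorOperator M φ) (hN : IsTensorOperator M N) :
    IsCovectorOperator M (φ ᵥ* N) := by
  intro i j k
  have e : ∀ l, M i j * N l k - N l k * M i j = _ := fun l => hN i j l k
  rw [vecMul_apply_eq_sum, vecMul_apply_eq_sum, commutator_sum_mul Finset.univ (M i j) φ
    (fun l => N l k)]
  have e1 : ∀ l, (M i j * φ l - φ l * M i j) * N l k + φ l * (M i j * N l k - N l k * M i j) =
      ((if i = l then -(φ j * N l k) else 0) + if j = l then φ l * N i k else 0) -
        if i = k then φ l * N l j else 0 := by
    intro l
    rw [e l, h i j l]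
    split_ifs <;> noncomm_ring
  rw [Finset.sum_congr rfl fun l _ => e1 l, Finset.sum_sub_distrib, Finset.sum_add_distrib,
    Finset.sum_ite_eq, Finset.sum_ite_eq, if_pos (Finset.mem_univ _), if_pos (Finset.mem_univ _),
    neg_add_cancel, zero_sub]
  split_ifs <;> simp

/-- Each of the two factors of `M j k * M k j` contributes one copy of `M *ᵥ ψ`. In one of them `ψ`
stands on the left, and moving it across costs `ψ i` once for every index. Thus multiplication by
`M` becomes a commutator with an element whose eigenvalues can be known. -/
theorem commutator_trace_sq {M : Matrix κ κ S} {ψ : κ → S} (h : IsVectorOperator M ψ) (i : κ) :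
    (M ^ 2).trace * ψ i - ψ i * (M ^ 2).trace =
      2 * (M *ᵥ ψ) i - (Fintype.card κ : S) * ψ i := by
  have e : ∀ j k, M j k * M k j * ψ i - ψ i * (M j k * M k j) =
      M j k * (if j = i then ψ k else 0) + (if k = i then ψ j else 0) * M k j := by
    intro j k
    rw [← h k j i, ← h j k i]
    noncomm_ring
  have e2 : ∀ j, ψ j * M i j = M i j * ψ j - ψ i := by
    intro j
    have := h i j j
    rw [if_pos rfl] at this
    rw [← this]; noncomm_ring
  simp only [pow_two, Matrix.trace, Matrix.diag, Matrix.mul_apply, Matrix.mulVec, dotProduct]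
  rw [Finset.sum_mul, Finset.mul_sum, ← Finset.sum_sub_distrib]
  simp only [Finset.sum_mul, Finset.mul_sum, ← Finset.sum_sub_distrib, e,
    Finset.sum_add_distrib, mul_ite, ite_mul, mul_zero, zero_mul]
  rw [Finset.sum_comm (f := fun j k => if j = i then M j k * ψ k else 0)]
  simp only [Finset.sum_ite_eq', Finset.mem_univ, if_true, e2, Finset.sum_sub_distrib,
    Finset.sum_const, Finset.card_univ, nsmul_eq_mul]
  rw [← Finset.mul_sum]
  noncomm_ring

/-- The correction `ψ i * φ i - ψ k * φ k` is antisymmetric in `i` and `k`, hence disappears in the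
double sum. -/
theorem sum_mulVec_mul_eq {M : Matrix κ κ S} {ψ φ : κ → S} (hψ : IsVectorOperator M ψ)
    (hφ : IsCovectorOperator M φ) :
    ∑ i, (M *ᵥ ψ) i * φ i = ∑ i, ψ i * (φ ᵥ* M) i := by
  have e : ∀ i k, M i k * ψ k * φ i = ψ k * (φ i * M i k) + (ψ i * φ i - ψ k * φ k) := by
    intro i k
    have h1 := hψ i k k
    have h2 := hφ i k i
    rw [if_pos rfl] at h1 h2
    rw [sub_eq_iff_eq_add] at h1 h2
    rw [h1, add_mul, mul_assoc, h2]
    noncomm_ring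
  simp only [mulVec_apply_eq_sum, vecMul_apply_eq_sum, Finset.sum_mul, Finset.mul_sum, e,
    Finset.sum_add_distrib, Finset.sum_sub_distrib]
  rw [Finset.sum_comm (f := fun i k => ψ i * φ i), sub_self, add_zero, Finset.sum_comm]

end Algebra

/-! ### Restriction from `𝔤𝔩_{m+1}` to `𝔤𝔩_m` -/

section Blocks

open Matrix

variable {K S : Type*} [CommRing K] [Ring S] [Algebra K S] {m : ℕ}

/-- The upper left block of size `m`. -/
def topBlock (M : Matrix (Fin (m + 1)) (Fin (m + 1)) S) : Matrix (Fin m) (Fin m) S :=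
  M.submatrix Fin.castSucc Fin.castSucc

/-- The last column without its last entry. -/
def lastCol (M : Matrix (Fin (m + 1)) (Fin (m + 1)) S) : Fin m → S :=
  fun i => M i.castSucc (Fin.last m)

/-- The last row without its last entry. -/
def lastRow (M : Matrix (Fin (m + 1)) (Fin (m + 1)) S) : Fin m → S :=
  fun i => M (Fin.last m) i.castSucc

/-- The lower right quasideterminant of `a - z M`, where `G` is the inverse of its upper left
block. -/
def quasidet (z a : K) (M : Matrix (Fin (m + 1)) (Fin (m + 1)) S) (G : Matrix (Fin m) (Fin m) S) :
    S :=
  algebraMap K S a - z • M (Fin.last m) (Fin.last m) - z ^ 2 • (lastRow M ⬝ᵥ (G *ᵥ lastCol M))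

variable {z a : K} {M H : Matrix (Fin (m + 1)) (Fin (m + 1)) S} {G G' : Matrix (Fin m) (Fin m) S}

theorem IsTensorOperator.topBlock (h : IsTensorOperator M M) :
    IsTensorOperator (topBlock M) (topBlock M) := by
  intro i j k l
  have := h i.castSucc j.castSucc k.castSucc l.castSucc
  simp only [Fin.castSucc_inj] at this
  exact this

theorem IsTensorOperator.lastCol (h : IsTensorOperator M M) :
    IsVectorOperator (GelfandTsetlin.topBlock M) (lastCol M) := by
  intro i j k
  have := h i.castSucc j.castSucc k.castSucc (Fin.last m)
  rw [if_neg (Fin.castSucc_lt_last i).ne, sub_zero] at this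
  simp only [Fin.castSucc_inj] at this
  exact this

theorem IsTensorOperator.lastRow (h : IsTensorOperator M M) :
    IsCovectorOperator (GelfandTsetlin.topBlock M) (lastRow M) := by
  intro i j k
  have := h i.castSucc j.castSucc (Fin.last m) k.castSucc
  rw [if_neg (Fin.castSucc_lt_last j).ne, zero_sub] at this
  refine this.trans ?_
  simp only [Fin.castSucc_inj]
  split_ifs <;> simp [GelfandTsetlin.lastRow]

theorem lastCol_lastRow (h : IsTensorOperator M M) (i j : Fin m) :
    lastCol M i * lastRow M j - lastRow M j * lastCol M i =
      topBlock M i j - if i = j then M (Fin.last m) (Fin.last m) else 0 := by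
  have := h i.castSucc (Fin.last m) (Fin.last m) j.castSucc
  simp only [if_true, Fin.castSucc_inj] at this
  exact this

theorem IsResolvent.apply_left {κ : Type*} [Fintype κ] [DecidableEq κ] {M G : Matrix κ κ S}
    (h : IsResolvent z a M G) (i j : κ) :
    a • G i j - z • ∑ k, M i k * G k j = if i = j then 1 else 0 := by
  have := congrFun (congrFun h.left i) j
  rwa [Matrix.sub_apply, Matrix.smul_apply, Matrix.smul_apply, Matrix.mul_apply,
    Matrix.one_apply] at this

theorem IsResolvent.apply_right {κ : Type*} [Fintype κ] [DecidableEq κ] {M G : Matrix κ κ S}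
    (h : IsResolvent z a M G) (i j : κ) :
    a • G i j - z • ∑ k, G i k * M k j = if i = j then 1 else 0 := by
  have := congrFun (congrFun h.right i) j
  rwa [Matrix.sub_apply, Matrix.smul_apply, Matrix.smul_apply, Matrix.mul_apply,
    Matrix.one_apply] at this

/-- Solving a linear system by the resolvent. -/
theorem IsResolvent.eq_mulVec {κ : Type*} [Fintype κ] [DecidableEq κ] {M G : Matrix κ κ S}
    (h : IsResolvent z a M G) {c d : κ → S} (hc : a • c - z • (M *ᵥ c) = d) : c = G *ᵥ d := by
  rw [← hc, Matrix.mulVec_sub, Matrix.mulVec_smul, Matrix.mulVec_smul, Matrix.mulVec_mulVec,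
    ← Matrix.smul_mulVec, ← Matrix.smul_mulVec, ← Matrix.sub_mulVec, h.right, Matrix.one_mulVec]

theorem IsResolvent.eq_vecMul {κ : Type*} [Fintype κ] [DecidableEq κ] {M G : Matrix κ κ S}
    (h : IsResolvent z a M G) {c d : κ → S} (hc : a • c - z • (c ᵥ* M) = d) : c = d ᵥ* G := by
  rw [← hc, Matrix.sub_vecMul, Matrix.smul_vecMul, Matrix.smul_vecMul, Matrix.vecMul_vecMul,
    ← Matrix.vecMul_smul, ← Matrix.vecMul_smul, ← Matrix.vecMul_sub, h.left, Matrix.vecMul_one]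

theorem mulVec_mul_right {κ : Type*} [Fintype κ] (N : Matrix κ κ S) (c : κ → S) (x : S) (i : κ) :
    (N *ᵥ fun j => c j * x) i = (N *ᵥ c) i * x := by
  simp only [mulVec_apply_eq_sum, Finset.sum_mul, mul_assoc]

theorem vecMul_mul_left {κ : Type*} [Fintype κ] (N : Matrix κ κ S) (c : κ → S) (x : S) (i : κ) :
    ((fun j => x * c j) ᵥ* N) i = x * (c ᵥ* N) i := by
  simp only [vecMul_apply_eq_sum, Finset.mul_sum, mul_assoc]

/-- Block inversion over a noncommutative ring: off the diagonal, the last column of `(a - z M) H =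
1` is a linear system for the upper left block, and `G` solves it. The last row, the upper left
block and the corner are treated alike below. -/
theorem lastCol_resolvent (hH : IsResolvent z a M H) (hG : IsResolvent z a (topBlock M) G)
    (i : Fin m) :
    lastCol H i = z • ((G *ᵥ lastCol M) i * H (Fin.last m) (Fin.last m)) := by
  have : lastCol H = G *ᵥ (z • fun j => lastCol M j * H (Fin.last m) (Fin.last m)) := by
    apply hG.eq_mulVec
    ext j
    have := hH.apply_left j.castSucc (Fin.last m)
    rw [if_neg (Fin.castSucc_lt_last j).ne, Fin.sum_univ_castSucc, smul_add, ← sub_sub,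
      sub_eq_zero] at this
    exact this
  rw [this, Matrix.mulVec_smul, Pi.smul_apply, mulVec_mul_right]

theorem lastRow_resolvent (hH : IsResolvent z a M H) (hG : IsResolvent z a (topBlock M) G)
    (i : Fin m) :
    lastRow H i = z • (H (Fin.last m) (Fin.last m) * (lastRow M ᵥ* G) i) := by
  have : lastRow H = (z • fun j => H (Fin.last m) (Fin.last m) * lastRow M j) ᵥ* G := by
    apply hG.eq_vecMul
    ext j
    have := hH.apply_right (Fin.last m) j.castSucc
    rw [if_neg (Fin.castSucc_lt_last j).ne', Fin.sum_univ_castSucc, smul_add, ← sub_sub,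
      sub_eq_zero] at this
    exact this
  rw [this, Matrix.smul_vecMul, Pi.smul_apply, vecMul_mul_left]

theorem topBlock_resolvent (hH : IsResolvent z a M H) (hG : IsResolvent z a (topBlock M) G)
    (i j : Fin m) :
    H i.castSucc j.castSucc = G i j + z • ((G *ᵥ lastCol M) i * lastRow H j) := by
  have : (fun i : Fin m => H i.castSucc j.castSucc) =
      G *ᵥ ((fun i => (1 : Matrix (Fin m) (Fin m) S) i j) +
        z • fun i => lastCol M i * lastRow H j) := by
    apply hG.eq_mulVec
    ext k
    have := hH.apply_left k.castSucc j.castSucc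
    rw [Fin.sum_univ_castSucc, smul_add, ← sub_sub, sub_eq_iff_eq_add] at this
    simp only [Fin.castSucc_inj] at this
    rw [Pi.add_apply, Matrix.one_apply]
    exact this
  have := congrFun this i
  rw [Matrix.mulVec_add, Matrix.mulVec_smul, Pi.add_apply, Pi.smul_apply, mulVec_mul_right] at this
  rw [this]
  congr 1
  rw [mulVec_apply_eq_sum, ← Matrix.mul_apply, Matrix.mul_one]

theorem quasidet_mul (hH : IsResolvent z a M H) (hG : IsResolvent z a (topBlock M) G) :
    quasidet z a M G * H (Fin.last m) (Fin.last m) = 1 := by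
  have h1 := hH.apply_left (Fin.last m) (Fin.last m)
  rw [if_pos rfl, Fin.sum_univ_castSucc] at h1
  have h2 : ∑ i : Fin m, M (Fin.last m) i.castSucc * H i.castSucc (Fin.last m) =
      z • (lastRow M ⬝ᵥ (G *ᵥ lastCol M) * H (Fin.last m) (Fin.last m)) := by
    rw [dotProduct, Finset.sum_mul, Finset.smul_sum]
    refine Finset.sum_congr rfl fun i _ => ?_
    rw [show H i.castSucc (Fin.last m) = lastCol H i from rfl, lastCol_resolvent hH hG,
      mul_smul_comm, mul_assoc]
    rfl
  rw [h2] at h1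
  rw [quasidet, sub_mul, sub_mul, ← Algebra.smul_def, smul_mul_assoc, smul_mul_assoc, ← h1,
    smul_add, smul_smul, pow_two]
  abel

theorem mul_quasidet (hH : IsResolvent z a M H) (hG : IsResolvent z a (topBlock M) G) :
    H (Fin.last m) (Fin.last m) * quasidet z a M G = 1 := by
  have h1 := hH.apply_right (Fin.last m) (Fin.last m)
  rw [if_pos rfl, Fin.sum_univ_castSucc] at h1
  have h2 : ∑ i : Fin m, H (Fin.last m) i.castSucc * M i.castSucc (Fin.last m) =
      z • (H (Fin.last m) (Fin.last m) * (lastRow M ⬝ᵥ (G *ᵥ lastCol M))) := by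
    rw [Matrix.dotProduct_mulVec, dotProduct, Finset.mul_sum, Finset.smul_sum]
    refine Finset.sum_congr rfl fun i _ => ?_
    rw [show H (Fin.last m) i.castSucc = lastRow H i from rfl, lastRow_resolvent hH hG,
      smul_mul_assoc, mul_assoc]
    rfl
  rw [h2] at h1
  rw [quasidet, mul_sub, mul_sub, ← Algebra.commutes, ← Algebra.smul_def, mul_smul_comm,
    mul_smul_comm, ← h1, smul_add, smul_smul, pow_two]
  abel

/-- The commutator of `E_{m+1,l}` with the `l`-th entry of the resolvent applied to the last
column. -/
theorem commutator_lastRow (hM : IsTensorOperator M M) (hG : IsResolvent z a (topBlock M) G)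
    (l : Fin m) :
    1 - z • (lastRow M l * (G *ᵥ lastCol M) l - (G *ᵥ lastCol M) l * lastRow M l) =
      G l l * quasidet z a M G := by
  have hφ : ∀ i j, lastRow M l * topBlock M i j - topBlock M i j * lastRow M l =
      if i = l then lastRow M j else 0 := by
    intro i j
    rw [← neg_sub, hM.lastRow i j l]
    split_ifs <;> simp
  -- the commutator with an entry of the resolvent
  have hφG : ∀ j, lastRow M l * G l j - G l j * lastRow M l =
      z • (G l l * (lastRow M ᵥ* G) j) := by
    -- Commuting `lastRow M l` with row `l` of `G (a - z M) = 1` gives a linear system for these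
    -- commutators, which is again solved by `G`.
    have e : (fun j => lastRow M l * G l j - G l j * lastRow M l) =
        (z • fun j => G l l * lastRow M j) ᵥ* G := by
      apply hG.eq_vecMul
      ext j
      have h1 := hG.apply_right l j
      have h2 : lastRow M l * (if l = j then 1 else 0) - (if l = j then 1 else 0) * lastRow M l =
        (0 : S) := by split_ifs <;> simp
      rw [← h1] at h2
      have h3 := commutator_sum_mul Finset.univ (lastRow M l) (fun k => G l k)
        (fun k => topBlock M k j)
      simp only [hφ, mul_ite, mul_zero, Finset.sum_add_distrib, Finset.sum_ite_eq',
        Finset.mem_univ, if_true] at h3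
      rw [mul_sub, sub_mul, mul_smul_comm, mul_smul_comm, smul_mul_assoc, smul_mul_assoc,
        sub_sub_sub_comm, ← smul_sub, ← smul_sub, h3, smul_add, ← sub_sub, sub_eq_zero] at h2
      exact h2
    intro j
    rw [← vecMul_mul_left, ← Pi.smul_apply, ← Matrix.smul_vecMul]
    exact congrFun e j
  have hφψ : ∀ j, lastRow M l * lastCol M j - lastCol M j * lastRow M l =
      (if j = l then M (Fin.last m) (Fin.last m) else 0) - topBlock M j l := by
    intro j
    rw [← neg_sub, lastCol_lastRow hM, neg_sub]
  have h1 := hG.apply_right l l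
  -- The diagonal entry of the resolvent equation absorbs the sum of the `G l j * M j l`; in every
  -- remaining term `G l l` can be taken out on the left.
  rw [if_pos rfl] at h1
  rw [mulVec_apply_eq_sum, commutator_sum_mul]
  simp only [hφG, hφψ, mul_sub, mul_ite, mul_zero, Finset.sum_add_distrib, Finset.sum_sub_distrib,
    Finset.sum_ite_eq', Finset.mem_univ, if_true, smul_mul_assoc, mul_assoc, ← Finset.smul_sum,
    ← Finset.mul_sum]
  rw [quasidet, Matrix.dotProduct_mulVec, dotProduct, mul_sub, mul_sub, ← Algebra.commutes,
    ← Algebra.smul_def, mul_smul_comm, mul_smul_comm, ← h1, smul_add, smul_sub, smul_smul, pow_two]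
  abel

end Blocks

/-! ### Recursion for the trace of the resolvent -/

section Trace

open Matrix

variable {K S : Type*} [CommRing K] [Ring S] [Algebra K S] {m : ℕ}
variable {z a : K} {M H : Matrix (Fin (m + 1)) (Fin (m + 1)) S} {G G' : Matrix (Fin m) (Fin m) S}

/-- Write `φ` as `φ G (a - z M)` and move `M` to the other side by `sum_mulVec_mul_eq`, which
applies because `G ψ` and `φ G` are again a vector and a covector operator. -/
theorem sum_resolvent_mulVec_mul {κ : Type*} [Fintype κ] [DecidableEq κ] {M G : Matrix κ κ S}
    {ψ φ : κ → S} (hM : IsTensorOperator M M) (hG : IsResolvent z a M G)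
    (hψ : IsVectorOperator M ψ) (hφ : IsCovectorOperator M φ) :
    ∑ i, (G *ᵥ ψ) i * φ i = ∑ i, ψ i * (φ ᵥ* G) i := by
  have h := sum_mulVec_mul_eq (hψ.tensor_mulVec (hG.isTensorOperator hM))
    (hφ.vecMul_tensor (hG.isTensorOperator hM))
  have h1 : a • (G *ᵥ ψ) - z • (M *ᵥ (G *ᵥ ψ)) = ψ := by
    rw [Matrix.mulVec_mulVec, ← Matrix.smul_mulVec, ← Matrix.smul_mulVec, ← Matrix.sub_mulVec,
      hG.left, Matrix.one_mulVec]
  have h2 : a • (φ ᵥ* G) - z • (φ ᵥ* G ᵥ* M) = φ := by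
    rw [Matrix.vecMul_vecMul, ← Matrix.vecMul_smul, ← Matrix.vecMul_smul, ← Matrix.vecMul_sub,
      hG.right, Matrix.vecMul_one]
  calc ∑ i, (G *ᵥ ψ) i * φ i
      = ∑ i, (G *ᵥ ψ) i * (a • (φ ᵥ* G) - z • (φ ᵥ* G ᵥ* M)) i := by rw [h2]
    _ = ∑ i, (a • (G *ᵥ ψ) - z • (M *ᵥ (G *ᵥ ψ))) i * (φ ᵥ* G) i := by
      simp only [Pi.sub_apply, Pi.smul_apply, mul_sub, sub_mul, mul_smul_comm, smul_mul_assoc,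
        Finset.sum_sub_distrib, ← Finset.smul_sum]
      rw [h]
    _ = ∑ i, ψ i * (φ ᵥ* G) i := by rw [h1]

theorem lastCol_commutator_resolvent (hM : IsTensorOperator M M)
    (hG : IsResolvent z a (topBlock M) G) (i j l : Fin m) :
    lastCol M i * G l j - G l j * lastCol M i = -(z • ((G *ᵥ lastCol M) l * G i j)) := by
  have hψ : ∀ k l, lastCol M i * topBlock M k l - topBlock M k l * lastCol M i =
      if l = i then -lastCol M k else 0 := by
    intro k l
    rw [← neg_sub, hM.lastCol k l i]
    split_ifs <;> simp
  have e : (fun l => lastCol M i * G l j - G l j * lastCol M i) =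
      G *ᵥ (-(z • fun l => lastCol M l * G i j)) := by
    apply hG.eq_mulVec
    ext l
    have h1 := hG.apply_left l j
    have h2 : lastCol M i * (if l = j then 1 else 0) - (if l = j then 1 else 0) * lastCol M i =
      (0 : S) := by split_ifs <;> simp
    rw [← h1] at h2
    have h3 := commutator_sum_mul Finset.univ (lastCol M i) (fun k => topBlock M l k)
      (fun k => G k j)
    simp only [hψ, ite_mul, zero_mul, Finset.sum_add_distrib, Finset.sum_ite_eq',
      Finset.mem_univ, if_true] at h3
    rw [mul_sub, sub_mul, mul_smul_comm, mul_smul_comm, smul_mul_assoc, smul_mul_assoc,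
      sub_sub_sub_comm, ← smul_sub, ← smul_sub, h3, smul_add, ← sub_sub, sub_right_comm,
      sub_eq_zero] at h2
    rw [neg_mul, smul_neg] at h2
    exact h2
  rw [← mulVec_mul_right, ← Pi.smul_apply, ← Pi.neg_apply, ← Matrix.mulVec_smul,
    ← Matrix.mulVec_neg]
  exact congrFun e l

/-- Moving the column to the right of `lastRow M ᵥ* G` produces the trace of `topBlock M * G` and
multiples of the trace of `G`; the former is eliminated by the trace of the resolvent equation,
which is also the source of the constant `m`. -/
theorem smul_sum_lastCol_mul (hM : IsTensorOperator M M) (hG : IsResolvent z a (topBlock M) G) :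
    z • ∑ i, lastCol M i * (lastRow M ᵥ* G) i =
      z • (lastRow M ⬝ᵥ (G *ᵥ lastCol M)) - (m : S) + quasidet z a M G * G.trace := by
  have h1 : ∀ i, lastCol M i * (lastRow M ᵥ* G) i = (lastRow M ᵥ* G) i * lastCol M i +
      (∑ l, topBlock M i l * G l i - M (Fin.last m) (Fin.last m) * G i i -
        z • (lastRow M ⬝ᵥ (G *ᵥ lastCol M) * G i i)) := by
    intro i
    rw [← sub_eq_iff_eq_add', vecMul_apply_eq_sum, commutator_sum_mul]
    simp only [lastCol_lastRow hM, lastCol_commutator_resolvent hM hG, sub_mul, ite_mul, zero_mul,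
      Finset.sum_add_distrib, Finset.sum_sub_distrib, Finset.sum_ite_eq, Finset.mem_univ, if_true,
      mul_neg, mul_smul_comm, Finset.sum_neg_distrib, ← Finset.smul_sum, ← mul_assoc,
      ← Finset.sum_mul]
    rw [← sub_eq_add_neg, dotProduct]
  have h2 : z • ∑ i, ∑ l, topBlock M i l * G l i = a • G.trace - (m : S) := by
    rw [Finset.smul_sum, Matrix.trace, Finset.smul_sum, eq_sub_iff_add_eq, ← eq_sub_iff_add_eq',
      ← Finset.sum_sub_distrib]
    simp only [Matrix.diag, hG.apply_left, if_true]
    simp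
  rw [Finset.sum_congr rfl fun i _ => h1 i, Finset.sum_add_distrib, Finset.sum_sub_distrib,
    Finset.sum_sub_distrib, smul_add, smul_sub, smul_sub, h2, quasidet, sub_mul, sub_mul,
    Matrix.dotProduct_mulVec, dotProduct, ← Finset.mul_sum, ← Finset.smul_sum, ← Finset.mul_sum,
    ← Algebra.smul_def, smul_smul, ← pow_two, smul_mul_assoc, smul_mul_assoc]
  simp only [Matrix.trace, Matrix.diag]
  abel

/-- The trace of the resolvent in terms of the trace of the resolvent of the upper left block. -/
theorem one_sub_trace_resolvent (hM : IsTensorOperator M M) (hH : IsResolvent z a M H)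
    (hG : IsResolvent z a (topBlock M) G) (hG' : IsResolvent z (a - z) (topBlock M) G') :
    1 - z • H.trace = H (Fin.last m) (Fin.last m) *
      (quasidet z (a - z) M G' * (1 - z • G'.trace)) := by
  set A := H (Fin.last m) (Fin.last m) with hA
  have hT := hH.isTensorOperator hM
  have hcomm : ∀ i j, Commute A (G' i j) := by
    apply hG'.entry_commute
    intro i j
    have := hT i.castSucc j.castSucc (Fin.last m) (Fin.last m)
    rw [if_neg (Fin.castSucc_lt_last j).ne, if_neg (Fin.castSucc_lt_last i).ne, sub_zero,
      sub_eq_zero] at this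
    exact this.symm
  -- `H` is a tensor operator, so the commutator of its corner with a column entry of `M` is an
  -- entry of its own last column.
  have hb : ∀ i, A * lastCol M i = lastCol M i * A - z • ((G *ᵥ lastCol M) i * A) := by
    intro i
    have := hT i.castSucc (Fin.last m) (Fin.last m) (Fin.last m)
    rw [if_pos rfl, if_neg (Fin.castSucc_lt_last i).ne, sub_zero,
      show H i.castSucc (Fin.last m) = lastCol H i from rfl, lastCol_resolvent hH hG] at this
    rw [← this]
    exact (sub_sub_cancel _ _).symm
  -- Carrying the corner across the column shifts the parameter from `a` to `a - z`; this is why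
  -- `G'` enters the recursion.
  have hc : ∀ i, A * (G' *ᵥ lastCol M) i = (G *ᵥ lastCol M) i * A := by
    intro i
    calc A * (G' *ᵥ lastCol M) i = (G' *ᵥ fun j => A * lastCol M j) i := by
          simp only [mulVec_apply_eq_sum, Finset.mul_sum, ← mul_assoc, (hcomm _ _).eq]
      _ = ((G' - z • (G' * G)) *ᵥ lastCol M) i * A := by
          have : (fun j => A * lastCol M j) = (fun j => lastCol M j * A) -
              z • fun j => (G *ᵥ lastCol M) j * A := funext hb
          rw [this, Matrix.mulVec_sub, Matrix.mulVec_smul, Pi.sub_apply, Pi.smul_apply,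
            mulVec_mul_right, mulVec_mul_right, Matrix.mulVec_mulVec, Matrix.sub_mulVec,
            Matrix.smul_mulVec, Pi.sub_apply, Pi.smul_apply, sub_mul, smul_mul_assoc]
      _ = (G *ᵥ lastCol M) i * A := by rw [hG.mul_eq_sub hG', sub_sub_cancel]
  have hd : z • ∑ i, (G' *ᵥ lastCol M) i * (lastRow M ᵥ* G) i =
      ∑ i, lastCol M i * (lastRow M ᵥ* G') i - ∑ i, lastCol M i * (lastRow M ᵥ* G) i := by
    rw [sum_resolvent_mulVec_mul hM.topBlock hG' hM.lastCol
      (hM.lastRow.vecMul_tensor (hG.isTensorOperator hM.topBlock)), ← Finset.sum_sub_distrib,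
      Finset.smul_sum]
    refine Finset.sum_congr rfl fun i _ => ?_
    rw [Matrix.vecMul_vecMul, ← mul_sub, ← mul_smul_comm, ← Pi.smul_apply, ← Matrix.vecMul_smul,
      hG.mul_eq_sub' hG', Matrix.vecMul_sub, Pi.sub_apply]
  have hW : A * quasidet z a M G = 1 := mul_quasidet hH hG
  have hdiff : z ^ 2 • (lastRow M ⬝ᵥ (G' *ᵥ lastCol M)) - z ^ 2 • (lastRow M ⬝ᵥ (G *ᵥ lastCol M)) =
      quasidet z a M G - quasidet z (a - z) M G' - z • 1 := by
    rw [quasidet, quasidet, map_sub, Algebra.algebraMap_eq_smul_one z]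
    abel
  -- By `hc` the corner comes out on the left of every diagonal entry of `H`. What remains is a
  -- product with both `G'` and `G`, which the resolvent identity in `hd` splits into a difference.
  have htr : H.trace = A + (G.trace +
      A * (z • ∑ i, lastCol M i * (lastRow M ᵥ* G') i -
        z • ∑ i, lastCol M i * (lastRow M ᵥ* G) i)) := by
    rw [Matrix.trace, Fin.sum_univ_castSucc, add_comm]
    congr 1
    simp only [Matrix.diag, topBlock_resolvent hH hG, lastRow_resolvent hH hG,
      Finset.sum_add_distrib, ← hA]
    rw [Matrix.trace, ← smul_sub, ← hd]
    congr 1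
    rw [smul_smul, Finset.smul_sum, Finset.mul_sum]
    refine Finset.sum_congr rfl fun i _ => ?_
    rw [mul_smul_comm, smul_smul, mul_smul_comm, ← mul_assoc, ← mul_assoc, hc]
  rw [htr, smul_sum_lastCol_mul hM hG, smul_sum_lastCol_mul hM hG']
  have e : A * (z • (lastRow M ⬝ᵥ (G' *ᵥ lastCol M)) - (m : S) +
      quasidet z (a - z) M G' * G'.trace - (z • (lastRow M ⬝ᵥ (G *ᵥ lastCol M)) - (m : S) +
      quasidet z a M G * G.trace)) =
      A * (z • (lastRow M ⬝ᵥ (G' *ᵥ lastCol M)) - z • (lastRow M ⬝ᵥ (G *ᵥ lastCol M))) +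
      A * (quasidet z (a - z) M G' * G'.trace) - A * quasidet z a M G * G.trace := by
    noncomm_ring
  rw [e, hW, one_mul, smul_add, smul_add, smul_sub, smul_add, ← mul_smul_comm, smul_sub,
    smul_smul, smul_smul, ← pow_two, hdiff, mul_sub, mul_sub, hW, mul_sub, mul_sub, mul_one,
    mul_smul_comm, mul_smul_comm, mul_smul_comm, mul_one]
  abel

end Trace

/-! ### Resolvents as power series -/

section Series

open Matrix PowerSeries

variable {A : Type*} [Ring A] [Algebra ℂ A]

/-- Power series over `A` as an algebra over the power series with complex coefficients. -/
@[reducible] def seriesAlgebra (A : Type*) [Ring A] [Algebra ℂ A] :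
    Algebra (PowerSeries ℂ) (PowerSeries A) :=
  (PowerSeries.map (algebraMap ℂ A)).toAlgebra' fun f x => by
    ext p
    simp only [coeff_mul, coeff_map]
    rw [← Finset.Nat.sum_antidiagonal_swap]
    exact Finset.sum_congr rfl fun q _ => Algebra.commutes _ _

attribute [local instance] seriesAlgebra

theorem series_smul_def (f : PowerSeries ℂ) (x : PowerSeries A) :
    f • x = PowerSeries.map (algebraMap ℂ A) f * x := rfl

theorem series_X_smul (x : PowerSeries A) : (X : PowerSeries ℂ) • x = X * x := by
  rw [series_smul_def, map_X]

variable {κ : Type*} [Fintype κ] [DecidableEq κ]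

/-- `∑ M^p z^p`, the inverse of `1 - z M`. -/
def resolventSeries (M : Matrix κ κ A) : Matrix κ κ (PowerSeries A) :=
  fun i j => mk fun p => (M ^ p) i j

/-- `∑ tr(M^p) z^p` -/
def traceSeries (M : Matrix κ κ A) : PowerSeries A := mk fun p => (M ^ p).trace

omit [Algebra ℂ A] in
theorem trace_resolventSeries (M : Matrix κ κ A) : (resolventSeries M).trace = traceSeries M := by
  ext p
  simp [resolventSeries, traceSeries, Matrix.trace]

/-- With `a = 1 - b z` the resolvent is the geometric series of `M + b`, so passing from `a` to `a -
z` means passing from `b` to `b + 1`. -/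
theorem isResolvent_resolventSeries (M : Matrix κ κ A) (b : ℂ) :
    IsResolvent (X : PowerSeries ℂ) (1 - C b * X) (M.map (C (R := A)))
      (resolventSeries (M + b • 1)) := by
  have key : ∀ (p : ℕ) (i j : κ), ((M + b • 1) ^ (p + 1)) i j - b • ((M + b • 1) ^ p) i j =
      (M * (M + b • 1) ^ p) i j ∧ ((M + b • 1) ^ (p + 1)) i j - b • ((M + b • 1) ^ p) i j =
      ((M + b • 1) ^ p * M) i j := by
    intro p i j
    constructor
    · rw [pow_succ', add_mul, smul_mul_assoc, one_mul, Matrix.add_apply, Matrix.smul_apply,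
        add_sub_cancel_right]
    · rw [pow_succ, mul_add, mul_smul_comm, mul_one, Matrix.add_apply, Matrix.smul_apply,
        add_sub_cancel_right]
  have h1 : ∀ i j, (1 - C b * X : PowerSeries ℂ) • resolventSeries (M + b • 1) i j =
      C ((1 : Matrix κ κ A) i j) + X * mk fun p => ((M + b • 1) ^ (p + 1)) i j -
        b • ((M + b • 1) ^ p) i j := by
    intro i j
    rw [sub_smul, one_smul, mul_smul, series_X_smul, series_smul_def, map_C]
    ext p
    rw [map_sub, coeff_C_mul]
    cases p with
    | zero => simp [resolventSeries]
    | succ p => simp [resolventSeries, coeff_succ_X_mul, Algebra.smul_def]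
  constructor
  · ext1 i j
    rw [Matrix.sub_apply, Matrix.smul_apply, Matrix.smul_apply, h1, series_X_smul]
    have : (M.map (C (R := A)) * resolventSeries (M + b • 1) : Matrix κ κ (PowerSeries A)) i j =
        mk fun p => ((M + b • 1) ^ (p + 1)) i j - b • ((M + b • 1) ^ p) i j := by
      ext p
      rw [coeff_mk, (key p i j).1, Matrix.mul_apply, Matrix.mul_apply, map_sum]
      simp [resolventSeries]
    rw [this, add_sub_cancel_right, Matrix.one_apply, Matrix.one_apply]
    split_ifs <;> simp
  · ext1 i j
    rw [Matrix.sub_apply, Matrix.smul_apply, Matrix.smul_apply, h1, series_X_smul]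
    have : (resolventSeries (M + b • 1) * M.map (C (R := A)) : Matrix κ κ (PowerSeries A)) i j =
        mk fun p => ((M + b • 1) ^ (p + 1)) i j - b • ((M + b • 1) ^ p) i j := by
      ext p
      rw [coeff_mk, (key p i j).2, Matrix.mul_apply, Matrix.mul_apply, map_sum]
      simp [resolventSeries]
    rw [this, add_sub_cancel_right, Matrix.one_apply, Matrix.one_apply]
    split_ifs <;> simp

omit [Algebra ℂ A] [Fintype κ] in
theorem IsTensorOperator.map_C {M : Matrix κ κ A} (h : IsTensorOperator M M) :
    IsTensorOperator (M.map (C (R := A))) (M.map (C (R := A))) := by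
  intro i j k l
  simp only [Matrix.map_apply]
  rw [← map_mul, ← map_mul, ← map_sub, h i j k l]
  split_ifs <;> simp

variable {m : ℕ}

/-- The inverse of the lower right entry of `∑ (M + b)^p z^p`. -/
def quasidetSeries (b : ℂ) (M : Matrix (Fin (m + 1)) (Fin (m + 1)) A) : PowerSeries A :=
  quasidet (X : PowerSeries ℂ) (1 - C b * X) (M.map (C (R := A)))
    (resolventSeries (topBlock M + b • 1))

theorem isResolvent_topBlock (M : Matrix (Fin (m + 1)) (Fin (m + 1)) A) (b : ℂ) :
    IsResolvent (X : PowerSeries ℂ) (1 - C b * X) (topBlock (M.map (C (R := A))))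
      (resolventSeries (topBlock M + b • 1)) :=
  isResolvent_resolventSeries (topBlock M) b

theorem quasidetSeries_mul (b : ℂ) (M : Matrix (Fin (m + 1)) (Fin (m + 1)) A) :
    quasidetSeries b M * resolventSeries (M + b • 1) (Fin.last m) (Fin.last m) = 1 :=
  quasidet_mul (isResolvent_resolventSeries M b) (isResolvent_topBlock M b)

theorem mul_quasidetSeries (b : ℂ) (M : Matrix (Fin (m + 1)) (Fin (m + 1)) A) :
    resolventSeries (M + b • 1) (Fin.last m) (Fin.last m) * quasidetSeries b M = 1 :=
  mul_quasidet (isResolvent_resolventSeries M b) (isResolvent_topBlock M b)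

theorem quasidetSeries_zero (b : ℂ) (M : Matrix (Fin 1) (Fin 1) A) :
    quasidetSeries b M = 1 - X * C (M 0 0 + algebraMap ℂ A b) := by
  rw [quasidetSeries, quasidet, dotProduct, Fin.sum_univ_zero, smul_zero, sub_zero, series_X_smul]
  change PowerSeries.map (algebraMap ℂ A) _ - _ = _
  rw [map_sub, map_one, map_mul, map_C, map_X, (commute_X (C _)).eq, map_add, mul_add, sub_sub,
    add_comm]
  rfl

/-- This is `commutator_lastRow` for the last index: there the diagonal entry of the smaller
resolvent is the inverse of the preceding quasideterminant. -/
theorem quasidetSeries_succ (b : ℂ) {M : Matrix (Fin (m + 2)) (Fin (m + 2)) A}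
    (hM : IsTensorOperator M M) :
    quasidetSeries b M = quasidetSeries b (topBlock M) *
      (1 - X * mk fun p =>
        lastRow M (Fin.last m) * ((topBlock M + b • 1) ^ p *ᵥ lastCol M) (Fin.last m) -
        ((topBlock M + b • 1) ^ p *ᵥ lastCol M) (Fin.last m) * lastRow M (Fin.last m)) := by
  have h := commutator_lastRow hM.map_C (isResolvent_topBlock M b) (Fin.last m)
  have e1 : (resolventSeries (topBlock M + b • 1) *ᵥ lastCol (M.map (C (R := A)))) (Fin.last m) =
      mk fun p => ((topBlock M + b • 1) ^ p *ᵥ lastCol M) (Fin.last m) := by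
    ext p
    rw [mulVec_apply_eq_sum, map_sum, coeff_mk, mulVec_apply_eq_sum]
    simp [resolventSeries, lastCol]
  have e2 : lastRow (M.map (C (R := A))) (Fin.last m) = C (lastRow M (Fin.last m)) := rfl
  have e3 : C (lastRow M (Fin.last m)) *
      (mk fun p => ((topBlock M + b • 1) ^ p *ᵥ lastCol M) (Fin.last m)) -
      (mk fun p => ((topBlock M + b • 1) ^ p *ᵥ lastCol M) (Fin.last m)) *
        C (lastRow M (Fin.last m)) = mk fun p =>
        lastRow M (Fin.last m) * ((topBlock M + b • 1) ^ p *ᵥ lastCol M) (Fin.last m) -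
        ((topBlock M + b • 1) ^ p *ᵥ lastCol M) (Fin.last m) * lastRow M (Fin.last m) := by
    ext p
    simp
  rw [e1, e2, e3, series_X_smul] at h
  rw [h, ← mul_assoc, quasidetSeries_mul, one_mul]
  rfl

theorem one_sub_traceSeries (b : ℂ) {M : Matrix (Fin (m + 1)) (Fin (m + 1)) A}
    (hM : IsTensorOperator M M) :
    1 - X * traceSeries (M + b • 1) =
      resolventSeries (M + b • 1) (Fin.last m) (Fin.last m) *
        (quasidetSeries (b + 1) M * (1 - X * traceSeries (topBlock M + (b + 1) • 1))) := by
  have e : (1 - C (b + 1) * X : PowerSeries ℂ) = 1 - C b * X - X := by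
    rw [map_add, map_one]; ring
  have h := one_sub_trace_resolvent hM.map_C (isResolvent_resolventSeries M b)
    (isResolvent_topBlock M b) (G' := resolventSeries (topBlock M + (b + 1) • 1))
    (by rw [← e]; exact isResolvent_topBlock M (b + 1))
  rw [← e, trace_resolventSeries, trace_resolventSeries, series_X_smul, series_X_smul] at h
  exact h

end Series

/-! ### Power series of operators acting by scalars -/

section ActsBy

open PowerSeries

variable {V : Type*} [AddCommGroup V] [Module ℂ V]

/-- All coefficients of `x` act on `v` by the corresponding coefficients of `f`. -/
def ActsBy (x : PowerSeries (Module.End ℂ V)) (v : V) (f : PowerSeries ℂ) : Prop :=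
  ∀ p, coeff p x v = coeff p f • v

variable {x y : PowerSeries (Module.End ℂ V)} {v : V} {f g : PowerSeries ℂ}

theorem coeff_mul_apply (hy : ActsBy y v g) (p : ℕ) :
    coeff p (x * y) v = ∑ q ∈ Finset.HasAntidiagonal.antidiagonal p, coeff q.2 g • coeff q.1 x v := by
  rw [coeff_mul, LinearMap.sum_apply]
  refine Finset.sum_congr rfl fun q _ => ?_
  rw [Module.End.mul_apply, hy q.2, map_smul]

theorem ActsBy.mul (hx : ActsBy x v f) (hy : ActsBy y v g) : ActsBy (x * y) v (f * g) := by
  intro p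
  rw [coeff_mul_apply hy, coeff_mul, Finset.sum_smul]
  refine Finset.sum_congr rfl fun q _ => ?_
  rw [hx q.1, smul_smul, mul_comm]

theorem ActsBy.one (v : V) : ActsBy 1 v 1 := by
  intro p
  rw [coeff_one, coeff_one]
  split_ifs <;> simp

theorem ActsBy.sub (hx : ActsBy x v f) (hy : ActsBy y v g) : ActsBy (x - y) v (f - g) := by
  intro p
  rw [map_sub, map_sub, LinearMap.sub_apply, hx p, hy p, sub_smul]

theorem ActsBy.X_mul (hx : ActsBy x v f) : ActsBy (X * x) v (X * f) := by
  intro p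
  cases p with
  | zero => simp
  | succ p => rw [coeff_succ_X_mul, coeff_succ_X_mul, hx p]

theorem ActsBy.coeff_of_one_sub_X_mul (h : ActsBy (1 - X * x) v f) (p : ℕ) :
    coeff p x v = -coeff (p + 1) f • v := by
  have := h (p + 1)
  rw [map_sub, LinearMap.sub_apply, coeff_one, if_neg p.succ_ne_zero, LinearMap.zero_apply,
    zero_sub, coeff_succ_X_mul] at this
  rw [neg_smul, ← this, neg_neg]

theorem ActsBy.one_sub_X_mul_zero (v : V) :
    ActsBy (1 - X * (0 : PowerSeries (Module.End ℂ V))) v 1 := by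
  rw [mul_zero, sub_zero]
  exact ActsBy.one v

/-- Nothing is known about `x` alone. Multiplying `y` by the scalar series `g'` gives a series
acting on `v` as `1`, so `x` and `x * y * g'` agree on `v`. -/
theorem ActsBy.of_mul_right (hxy : ActsBy (x * y) v f) (hy : ActsBy y v g) {g' : PowerSeries ℂ}
    (hg : g * g' = 1) : ActsBy x v (f * g') := by
  have h0 : ActsBy (PowerSeries.map (algebraMap ℂ (Module.End ℂ V)) g') v g' := by
    intro p
    rw [coeff_map, Module.algebraMap_end_apply]
  have h1 := hxy.mul h0
  have h2 := hy.mul h0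
  rw [hg] at h2
  intro p
  rw [← h1 p, mul_assoc, coeff_mul_apply h2, Finset.sum_eq_single (p, 0)]
  · simp
  · rintro ⟨i, j⟩ hq hne
    rw [Finset.HasAntidiagonal.mem_antidiagonal] at hq
    have : j ≠ 0 := by
      rintro rfl
      exact hne (by simpa using hq)
    rw [coeff_one, if_neg this, zero_smul]
  · simp

end ActsBy

/-! ### Partial fractions -/

section PartialFractions

open Polynomial

variable {ι : Type*} [DecidableEq ι] (s : Finset ι) (r : ι → ℂ) (N : ℂ[X])

/-- `∏ (t - r_j) ∏ (t - r_j + 1)` -/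
def nodePoly (s s' : Finset ι) (r : ι → ℂ) : ℂ[X] :=
  (∏ j ∈ s, (X - C (r j))) * ∏ j ∈ s', (X - C (r j - 1))

/-- Minus the residue of `N(t) / ∏ (t - r_j) (t - r_j + 1)` at `r_a`. -/
def resPlus (a : ι) : ℂ :=
  -(N.eval (r a) / ((∏ j ∈ s.erase a, (r a - r j)) * ∏ j ∈ s.erase a, (r a + 1 - r j)))

/-- The residue of `N(t) / ∏ (t - r_j) (t - r_j + 1)` at `r_a - 1`. -/
def resMinus (a : ι) : ℂ :=
  -(N.eval (r a - 1) / ((∏ j ∈ s.erase a, (r a - 1 - r j)) * ∏ j ∈ s.erase a, (r a - r j)))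

/-- The numerator of the difference between `N(t) / ∏ (t - r_j) (t - r_j + 1)` and its expected
partial fraction decomposition. -/
def defect : ℂ[X] :=
  N - nodePoly s s r + ∑ a ∈ s, C (resPlus s r N a) * nodePoly (s.erase a) s r -
    ∑ a ∈ s, C (resMinus s r N a) * nodePoly s (s.erase a) r

variable {s r N}

omit [DecidableEq ι] in
theorem nodePoly_monic (s s' : Finset ι) (r : ι → ℂ) : (nodePoly s s' r).Monic :=
  (monic_prod_of_monic _ _ fun _ _ => monic_X_sub_C _).mul
    (monic_prod_of_monic _ _ fun _ _ => monic_X_sub_C _)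

omit [DecidableEq ι] in
theorem nodePoly_natDegree (s s' : Finset ι) (r : ι → ℂ) :
    (nodePoly s s' r).natDegree = s.card + s'.card := by
  rw [nodePoly, (monic_prod_of_monic _ _ fun _ _ => monic_X_sub_C _).natDegree_mul
    (monic_prod_of_monic _ _ fun _ _ => monic_X_sub_C _), natDegree_prod_of_monic _ _
    fun _ _ => monic_X_sub_C _, natDegree_prod_of_monic _ _ fun _ _ => monic_X_sub_C _]
  simp only [natDegree_X_sub_C, Finset.sum_const, smul_eq_mul, mul_one]

omit [DecidableEq ι] in
theorem degree_nodePoly (s s' : Finset ι) (r : ι → ℂ) :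
    (nodePoly s s' r).degree = (s.card + s'.card : ℕ) := by
  rw [degree_eq_natDegree (nodePoly_monic s s' r).ne_zero, nodePoly_natDegree]

theorem degree_C_mul_le' (c : ℂ) (p : ℂ[X]) : (C c * p).degree ≤ p.degree := by
  rw [← smul_eq_C_mul]
  exact degree_smul_le c p

theorem degree_defect_lt (hN : N.Monic) (hd : N.natDegree = 2 * s.card) :
    (defect s r N).degree < (2 * s.card : ℕ) := by
  have hlt : ∀ a ∈ s, ((s.erase a).card + s.card : ℕ) < 2 * s.card := by
    intro a ha
    have := Finset.card_erase_lt_of_mem ha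
    omega
  refine (degree_sub_le _ _).trans_lt (max_lt ((degree_add_le _ _).trans_lt (max_lt ?_ ?_)) ?_)
  · have h1 : N.degree = (2 * s.card : ℕ) := by rw [degree_eq_natDegree hN.ne_zero, hd]
    rw [← h1]
    refine degree_sub_lt_left (by rw [h1, degree_nodePoly, two_mul]) hN.ne_zero ?_
    rw [hN.leadingCoeff, (nodePoly_monic s s r).leadingCoeff]
  · refine (degree_sum_le _ _).trans_lt ((Finset.sup_lt_iff (WithBot.bot_lt_coe _)).2 fun a ha => ?_)
    refine (degree_C_mul_le' _ _).trans_lt ?_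
    rw [degree_nodePoly]
    exact_mod_cast hlt a ha
  · refine (degree_sum_le _ _).trans_lt ((Finset.sup_lt_iff (WithBot.bot_lt_coe _)).2 fun a ha => ?_)
    refine (degree_C_mul_le' _ _).trans_lt ?_
    rw [degree_nodePoly, add_comm]
    exact_mod_cast hlt a ha

/-- At a double node the denominator is zero, and the convention `x / 0 = 0` gives the intended
weight: for admissible relations, raising `r a` to the value `r j` in the same row is forbidden. -/
theorem resPlus_eq_zero {a j : ι} (hj : j ∈ s) (h : r j = r a + 1) : resPlus s r N a = 0 := by
  have hja : j ≠ a := by rintro rfl; simp at h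
  rw [resPlus, Finset.prod_eq_zero (i := j) (s := s.erase a) (f := fun j => r a + 1 - r j)
    (Finset.mem_erase.2 ⟨hja, hj⟩) (by rw [h, sub_self]), mul_zero, div_zero, neg_zero]

theorem resMinus_eq_zero {a j : ι} (ha : a ∈ s) (h : r j = r a + 1) : resMinus s r N j = 0 := by
  have hja : a ≠ j := by rintro rfl; simp at h
  rw [resMinus, Finset.prod_eq_zero (i := a) (s := s.erase j) (f := fun i => r j - 1 - r i)
    (Finset.mem_erase.2 ⟨hja, ha⟩) (by rw [h]; ring), zero_mul, div_zero, neg_zero]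

omit [DecidableEq ι] in
theorem eval_nodePoly (s s' : Finset ι) (r : ι → ℂ) (x : ℂ) :
    (nodePoly s s' r).eval x = (∏ j ∈ s, (x - r j)) * ∏ j ∈ s', (x + 1 - r j) := by
  rw [nodePoly, eval_mul, eval_prod, eval_prod]
  simp only [eval_sub, eval_X, eval_C]
  congr 1
  exact Finset.prod_congr rfl fun j _ => by ring

/-- At a simple node a single summand survives, and `resPlus` is chosen so that it cancels `N`. At a
double node every summand vanishes, `N` by assumption. -/
theorem eval_defect_node (hr : Set.InjOn r s)
    (hcrit : ∀ a ∈ s, ∀ j ∈ s, r j = r a + 1 → N.eval (r a) = 0) {a : ι} (ha : a ∈ s) :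
    (defect s r N).eval (r a) = 0 := by
  simp only [defect, eval_sub, eval_add, eval_finsetSum, eval_mul, eval_C, eval_nodePoly]
  have h0 : ∏ j ∈ s, (r a - r j) = 0 := Finset.prod_eq_zero ha (sub_self _)
  rw [h0, Finset.sum_eq_single a (fun b _ hb => by
    rw [Finset.prod_eq_zero (Finset.mem_erase.2 ⟨hb.symm, ha⟩) (sub_self _), zero_mul,
      mul_zero]) (fun h => absurd ha h), Finset.sum_eq_zero (fun b _ => by rw [zero_mul, mul_zero]),
    zero_mul, sub_zero, sub_zero]
  by_cases hc : ∃ j ∈ s, r j = r a + 1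
  · obtain ⟨j, hj, e⟩ := hc
    rw [hcrit a ha j hj e, resPlus_eq_zero hj e, zero_mul, add_zero]
  · push Not at hc
    have h1 : ∏ j ∈ s.erase a, (r a - r j) ≠ 0 := Finset.prod_ne_zero_iff.2 fun j hj =>
      sub_ne_zero.2 fun e => (Finset.mem_erase.1 hj).1 (hr (Finset.mem_erase.1 hj).2 ha e.symm)
    have h2 : ∏ j ∈ s.erase a, (r a + 1 - r j) ≠ 0 := Finset.prod_ne_zero_iff.2 fun j hj =>
      sub_ne_zero.2 fun e => hc j (Finset.mem_erase.1 hj).2 e.symm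
    rw [resPlus, ← Finset.mul_prod_erase s _ ha]
    field_simp
    ring

theorem eval_defect_node_sub_one (hr : Set.InjOn r s)
    (hcrit : ∀ a ∈ s, ∀ j ∈ s, r j = r a + 1 → N.eval (r a) = 0) {a : ι} (ha : a ∈ s) :
    (defect s r N).eval (r a - 1) = 0 := by
  simp only [defect, eval_sub, eval_add, eval_finsetSum, eval_mul, eval_C, eval_nodePoly,
    sub_add_cancel]
  have h0 : ∏ j ∈ s, (r a - r j) = 0 := Finset.prod_eq_zero ha (sub_self _)
  rw [h0, Finset.sum_eq_zero (fun b _ => by rw [mul_zero, mul_zero]),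
    Finset.sum_eq_single a (fun b _ hb => by
    rw [Finset.prod_eq_zero (i := a) (s := s.erase b) (f := fun j => r a - r j)
      (Finset.mem_erase.2 ⟨hb.symm, ha⟩) (sub_self _), mul_zero,
      mul_zero]) (fun h => absurd ha h), mul_zero, sub_zero, add_zero]
  by_cases hc : ∃ j ∈ s, r a = r j + 1
  · obtain ⟨j, hj, e⟩ := hc
    have := hcrit j hj a ha e
    rw [resMinus_eq_zero hj e, zero_mul, sub_zero, ← this, e, add_sub_cancel_right]
  · push Not at hc
    have h1 : ∏ j ∈ s.erase a, (r a - r j) ≠ 0 := Finset.prod_ne_zero_iff.2 fun j hj =>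
      sub_ne_zero.2 fun e => (Finset.mem_erase.1 hj).1 (hr (Finset.mem_erase.1 hj).2 ha e.symm)
    have h2 : ∏ j ∈ s.erase a, (r a - 1 - r j) ≠ 0 := Finset.prod_ne_zero_iff.2 fun j hj =>
      sub_ne_zero.2 fun e => hc j (Finset.mem_erase.1 hj).2 (by rw [← e]; ring)
    rw [resMinus, ← Finset.mul_prod_erase s _ ha]
    field_simp
    ring

omit [DecidableEq ι] in
theorem sq_dvd_nodePoly {s s' : Finset ι} {a j : ι} (ha : a ∈ s) (hj : j ∈ s')
    (h : r j = r a + 1) : (X - C (r a)) ^ 2 ∣ nodePoly s s' r := by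
  rw [pow_two]
  refine mul_dvd_mul (Finset.dvd_prod_of_mem _ ha) ?_
  have : X - C (r a) = X - C (r j - 1) := by rw [h, add_sub_cancel_right]
  rw [this]
  exact Finset.dvd_prod_of_mem (fun j => X - C (r j - 1)) hj

/-- The factors `X - r a` and `X - (r j - 1)` coincide. A summand lacking one of them has
coefficient zero, and all the others contain both. -/
theorem sq_dvd_defect_sub {a j : ι} (ha : a ∈ s) (hj : j ∈ s)
    (h : r j = r a + 1) : (X - C (r a)) ^ 2 ∣ defect s r N - N := by
  have e : defect s r N - N = - nodePoly s s r + ∑ a ∈ s, C (resPlus s r N a) *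
      nodePoly (s.erase a) s r - ∑ a ∈ s, C (resMinus s r N a) * nodePoly s (s.erase a) r := by
    rw [defect]; ring
  rw [e]
  refine dvd_sub (dvd_add (dvd_neg.2 (sq_dvd_nodePoly ha hj h)) (Finset.dvd_sum fun b hb => ?_))
    (Finset.dvd_sum fun b hb => ?_)
  · by_cases hab : b = a
    · rw [hab, resPlus_eq_zero hj h, C_0, zero_mul]
      exact dvd_zero _
    · exact (sq_dvd_nodePoly (Finset.mem_erase.2 ⟨Ne.symm hab, ha⟩) hj h).mul_left _
  · by_cases hbj : b = j
    · rw [hbj, resMinus_eq_zero ha h, C_0, zero_mul]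
      exact dvd_zero _
    · exact (sq_dvd_nodePoly ha (Finset.mem_erase.2 ⟨Ne.symm hbj, hj⟩) h).mul_left _

/-- The partial fraction decomposition holds if all double nodes are double zeros of `N`. -/
theorem defect_eq_zero (hr : Set.InjOn r s) (hN : N.Monic) (hd : N.natDegree = 2 * s.card)
    (hcrit : ∀ a ∈ s, ∀ j ∈ s, r j = r a + 1 → (X - C (r a)) ^ 2 ∣ N) : defect s r N = 0 := by
  have hcrit' : ∀ a ∈ s, ∀ j ∈ s, r j = r a + 1 → N.eval (r a) = 0 := fun a ha j hj h =>
    dvd_iff_isRoot.1 ((dvd_pow_self _ two_ne_zero).trans (hcrit a ha j hj h))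
  by_contra h0
  -- Counted with multiplicity, the nodes are `2 * s.card` zeros, more than the degree allows.
  have hle : s.val.map r + s.val.map (fun j => r j - 1) ≤ (defect s r N).roots := by
    rw [Multiset.le_iff_count]
    intro x
    have n1 : (s.val.map r).Nodup := Multiset.Nodup.map_on (fun a ha b hb e => hr ha hb e) s.nodup
    have n2 : (s.val.map fun j => r j - 1).Nodup :=
      Multiset.Nodup.map_on (fun a ha b hb e => hr ha hb (sub_left_injective e)) s.nodup
    rw [Multiset.count_add, Multiset.count_eq_of_nodup n1, Multiset.count_eq_of_nodup n2,
      count_roots, le_rootMultiplicity_iff h0]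
    by_cases h1 : x ∈ s.val.map r
    · obtain ⟨a, ha, rfl⟩ := Multiset.mem_map.1 h1
      by_cases h2 : r a ∈ s.val.map fun j => r j - 1
      · obtain ⟨j, hj, e⟩ := Multiset.mem_map.1 h2
        rw [if_pos h1, if_pos h2]
        have e' : r j = r a + 1 := by rw [← e]; ring
        have := dvd_add (sq_dvd_defect_sub (N := N) ha hj e') (hcrit a ha j hj e')
        rwa [sub_add_cancel] at this
      · rw [if_pos h1, if_neg h2, add_zero, pow_one]
        exact dvd_iff_isRoot.2 (eval_defect_node hr hcrit' ha)
    · rw [if_neg h1, zero_add]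
      split_ifs with h2
      · obtain ⟨j, hj, rfl⟩ := Multiset.mem_map.1 h2
        rw [pow_one]
        exact dvd_iff_isRoot.2 (eval_defect_node_sub_one hr hcrit' hj)
      · rw [pow_zero]
        exact one_dvd _
  have h1 := Multiset.card_le_card hle
  rw [Multiset.card_add, Multiset.card_map, Multiset.card_map, Finset.card_val] at h1
  have h2 := (card_roots' (defect s r N)).trans_lt
    ((natDegree_lt_iff_degree_lt h0).2 (degree_defect_lt hN hd))
  omega

/-- If there is only one double node, then `N` has a double zero there as soon as it vanishes and
the residues sum up to the right value. -/
theorem sq_dvd_of_unique (hr : Set.InjOn r s) (hN : N.Monic) (hd : N.natDegree = 2 * s.card)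
    {a j : ι} (ha : a ∈ s) (hj : j ∈ s) (haj : r j = r a + 1) (h0 : N.eval (r a) = 0)
    (huniq : ∀ b ∈ s, ∀ i ∈ s, r i = r b + 1 → b = a)
    (hsum : N.coeff (2 * s.card - 1) - (nodePoly s s r).coeff (2 * s.card - 1) +
      ∑ a ∈ s, (resPlus s r N a - resMinus s r N a) = 0) : (X - C (r a)) ^ 2 ∣ N := by
  have hcrit : ∀ a ∈ s, ∀ j ∈ s, r j = r a + 1 → N.eval (r a) = 0 := by
    intro b hb i hi h
    rw [huniq b hb i hi h, h0]
  have hpos : 0 < s.card := Finset.card_pos.2 ⟨a, ha⟩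
  have hlead : ∀ t t' : Finset ι, t.card + t'.card = 2 * s.card - 1 →
      (nodePoly t t' r).coeff (2 * s.card - 1) = 1 := by
    intro t t' h
    rw [← h, ← nodePoly_natDegree t t' r]
    exact (nodePoly_monic t t' r).coeff_natDegree
  -- Because of the double node only `2 * s.card - 1` distinct zeros are available. The condition on
  -- the residues makes up for this by lowering the bound on the degree by one.
  have hcoeff : (defect s r N).coeff (2 * s.card - 1) = 0 := by
    rw [← hsum, defect, coeff_sub, coeff_add, coeff_sub, finsetSum_coeff, finsetSum_coeff,
      Finset.sum_sub_distrib, ← add_sub_assoc]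
    congr 1
    · congr 1
      refine Finset.sum_congr rfl fun b hb => ?_
      rw [coeff_C_mul, hlead, mul_one]
      rw [Finset.card_erase_of_mem hb]; omega
    · refine Finset.sum_congr rfl fun b hb => ?_
      rw [coeff_C_mul, hlead, mul_one]
      rw [Finset.card_erase_of_mem hb]; omega
  have hdeg : (defect s r N).degree < (2 * s.card - 1 : ℕ) := by
    rw [degree_lt_iff_coeff_zero]
    intro p hp
    rcases hp.lt_or_eq with h | h
    · exact (degree_lt_iff_coeff_zero _ _).1 (degree_defect_lt hN hd) p (by omega)
    · rw [← h, hcoeff]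
  have hcard : (s.image r ∪ s.image fun j => r j - 1).card = 2 * s.card - 1 := by
    have h1 : (s.image r ∩ s.image fun j => r j - 1) = {r a} := by
      ext x
      rw [Finset.mem_inter, Finset.mem_image, Finset.mem_image, Finset.mem_singleton]
      constructor
      · rintro ⟨⟨b, hb, rfl⟩, ⟨i, hi, e⟩⟩
        rw [huniq b hb i hi (by rw [← e]; ring)]
      · rintro rfl
        exact ⟨⟨a, ha, rfl⟩, ⟨j, hj, by rw [haj]; ring⟩⟩
    have h2 := Finset.card_union_add_card_inter (s.image r) (s.image fun j => r j - 1)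
    rw [h1, Finset.card_singleton, Finset.card_image_of_injOn hr, Finset.card_image_of_injOn
      fun a ha b hb e => hr ha hb (sub_left_injective e)] at h2
    omega
  have hzero : defect s r N = 0 := by
    refine eq_zero_of_degree_lt_of_eval_finset_eq_zero _ (hcard ▸ hdeg) fun x hx => ?_
    rcases Finset.mem_union.1 hx with h | h
    · obtain ⟨b, hb, rfl⟩ := Finset.mem_image.1 h
      exact eval_defect_node hr hcrit hb
    · obtain ⟨b, hb, rfl⟩ := Finset.mem_image.1 h
      exact eval_defect_node_sub_one hr hcrit hb
  have := sq_dvd_defect_sub (N := N) ha hj haj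
  rw [hzero, zero_sub] at this
  exact (dvd_neg.1 this)

end PartialFractions

/-! ### Products of linear factors as power series -/

section LinearFactors

open Polynomial

variable {ι : Type*} [DecidableEq ι] {s : Finset ι} {r : ι → ℂ}

/-- `∏ (1 - r_j z)` -/
def linPoly (s : Finset ι) (r : ι → ℂ) : ℂ[X] := ∏ j ∈ s, (1 - C (r j) * X)

/-- `∏ (1 - r_j z)` as a power series. -/
def linProd (s : Finset ι) (r : ι → ℂ) : PowerSeries ℂ := (linPoly s r : ℂ[X])

/-- `1 / (1 - x z)` -/
def geomSeries (x : ℂ) : PowerSeries ℂ := PowerSeries.mk fun p => x ^ p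

/-- `∏ 1 / (1 - r_j z)` -/
def invProd (s : Finset ι) (r : ι → ℂ) : PowerSeries ℂ := ∏ j ∈ s, geomSeries (r j)

omit [DecidableEq ι] in
theorem linProd_eq_prod (s : Finset ι) (r : ι → ℂ) :
    linProd s r = ∏ j ∈ s, (1 - PowerSeries.C (r j) * PowerSeries.X) := by
  rw [linProd, linPoly, ← coeToPowerSeries.ringHom_apply, map_prod]
  simp

theorem linFactor_mul_geomSeries (x : ℂ) :
    (1 - PowerSeries.C x * PowerSeries.X) * geomSeries x = 1 := by
  ext p
  rw [sub_mul, one_mul, mul_assoc, map_sub, PowerSeries.coeff_C_mul]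
  cases p with
  | zero => simp [geomSeries]
  | succ p => simp [geomSeries, PowerSeries.coeff_succ_X_mul, PowerSeries.coeff_one, pow_succ']

omit [DecidableEq ι] in
theorem linProd_mul_invProd (s : Finset ι) (r : ι → ℂ) : linProd s r * invProd s r = 1 := by
  rw [linProd_eq_prod, invProd, ← Finset.prod_mul_distrib]
  exact Finset.prod_eq_one fun j _ => linFactor_mul_geomSeries (r j)

theorem linProd_mul_geomSeries {a : ι} (ha : a ∈ s) (r : ι → ℂ) :
    linProd s r * geomSeries (r a) = linProd (s.erase a) r := by
  rw [linProd_eq_prod, linProd_eq_prod, ← Finset.mul_prod_erase s _ ha, mul_right_comm,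
    linFactor_mul_geomSeries, one_mul]

omit [DecidableEq ι] in
theorem eval_linPoly {x : ℂ} (hx : x ≠ 0) (s : Finset ι) (r : ι → ℂ) :
    (linPoly s r).eval x = x ^ s.card * ∏ j ∈ s, (x⁻¹ - r j) := by
  rw [linPoly, eval_prod, Finset.pow_card_mul_prod]
  refine Finset.prod_congr rfl fun j _ => ?_
  simp only [eval_sub, eval_one, eval_mul, eval_C, eval_X]
  field_simp

theorem polynomial_ext_of_ne_zero {p q : ℂ[X]} (h : ∀ x : ℂ, x ≠ 0 → p.eval x = q.eval x) :
    p = q := by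
  refine eq_of_infinite_eval_eq p q (Set.Infinite.mono (s := {0}ᶜ) (fun x hx => h x hx) ?_)
  exact (Set.finite_singleton (0 : ℂ)).infinite_compl

-- The factor of a value `0` is trivial, but no information is lost: the number of factors is known,
-- so the reversed polynomial, with roots `r j`, can be recovered.
omit [DecidableEq ι] in
theorem map_eq_map_of_linProd_eq {r r' : ι → ℂ} (h : linProd s r = linProd s r') :
    s.val.map r = s.val.map r' := by
  have h1 : linPoly s r = linPoly s r' := Polynomial.coe_injective ℂ h
  have h2 : ∏ j ∈ s, (X - C (r j)) = ∏ j ∈ s, (X - C (r' j)) := by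
    refine polynomial_ext_of_ne_zero fun x hx => ?_
    have h3 := congrArg (eval x⁻¹) h1
    rw [eval_linPoly (inv_ne_zero hx), eval_linPoly (inv_ne_zero hx), inv_inv] at h3
    have h4 := mul_left_cancel₀ (pow_ne_zero _ (inv_ne_zero hx)) h3
    simpa [eval_prod] using h4
  have h3 : ∀ r : ι → ℂ, (∏ j ∈ s, (X - C (r j))).roots = s.val.map r := by
    intro r
    have := roots_multiset_prod_X_sub_C (s.val.map r)
    rwa [Multiset.map_map] at this
  rw [← h3, h2, h3]

/-- The partial fraction decomposition in terms of power series. -/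
theorem residue_series {s₁ s₂ : Finset ι} {u w : ι → ℂ} (hcard : s₁.card + s₂.card = 2 * s.card)
    (h : defect s r ((∏ j ∈ s₁, (X - C (u j))) * ∏ j ∈ s₂, (X - C (w j - 1))) = 0) (c : ℂ) :
    (1 - PowerSeries.X * PowerSeries.mk fun p => ∑ a ∈ s,
        (resPlus s r ((∏ j ∈ s₁, (X - C (u j))) * ∏ j ∈ s₂, (X - C (w j - 1))) a * (r a + c) ^ p -
         resMinus s r ((∏ j ∈ s₁, (X - C (u j))) * ∏ j ∈ s₂, (X - C (w j - 1))) a *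
          (r a + c - 1) ^ p)) *
      (linProd s (fun j => r j + c) * linProd s (fun j => r j + c - 1)) =
    linProd s₁ (fun j => u j + c) * linProd s₂ (fun j => w j + c - 1) := by
  set N := (∏ j ∈ s₁, (X - C (u j))) * ∏ j ∈ s₂, (X - C (w j - 1)) with hN
  have key : linPoly s₁ (fun j => u j + c) * linPoly s₂ (fun j => w j + c - 1) =
      linPoly s (fun j => r j + c) * linPoly s (fun j => r j + c - 1) -
      X * (∑ a ∈ s, (C (resPlus s r N a) * (linPoly (s.erase a) (fun j => r j + c) *
          linPoly s (fun j => r j + c - 1)) - C (resMinus s r N a) *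
          (linPoly s (fun j => r j + c) * linPoly (s.erase a) (fun j => r j + c - 1)))) := by
    refine polynomial_ext_of_ne_zero fun x hx => ?_
    -- The variables are related by `t = 1 / z - c`; the powers of `x` compensate for the reversal
    -- of the polynomials.
    have h1 := congrArg (eval (x⁻¹ - c)) h
    have hs : ∀ a ∈ s, (s.erase a).card + 1 = s.card := fun a ha =>
      Finset.card_erase_add_one ha
    simp only [defect, eval_sub, eval_add, eval_finsetSum, eval_mul, eval_C, eval_nodePoly,
      eval_zero, hN, eval_prod, eval_X] at h1
    simp only [eval_sub, eval_mul, eval_X, eval_finsetSum, eval_C, eval_linPoly hx]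
    have e1 : ∀ (t : Finset ι) (v : ι → ℂ), ∏ j ∈ t, (x⁻¹ - (v j + c)) =
        ∏ j ∈ t, (x⁻¹ - c - v j) := fun t v => Finset.prod_congr rfl fun j _ => by ring
    have e2 : ∀ (t : Finset ι) (v : ι → ℂ), ∏ j ∈ t, (x⁻¹ - (v j + c - 1)) =
        ∏ j ∈ t, (x⁻¹ - c + 1 - v j) := fun t v => Finset.prod_congr rfl fun j _ => by ring
    have e3 : ∏ j ∈ s₂, (x⁻¹ - c - (w j - 1)) = ∏ j ∈ s₂, (x⁻¹ - c + 1 - w j) :=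
      Finset.prod_congr rfl fun j _ => by ring
    simp only [e1, e2]
    rw [e3] at h1
    have e4 : ∀ a ∈ s, x * (resPlus s r N a * ((x ^ (s.erase a).card *
        ∏ j ∈ s.erase a, (x⁻¹ - c - r j)) * (x ^ s.card * ∏ j ∈ s, (x⁻¹ - c + 1 - r j))) -
        resMinus s r N a * ((x ^ s.card * ∏ j ∈ s, (x⁻¹ - c - r j)) * (x ^ (s.erase a).card *
        ∏ j ∈ s.erase a, (x⁻¹ - c + 1 - r j)))) = x ^ (2 * s.card) * (resPlus s r N a *
          ((∏ j ∈ s.erase a, (x⁻¹ - c - r j)) * ∏ j ∈ s, (x⁻¹ - c + 1 - r j)) -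
          resMinus s r N a *
          ((∏ j ∈ s, (x⁻¹ - c - r j)) * ∏ j ∈ s.erase a, (x⁻¹ - c + 1 - r j))) := by
      intro a ha
      rw [two_mul, pow_add, ← hs a ha, pow_succ]
      ring
    rw [Finset.mul_sum, Finset.sum_congr rfl e4, ← Finset.mul_sum, Finset.sum_sub_distrib]
    have e5 : x ^ s₁.card * x ^ s₂.card = x ^ (2 * s.card) := by rw [← pow_add, hcard]
    calc _ = x ^ s₁.card * x ^ s₂.card * ((∏ j ∈ s₁, (x⁻¹ - c - u j)) *
            ∏ j ∈ s₂, (x⁻¹ - c + 1 - w j)) := by ring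
      _ = _ := by
        rw [e5, two_mul, pow_add]
        linear_combination (x ^ s.card * x ^ s.card) * h1
  have e : ((PowerSeries.mk fun p => ∑ a ∈ s, (resPlus s r N a * (r a + c) ^ p -
      resMinus s r N a * (r a + c - 1) ^ p)) : PowerSeries ℂ) =
      ∑ a ∈ s, (PowerSeries.C (resPlus s r N a) * geomSeries (r a + c) -
        PowerSeries.C (resMinus s r N a) * geomSeries (r a + c - 1)) := by
    ext p
    rw [PowerSeries.coeff_mk, map_sum]
    simp [geomSeries]
  have key2 := congrArg (coeToPowerSeries.ringHom (R := ℂ)) key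
  simp only [map_mul, map_sub, map_sum, coeToPowerSeries.ringHom_apply, coe_C, coe_X] at key2
  change linProd s₁ (fun j => u j + c) * linProd s₂ (fun j => w j + c - 1) = linProd s _ *
    linProd s _ - PowerSeries.X * ∑ a ∈ s, (PowerSeries.C _ * (linProd _ _ * linProd _ _) -
      PowerSeries.C _ * (linProd _ _ * linProd _ _)) at key2
  rw [key2, e, sub_mul, one_mul, mul_assoc, Finset.sum_mul]
  congr 2
  refine Finset.sum_congr rfl fun a ha => ?_
  rw [← linProd_mul_geomSeries ha, ← linProd_mul_geomSeries ha]
  ring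

/-- The eigenvalue of `1 - ∑ tr(M^p) z^(p+1)`. -/
def traceEigen (s : Finset ι) (y : ι → ℂ) : PowerSeries ℂ :=
  linProd s (fun j => y j + 1) * invProd s y

omit [DecidableEq ι] in
theorem traceEigen_eq_prod (s : Finset ι) (y : ι → ℂ) :
    traceEigen s y = ∏ j ∈ s, (1 - PowerSeries.X * geomSeries (y j)) := by
  rw [traceEigen, linProd_eq_prod, invProd, ← Finset.prod_mul_distrib]
  refine Finset.prod_congr rfl fun j _ => ?_
  have h := linFactor_mul_geomSeries (y j)
  rw [map_add, map_one]
  linear_combination h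

/-- Partial fractions of `∏ (t - y_j - 1) / ∏ (t - y_j)` at its simple poles, read at `t = 1 / z`;
up to sign, the residues are the products in `gammaExpr`. -/
theorem traceEigen_partialFractions {y : ι → ℂ} (hy : Set.InjOn y s) :
    traceEigen s y = 1 - PowerSeries.X * PowerSeries.mk fun p =>
      ∑ i ∈ s, y i ^ p * ∏ j ∈ s.erase i, (1 - 1 / (y i - y j)) := by
  set c : ι → ℂ := fun i => ∏ j ∈ s.erase i, (1 - 1 / (y i - y j)) with hc
  have key : ∏ j ∈ s, (X - C (y j + 1)) = ∏ j ∈ s, (X - C (y j)) -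
      ∑ i ∈ s, C (c i) * ∏ j ∈ s.erase i, (X - C (y j)) := by
    have hdeg : ∀ (t : Finset ι) (v : ι → ℂ), (∏ j ∈ t, (X - C (v j))).degree =
        ((t.card : ℕ) : WithBot ℕ) := by
      intro t v
      rw [degree_prod]
      simp
    have h1 : (∏ j ∈ s, (X - C (y j + 1)) - ∏ j ∈ s, (X - C (y j)) +
      ∑ i ∈ s, C (c i) * ∏ j ∈ s.erase i, (X - C (y j))) = 0 := by
      refine eq_zero_of_degree_lt_of_eval_finset_eq_zero (s.image y) ?_ fun x hx => ?_
      · rw [Finset.card_image_of_injOn hy]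
        refine (degree_add_le _ _).trans_lt (max_lt ?_ ?_)
        · rw [← hdeg s fun j => y j + 1]
          refine degree_sub_lt_left ?_ (monic_prod_of_monic _ _ fun _ _ => monic_X_sub_C _).ne_zero ?_
          · rw [hdeg s fun j => y j + 1, hdeg]
          · rw [(monic_prod_of_monic _ _ fun _ _ => monic_X_sub_C _).leadingCoeff,
              (monic_prod_of_monic _ _ fun _ _ => monic_X_sub_C _).leadingCoeff]
        · refine (degree_sum_le _ _).trans_lt
            ((Finset.sup_lt_iff (WithBot.bot_lt_coe _)).2 fun a ha => ?_)
          refine (degree_C_mul_le' _ _).trans_lt ?_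
          rw [hdeg]
          exact_mod_cast Finset.card_erase_lt_of_mem ha
      · obtain ⟨i, hi, rfl⟩ := Finset.mem_image.1 hx
        simp only [eval_add, eval_sub, eval_prod, eval_finsetSum, eval_mul, eval_C, eval_X]
        rw [Finset.prod_eq_zero hi (f := fun j => y i - y j) (sub_self _),
          Finset.sum_eq_single i (fun b _ hb => by
          rw [Finset.prod_eq_zero (Finset.mem_erase.2 ⟨hb.symm, hi⟩) (sub_self _), mul_zero])
          (fun h => absurd hi h), ← Finset.mul_prod_erase s _ hi, hc, ← Finset.prod_mul_distrib]
        have e : ∏ j ∈ s.erase i, (1 - 1 / (y i - y j)) * (y i - y j) =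
            ∏ j ∈ s.erase i, (y i - (y j + 1)) := by
          refine Finset.prod_congr rfl fun j hj => ?_
          have : y i - y j ≠ 0 := sub_ne_zero.2 fun e =>
            (Finset.mem_erase.1 hj).1 (hy (Finset.mem_erase.1 hj).2 hi e.symm)
          field_simp
          ring
        rw [e]
        ring
    linear_combination h1
  have key' : linPoly s (fun j => y j + 1) = linPoly s y -
      X * ∑ i ∈ s, C (c i) * linPoly (s.erase i) y := by
    refine polynomial_ext_of_ne_zero fun x hx => ?_
    have h1 := congrArg (eval x⁻¹) key
    simp only [eval_sub, eval_prod, eval_finsetSum, eval_mul, eval_C, eval_X] at h1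
    simp only [eval_sub, eval_mul, eval_X, eval_finsetSum, eval_C, eval_linPoly hx]
    rw [h1, mul_sub, Finset.mul_sum, Finset.mul_sum]
    congr 1
    refine Finset.sum_congr rfl fun i hi => ?_
    rw [← Finset.card_erase_add_one hi, pow_succ]
    ring
  have key2 := congrArg (coeToPowerSeries.ringHom (R := ℂ)) key'
  simp only [map_mul, map_sub, map_sum, coeToPowerSeries.ringHom_apply, coe_C, coe_X] at key2
  change linProd s _ = linProd s y - PowerSeries.X * ∑ a ∈ s, PowerSeries.C _ * linProd _ _ at key2
  rw [traceEigen, key2, sub_mul, linProd_mul_invProd, mul_assoc, Finset.sum_mul]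
  congr 2
  ext p
  rw [PowerSeries.coeff_mk, map_sum]
  refine Finset.sum_congr rfl fun i hi => ?_
  rw [← linProd_mul_geomSeries hi, mul_assoc, mul_right_comm (linProd s y), linProd_mul_invProd,
    one_mul, PowerSeries.coeff_C_mul, geomSeries, PowerSeries.coeff_mk, mul_comm]

theorem coeff_one_traceEigen (s : Finset ι) (y : ι → ℂ) :
    PowerSeries.coeff 0 (traceEigen s y) = 1 ∧ PowerSeries.coeff 1 (traceEigen s y) = -s.card := by
  rw [traceEigen_eq_prod]
  induction s using Finset.induction_on with
  | empty => simp [PowerSeries.coeff_one]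
  | insert a s ha ih =>
    rw [Finset.prod_insert ha, Finset.card_insert_of_notMem ha, sub_mul, one_mul, mul_assoc,
      map_sub, map_sub, ih.1, ih.2]
    constructor
    · simp
    · rw [show (1 : ℕ) = 0 + 1 from rfl, PowerSeries.coeff_succ_X_mul,
        PowerSeries.coeff_zero_eq_constantCoeff, map_mul,
        ← PowerSeries.coeff_zero_eq_constantCoeff_apply, ← PowerSeries.coeff_zero_eq_constantCoeff_apply,
        ih.1]
      simp [geomSeries]
      ring

/-- The eigenvalue of `tr(M²)` is a quadratic polynomial. -/
theorem coeff_three_traceEigen_sub {a : ι} (ha : a ∈ s) {y y' : ι → ℂ}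
    (h : ∀ j ∈ s.erase a, y' j = y j) :
    PowerSeries.coeff 3 (traceEigen s y) - PowerSeries.coeff 3 (traceEigen s y') =
      (y' a - y a) * (y a + y' a + 1 - s.card) := by
  have h1 := coeff_one_traceEigen (s.erase a) y
  have h2 : ∀ y : ι → ℂ, PowerSeries.coeff 3 (traceEigen s y) =
      PowerSeries.coeff 3 (traceEigen (s.erase a) y) -
      (PowerSeries.coeff 2 (traceEigen (s.erase a) y) +
        y a * PowerSeries.coeff 1 (traceEigen (s.erase a) y) +
        y a ^ 2 * PowerSeries.coeff 0 (traceEigen (s.erase a) y)) := by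
    intro y
    rw [traceEigen_eq_prod, ← Finset.mul_prod_erase s _ ha, ← traceEigen_eq_prod, sub_mul, one_mul,
      mul_assoc, map_sub, PowerSeries.coeff_succ_X_mul, PowerSeries.coeff_mul,
      Finset.Nat.sum_antidiagonal_eq_sum_range_succ
        (fun i j => PowerSeries.coeff i (geomSeries (y a)) *
          PowerSeries.coeff j (traceEigen (s.erase a) y))]
    simp [Finset.sum_range_succ, geomSeries]
  have h3 : traceEigen (s.erase a) y' = traceEigen (s.erase a) y := by
    rw [traceEigen_eq_prod, traceEigen_eq_prod]
    exact Finset.prod_congr rfl fun j hj => by rw [h j hj]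
  have h4 : ((s.erase a).card : ℂ) = s.card - 1 := by
    rw [Finset.card_erase_of_mem ha, Nat.cast_sub (Finset.card_pos.2 ⟨a, ha⟩), Nat.cast_one]
  rw [h2, h2, h3, h1.1, h1.2, h4]
  ring

end LinearFactors

/-! ### The polynomials `γ_{mk}` -/

section Gamma

open MvPolynomial

/-- Multiplied by all differences of variables, `p - q` vanishes at every point; that product is
nonzero and can be cancelled. -/
theorem mvPolynomial_eq_of_eval_injective {m : ℕ} {p q : MvPolynomial (Fin m) ℂ}
    (h : ∀ x : Fin m → ℂ, Function.Injective x → eval x p = eval x q) : p = q := by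
  set D : MvPolynomial (Fin m) ℂ := ∏ i, ∏ j ∈ Finset.univ.erase i, (X i - X j) with hD
  have hD0 : D ≠ 0 := by
    refine Finset.prod_ne_zero_iff.2 fun i _ => Finset.prod_ne_zero_iff.2 fun j hj => ?_
    exact sub_ne_zero.2 fun e => (Finset.mem_erase.1 hj).1 (X_injective e).symm
  have : (p - q) * D = 0 := by
    refine MvPolynomial.funext fun x => ?_
    rw [map_mul, map_sub, map_zero]
    by_cases hx : Function.Injective x
    · rw [h x hx, sub_self, zero_mul]
    · obtain ⟨i, j, e, hne⟩ := Function.not_injective_iff.1 hx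
      rw [hD, map_prod, Finset.prod_eq_zero (Finset.mem_univ i), mul_zero]
      rw [map_prod, Finset.prod_eq_zero (Finset.mem_erase.2 ⟨hne.symm, Finset.mem_univ j⟩)]
      simp [e]
  exact sub_eq_zero.1 ((mul_eq_zero.1 this).resolve_right hD0)

/-- The coefficients of `∏ (1 - z / (1 - y_j z))` are polynomials in the `y_j` that remain
meaningful at coinciding values. This matters for the top row, where noncriticality allows equal
entries. -/
theorem eval_gammaPoly_eq_coeff (m k : ℕ) (x : Fin m → ℂ) :
    eval x (gammaPoly m k) =
      -PowerSeries.coeff (k + 1) (traceEigen Finset.univ fun i => x i + (m : ℂ) - 1) := by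
  let P : PowerSeries (MvPolynomial (Fin m) ℂ) :=
    ∏ j : Fin m, (1 - PowerSeries.X * PowerSeries.mk fun p => (X j + C ((m : ℂ) - 1)) ^ p)
  have hP : ∀ x : Fin m → ℂ, eval x (PowerSeries.coeff (k + 1) P) =
      PowerSeries.coeff (k + 1) (traceEigen Finset.univ fun i => x i + (m : ℂ) - 1) := by
    intro x
    rw [← PowerSeries.coeff_map, map_prod, traceEigen_eq_prod]
    congr 1
    refine Finset.prod_congr rfl fun j _ => ?_
    rw [map_sub, map_one, map_mul, PowerSeries.map_X]
    congr 2
    ext p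
    simp [geomSeries, add_sub_assoc]
  have : gammaPoly m k = -PowerSeries.coeff (k + 1) P := by
    refine mvPolynomial_eq_of_eval_injective fun x hx => ?_
    rw [eval_gammaPoly m k x hx, map_neg, hP, traceEigen_partialFractions]
    · rw [map_sub, PowerSeries.coeff_succ_X_mul, PowerSeries.coeff_mk, PowerSeries.coeff_one,
        if_neg (Nat.succ_ne_zero k), zero_sub, neg_neg, gammaExpr]
      refine Finset.sum_congr rfl fun i _ => ?_
      congr 1
      exact Finset.prod_congr (by ext; simp) fun j _ => by congr 2; ring
    · intro i _ j _ e
      exact hx (by simpa using e)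
  rw [this, map_neg, hP]

end Gamma

/-! ### Matrices of generators -/

section Generators

variable {n : ℕ} {A : Type*} [Ring A] [Algebra ℂ A]

/-- The matrix `(f(E_{ij}))` with `1 ≤ i, j ≤ m`. -/
def genMat (f : gln n →ₗ⁅ℂ⁆ A) (m : ℕ) : Matrix (Fin m) (Fin m) A :=
  fun i j => f (E n (i + 1) (j + 1))

theorem E_mul_E (i j k l : ℕ) (hj : j < n) :
    E n (i + 1) (j + 1) * E n (k + 1) (l + 1) = if j = k then E n (i + 1) (l + 1) else 0 := by
  ext a b
  rw [Matrix.mul_apply, Finset.sum_eq_single ⟨j, hj⟩]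
  · by_cases hjk : j = k
    · subst hjk
      simp only [E, Matrix.of_apply, if_true]
      by_cases h1 : a.val = i <;> by_cases h2 : b.val = l <;> simp [h1, h2]
    · simp [E, hjk]
  · intro c _ hc
    have : c.val ≠ j := fun h => hc (Fin.ext h)
    simp [E, this]
  · simp

theorem isTensorOperator_genMat (f : gln n →ₗ⁅ℂ⁆ A) {m : ℕ} (hm : m ≤ n) :
    IsTensorOperator (genMat f m) (genMat f m) := by
  intro i j k l
  simp only [genMat]
  rw [← LieRing.of_associative_ring_bracket, ← LieHom.map_lie,
    LieRing.of_associative_ring_bracket, E_mul_E _ _ _ _ (j.2.trans_le hm),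
    E_mul_E _ _ _ _ (l.2.trans_le hm), map_sub]
  simp only [Fin.ext_iff, eq_comm (a := (l : ℕ))]
  split_ifs <;> simp

theorem topBlock_genMat (f : gln n →ₗ⁅ℂ⁆ A) (m : ℕ) : topBlock (genMat f (m + 1)) = genMat f m :=
  rfl

omit [Algebra ℂ A] in
theorem matrix_pow_succ_apply_eq_sum {κ : Type*} [Fintype κ] [DecidableEq κ] (M : Matrix κ κ A) (k : ℕ) (i j : κ) :
    (M ^ (k + 1)) i j = ∑ f : Fin k → κ, (List.ofFn fun a : Fin (k + 1) =>
      M ((Fin.cons i f : Fin (k + 1) → κ) a) ((Fin.snoc f j : Fin (k + 1) → κ) a)).prod := by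
  induction k generalizing i with
  | zero => simp [Fin.snoc]
  | succ k ih =>
    rw [pow_succ', Matrix.mul_apply, ← (Fin.consEquiv fun _ : Fin (k + 1) => κ).sum_comp,
      Fintype.sum_prod_type]
    refine Finset.sum_congr rfl fun l _ => ?_
    rw [ih, Finset.mul_sum]
    refine Finset.sum_congr rfl fun f _ => ?_
    rw [List.ofFn_succ (n := k + 1), List.prod_cons]
    have e : (Fin.snoc (Fin.cons l f : Fin (k + 1) → κ) j : Fin (k + 2) → κ) =
      Fin.cons l (Fin.snoc f j : Fin (k + 1) → κ) := (Fin.cons_snoc_eq_snoc_cons _ _ _).symm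
    change _ = M _ ((Fin.snoc (Fin.cons l f : Fin (k + 1) → κ) j : Fin (k + 2) → κ) 0) *
      (List.ofFn fun a => M ((Fin.cons l f : Fin (k + 1) → κ) a)
        ((Fin.snoc (Fin.cons l f : Fin (k + 1) → κ) j : Fin (k + 2) → κ) a.succ)).prod
    simp only [e, Fin.cons_zero, Fin.cons_succ]

omit [Algebra ℂ A] in
theorem trace_pow_eq_sum {κ : Type*} [Fintype κ] [DecidableEq κ] (M : Matrix κ κ A) (k : ℕ) :
    (M ^ (k + 1)).trace = ∑ f : Fin (k + 1) → κ, (List.ofFn fun a : Fin (k + 1) =>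
      M (f a) (f (finRotate (k + 1) a))).prod := by
  rw [← (Fin.consEquiv fun _ : Fin (k + 1) => κ).sum_comp, Fintype.sum_prod_type, Matrix.trace]
  refine Finset.sum_congr rfl fun i _ => ?_
  rw [Matrix.diag_apply, matrix_pow_succ_apply_eq_sum]
  refine Finset.sum_congr rfl fun f _ => ?_
  congr 2
  ext1 a
  congr 1
  simp only [Fin.consEquiv_apply]
  refine Fin.lastCases ?_ (fun b => ?_) a
  · rw [finRotate_last, Fin.snoc_last, Fin.cons_zero]
  · rw [finRotate_apply, Fin.coeSucc_eq_succ, Fin.snoc_castSucc, Fin.cons_succ]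

theorem cGen_eq_trace (m k : ℕ) :
    cGen n m (k + 1) = ((genMat (ι ℂ : gln n →ₗ⁅ℂ⁆ UGL n) m) ^ (k + 1)).trace := by
  rw [trace_pow_eq_sum]
  rfl

theorem map_genMat_pow {B : Type*} [Ring B] [Algebra ℂ B] (f : gln n →ₗ⁅ℂ⁆ A) (g : gln n →ₗ⁅ℂ⁆ B)
    (F : A →ₐ[ℂ] B) (h : ∀ x, F (f x) = g x) (m p : ℕ) (i j : Fin m) :
    F ((genMat f m ^ p) i j) = (genMat g m ^ p) i j := by
  have : (genMat f m).map F = genMat g m := by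
    ext i j
    exact h _
  rw [← this, ← AlgHom.mapMatrix_apply, ← map_pow]
  rfl

end Generators

/-! ### Entries of tableaux -/

section Entries

variable {n : ℕ}

theorem entry_of_valid (R : Tableau n) {i j : ℕ} (h : 1 ≤ j ∧ j ≤ i ∧ i ≤ n) :
    R.entry i j = R ⟨(i, j), h⟩ := dif_pos h

theorem entry_eq (R : Tableau n) (v : Vertex n) : R.entry v.1.1 v.1.2 = R v := dif_pos v.2

theorem entry_add (R S : Tableau n) (i j : ℕ) :
    (R + S).entry i j = R.entry i j + S.entry i j := by
  unfold Tableau.entry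
  split_ifs <;> simp

theorem entry_sub (R S : Tableau n) (i j : ℕ) :
    (R - S).entry i j = R.entry i j - S.entry i j := by
  unfold Tableau.entry
  split_ifs <;> simp

theorem entry_delta {k i : ℕ} (hk : k ≤ n) (hi : i ∈ Finset.Icc 1 k) (k' i' : ℕ) :
    (delta n k i).entry k' i' = if k' = k ∧ i' = i then 1 else 0 := by
  rw [Finset.mem_Icc] at hi
  unfold Tableau.entry
  split_ifs with h1 h2 h2
  · simp [delta, h2]
  · rw [delta, if_neg]
    simpa using h2
  · exact absurd ⟨h2.2 ▸ hi.1, h2.1 ▸ h2.2 ▸ hi.2, h2.1 ▸ hk⟩ h1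
  · rfl

theorem entry_delta_self {k i j : ℕ} (hk : k ≤ n) (hi : i ∈ Finset.Icc 1 k) :
    (delta n k i).entry k j = if j = i then 1 else 0 := by
  rw [entry_delta hk hi]
  simp

theorem entry_delta_of_ne {k k' i j : ℕ} (hk : k ≤ n) (hi : i ∈ Finset.Icc 1 k) (h : k' ≠ k) :
    (delta n k i).entry k' j = 0 := by
  rw [entry_delta hk hi, if_neg fun e => h e.1]

theorem tableau_ext {R S : Tableau n} (h : ∀ k j, k ≤ n → j ∈ Finset.Icc 1 k →
    R.entry k j = S.entry k j) : R = S := by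
  ext v
  rw [← entry_eq R, ← entry_eq S]
  exact h _ _ v.2.2.2 (Finset.mem_Icc.2 ⟨v.2.1, v.2.2.1⟩)

variable {C : Set (Relation n)} {L R : Tableau n}

theorem mem_tableaux_of_shift (hR : R ∈ tableaux C L) {S : Tableau n} {z : Vertex n → ℤ}
    (hz : ∀ v, v.row = n → z v = 0) (hS : ∀ v, S v = R v + z v) (h : Satisfies S C) :
    S ∈ tableaux C L := by
  obtain ⟨⟨z', hz', hR'⟩, -⟩ := hR
  refine ⟨⟨fun v => z' v + z v, fun v hv => by simp [hz v hv, hz' v hv], fun v => ?_⟩, h⟩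
  rw [hS, hR']
  push_cast
  ring

theorem add_delta_mem_iff (hR : R ∈ tableaux C L) {k i : ℕ} (hk : k < n) :
    R + delta n k i ∈ tableaux C L ↔ Satisfies (R + delta n k i) C := by
  refine ⟨fun h => h.2, mem_tableaux_of_shift hR (z := fun v => if v.1 = (k, i) then 1 else 0)
    (fun v hv => if_neg ?_) fun v => ?_⟩
  · rintro e
    have : v.1.1 = k := by rw [e]
    have : v.1.1 = n := hv
    omega
  · rw [Pi.add_apply, delta]
    split_ifs <;> simp

theorem sub_delta_mem_iff (hR : R ∈ tableaux C L) {k i : ℕ} (hk : k < n) :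
    R - delta n k i ∈ tableaux C L ↔ Satisfies (R - delta n k i) C := by
  refine ⟨fun h => h.2, mem_tableaux_of_shift hR (z := fun v => if v.1 = (k, i) then -1 else 0)
    (fun v hv => if_neg ?_) fun v => ?_⟩
  · rintro e
    have : v.1.1 = k := by rw [e]
    have : v.1.1 = n := hv
    omega
  · rw [Pi.sub_apply, delta]
    split_ifs <;> simp [sub_eq_add_neg]

/-- If raising an entry violates a relation, the relation was tight. -/
theorem exists_tight_of_add_not_mem (hC : C ⊆ relR n ∪ relR0 n) (hR : R ∈ tableaux C L) {k i : ℕ}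
    (hk : k < n) (h : R + delta n k i ∉ tableaux C L) :
    (∃ j ∈ Finset.Icc 1 (k + 1), R.entry k i = R.entry (k + 1) j) ∨
      ∃ j ∈ Finset.Icc 1 (k - 1), R.entry (k - 1) j = R.entry k i + 1 := by
  rw [add_delta_mem_iff hR hk, Satisfies] at h
  push Not at h
  obtain ⟨⟨b, v, w⟩, hr, hn⟩ := h
  obtain ⟨d, hd, hd0, hd1⟩ := hR.2 _ hr
  simp only at hd hd1
  -- Raising the entry `(k, i)` decreases the difference in a relation only if `(k, i)` is its
  -- target and not its source. It then drops by exactly one, so it had its least permitted value,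
  -- `0` or `1`.
  have hw : w.1 = (k, i) ∧ v.1 ≠ (k, i) := by
    by_contra hcon
    refine hn ⟨d + (if v.1 = (k, i) then 1 else 0) - (if w.1 = (k, i) then 1 else 0), ?_, ?_, ?_⟩
    · simp only [Pi.add_apply, delta]
      push_cast
      rw [← hd]
      ring
    · split_ifs with h1 h2 <;> simp_all
      omega
    · intro hb
      have := hd1 hb
      split_ifs with h1 h2 <;> simp_all
  have hd' : d ≤ if b = true then 1 else 0 := by
    by_contra hcon
    refine hn ⟨d - 1, ?_, ?_, ?_⟩
    · simp only [Pi.add_apply, delta, if_pos hw.1, if_neg hw.2]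
      push_cast
      rw [← hd]
      ring
    · split_ifs at hcon <;> omega
    · intro hb
      simp only at hb
      rw [if_pos hb] at hcon
      omega
  rw [← entry_eq R, ← entry_eq R, hw.1] at hd
  have hwr : w.row = k := by rw [Vertex.row, hw.1]
  have hv := v.2
  rcases hC hr with (⟨hb, hrow⟩ | ⟨hb, hrow⟩) | ⟨hb, -, hrow, -⟩
  · left
    simp only at hb hrow
    have hvr : v.1.1 = k + 1 := by rw [← hwr]; exact hrow
    rw [hb] at hd'
    have : d = 0 := by simp at hd'; omega
    refine ⟨v.1.2, Finset.mem_Icc.2 ⟨hv.1, hvr ▸ hv.2.1⟩, ?_⟩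
    rw [this, Int.cast_zero, sub_eq_zero, hvr] at hd
    exact hd.symm
  · right
    simp only at hb hrow
    have hvr : v.1.1 = k - 1 := by
      have : w.row = v.1.1 + 1 := hrow
      omega
    rw [hb] at hd'
    have : d = 1 := by
      have := hd1 hb
      simp at hd'; omega
    refine ⟨v.1.2, Finset.mem_Icc.2 ⟨hv.1, hvr ▸ hv.2.1⟩, ?_⟩
    rw [this, Int.cast_one, hvr] at hd
    linear_combination hd
  · simp only at hrow
    omega

/-- If lowering an entry violates a relation, the relation was tight. -/
theorem exists_tight_of_sub_not_mem (hC : C ⊆ relR n ∪ relR0 n) (hR : R ∈ tableaux C L) {k i : ℕ}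
    (hk : k < n) (h : R - delta n k i ∉ tableaux C L) :
    (∃ j ∈ Finset.Icc 1 (k - 1), R.entry k i = R.entry (k - 1) j) ∨
      ∃ j ∈ Finset.Icc 1 (k + 1), R.entry k i = R.entry (k + 1) j + 1 := by
  rw [sub_delta_mem_iff hR hk, Satisfies] at h
  push Not at h
  obtain ⟨⟨b, v, w⟩, hr, hn⟩ := h
  obtain ⟨d, hd, hd0, hd1⟩ := hR.2 _ hr
  simp only at hd hd1
  have hw : v.1 = (k, i) ∧ w.1 ≠ (k, i) := by
    by_contra hcon
    refine hn ⟨d - (if v.1 = (k, i) then 1 else 0) + (if w.1 = (k, i) then 1 else 0), ?_, ?_, ?_⟩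
    · simp only [Pi.sub_apply, delta]
      push_cast
      rw [← hd]
      ring
    · split_ifs with h1 h2 <;> simp_all
      omega
    · intro hb
      have := hd1 hb
      split_ifs with h1 h2 <;> simp_all
  have hd' : d ≤ if b = true then 1 else 0 := by
    by_contra hcon
    refine hn ⟨d - 1, ?_, ?_, ?_⟩
    · simp only [Pi.sub_apply, delta, if_pos hw.1, if_neg hw.2]
      push_cast
      rw [← hd]
      ring
    · split_ifs at hcon <;> omega
    · intro hb
      simp only at hb
      rw [if_pos hb] at hcon
      omega
  rw [← entry_eq R, ← entry_eq R, hw.1] at hd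
  have hvr : v.row = k := by rw [Vertex.row, hw.1]
  have hwv := w.2
  rcases hC hr with (⟨hb, hrow⟩ | ⟨hb, hrow⟩) | ⟨hb, hrow, -, -⟩
  · left
    simp only at hb hrow
    have hwr : w.1.1 = k - 1 := by
      have : v.row = w.1.1 + 1 := hrow
      omega
    rw [hb] at hd'
    have : d = 0 := by simp at hd'; omega
    refine ⟨w.1.2, Finset.mem_Icc.2 ⟨hwv.1, hwr ▸ hwv.2.1⟩, ?_⟩
    rw [this, Int.cast_zero, sub_eq_zero, hwr] at hd
    exact hd
  · right
    simp only at hb hrow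
    have hwr : w.1.1 = k + 1 := by rw [← hvr]; exact hrow
    rw [hb] at hd'
    have : d = 1 := by
      have := hd1 hb
      simp at hd'; omega
    refine ⟨w.1.2, Finset.mem_Icc.2 ⟨hwv.1, hwr ▸ hwv.2.1⟩, ?_⟩
    rw [this, Int.cast_one, hwr] at hd
    linear_combination hd
  · simp only at hrow
    omega

end Entries

/-! ### The commutator of raising and lowering operators -/

section Commutator

variable {n : ℕ} {C : Set (Relation n)} {L R : Tableau n}

theorem tab_of_mem (h : R ∈ tableaux C L) : tab C L R = Finsupp.single ⟨R, h⟩ 1 := dif_pos h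

theorem tab_of_not_mem (h : R ∉ tableaux C L) : tab C L R = 0 := dif_neg h

theorem tab_apply (R : Tableau n) (S : tableaux C L) :
    tab C L R S = if R = S.1 then 1 else 0 := by
  by_cases h : R ∈ tableaux C L
  · rw [tab_of_mem h, Finsupp.single_apply]
    simp only [Subtype.ext_iff]
  · rw [tab_of_not_mem h, if_neg]
    · rfl
    · rintro rfl
      exact h S.2

theorem tab_ne_zero (h : R ∈ tableaux C L) : tab C L R ≠ 0 := by
  intro e
  have := tab_apply R (⟨R, h⟩ : tableaux C L)
  rw [e] at this
  simp at this

open Polynomial in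
/-- The polynomial `∏ (t - r_{k+1,j}) ∏ (t + 1 - r_{k-1,j})`. -/
def adjacentPoly (R : Tableau n) (k : ℕ) : ℂ[X] :=
  (∏ j ∈ Finset.Icc 1 (k + 1), (X - Polynomial.C (R.entry (k + 1) j))) *
    ∏ j ∈ Finset.Icc 1 (k - 1), (X - Polynomial.C (R.entry (k - 1) j - 1))

theorem eval_adjacentPoly (R : Tableau n) (k : ℕ) (x : ℂ) :
    (adjacentPoly R k).eval x = (∏ j ∈ Finset.Icc 1 (k + 1), (x - R.entry (k + 1) j)) *
      ∏ j ∈ Finset.Icc 1 (k - 1), (x + 1 - R.entry (k - 1) j) := by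
  rw [adjacentPoly, Polynomial.eval_mul, Polynomial.eval_prod, Polynomial.eval_prod]
  simp only [Polynomial.eval_sub, Polynomial.eval_X, Polynomial.eval_C]
  congr 1
  exact Finset.prod_congr rfl fun j _ => by ring

theorem adjacentPoly_monic (R : Tableau n) (k : ℕ) : (adjacentPoly R k).Monic :=
  (Polynomial.monic_prod_of_monic _ _ fun _ _ => Polynomial.monic_X_sub_C _).mul
    (Polynomial.monic_prod_of_monic _ _ fun _ _ => Polynomial.monic_X_sub_C _)

theorem adjacentPoly_natDegree (R : Tableau n) {k : ℕ} (hk : 1 ≤ k) :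
    (adjacentPoly R k).natDegree = 2 * (Finset.Icc 1 k).card := by
  rw [adjacentPoly, (Polynomial.monic_prod_of_monic _ _ fun _ _ =>
    Polynomial.monic_X_sub_C _).natDegree_mul (Polynomial.monic_prod_of_monic _ _ fun _ _ =>
    Polynomial.monic_X_sub_C _), Polynomial.natDegree_prod_of_monic _ _ fun _ _ =>
    Polynomial.monic_X_sub_C _, Polynomial.natDegree_prod_of_monic _ _ fun _ _ =>
    Polynomial.monic_X_sub_C _]
  simp only [Polynomial.natDegree_X_sub_C, Finset.sum_const, smul_eq_mul, mul_one, Nat.card_Icc]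
  omega

/-- A tight relation kills one linear factor. Hence the residue belonging to a missing tableau is
zero by itself, and sums of residues may run over all of the row. -/
theorem eval_adjacentPoly_of_add_not_mem (hC : C ⊆ relR n ∪ relR0 n) (hR : R ∈ tableaux C L) {k i : ℕ} (hk : k < n)
    (h : R + delta n k i ∉ tableaux C L) : (adjacentPoly R k).eval (R.entry k i) = 0 := by
  rw [eval_adjacentPoly]
  rcases exists_tight_of_add_not_mem hC hR hk h with ⟨j, hj, e⟩ | ⟨j, hj, e⟩
  · rw [Finset.prod_eq_zero hj (by rw [e, sub_self]), zero_mul]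
  · rw [Finset.prod_eq_zero (s := Finset.Icc 1 (k - 1)) hj (by rw [e, sub_self]), mul_zero]

theorem eval_adjacentPoly_of_sub_not_mem (hC : C ⊆ relR n ∪ relR0 n) (hR : R ∈ tableaux C L)
    {k i : ℕ} (hk : k < n) (h : R - delta n k i ∉ tableaux C L) :
    (adjacentPoly R k).eval (R.entry k i - 1) = 0 := by
  rw [eval_adjacentPoly]
  rcases exists_tight_of_sub_not_mem hC hR hk h with ⟨j, hj, e⟩ | ⟨j, hj, e⟩
  · rw [Finset.prod_eq_zero (s := Finset.Icc 1 (k - 1)) hj (by rw [e]; ring), mul_zero]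
  · rw [Finset.prod_eq_zero hj (by rw [e]; ring), zero_mul]

theorem eCoeff_mul_fCoeff (R : Tableau n) {k a : ℕ} (hk : k < n) (ha : a ∈ Finset.Icc 1 k) :
    eCoeff R k a * fCoeff (R + delta n k a) k a =
      resPlus (Finset.Icc 1 k) (R.entry k) (adjacentPoly R k) a := by
  have h1 : ∏ j ∈ Finset.Icc 1 (k - 1),
      ((R + delta n k a).entry k a - (R + delta n k a).entry (k - 1) j) =
      ∏ j ∈ Finset.Icc 1 (k - 1), (R.entry k a + 1 - R.entry (k - 1) j) := by
    have hk1 : k - 1 ≠ k := by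
      have := Finset.mem_Icc.1 ha
      omega
    refine Finset.prod_congr rfl fun j _ => ?_
    rw [entry_add, entry_add, entry_delta_self hk.le ha, if_pos rfl,
      entry_delta_of_ne hk.le ha hk1, add_zero]
  have h2 : ∏ j ∈ (Finset.Icc 1 k).erase a,
      ((R + delta n k a).entry k a - (R + delta n k a).entry k j) =
      ∏ j ∈ (Finset.Icc 1 k).erase a, (R.entry k a + 1 - R.entry k j) := by
    refine Finset.prod_congr rfl fun j hj => ?_
    rw [entry_add, entry_add, entry_delta_self hk.le ha, if_pos rfl,
      entry_delta_self hk.le ha, if_neg (Finset.mem_erase.1 hj).1, add_zero]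
  rw [eCoeff, fCoeff, h1, h2, resPlus, eval_adjacentPoly, neg_mul, div_mul_div_comm]

theorem fCoeff_mul_eCoeff (R : Tableau n) {k a : ℕ} (hk : k < n) (ha : a ∈ Finset.Icc 1 k) :
    fCoeff R k a * eCoeff (R - delta n k a) k a =
      resMinus (Finset.Icc 1 k) (R.entry k) (adjacentPoly R k) a := by
  have h1 : ∏ j ∈ Finset.Icc 1 (k + 1),
      ((R - delta n k a).entry k a - (R - delta n k a).entry (k + 1) j) =
      ∏ j ∈ Finset.Icc 1 (k + 1), (R.entry k a - 1 - R.entry (k + 1) j) := by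
    refine Finset.prod_congr rfl fun j _ => ?_
    rw [entry_sub, entry_sub, entry_delta_self hk.le ha, if_pos rfl,
      entry_delta_of_ne hk.le ha k.succ_ne_self, sub_zero]
  have h2 : ∏ j ∈ (Finset.Icc 1 k).erase a,
      ((R - delta n k a).entry k a - (R - delta n k a).entry k j) =
      ∏ j ∈ (Finset.Icc 1 k).erase a, (R.entry k a - 1 - R.entry k j) := by
    refine Finset.prod_congr rfl fun j hj => ?_
    rw [entry_sub, entry_sub, entry_delta_self hk.le ha, if_pos rfl,
      entry_delta_self hk.le ha, if_neg (Finset.mem_erase.1 hj).1, sub_zero]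
  rw [eCoeff, fCoeff, h1, h2, resMinus, eval_adjacentPoly, mul_neg, div_mul_div_comm, mul_comm
    (∏ j ∈ Finset.Icc 1 (k - 1), _), mul_comm (∏ j ∈ (Finset.Icc 1 k).erase a, _)]
  simp only [sub_add_cancel]

/-- The tableau `T(R + δ^{ka} - δ^{kb})` determines `a ≠ b`. -/
theorem eq_of_add_delta_sub_delta_eq (R : Tableau n) {k a b a' b' : ℕ} (hk : k < n)
    (ha : a ∈ Finset.Icc 1 k) (hb : b ∈ Finset.Icc 1 k) (ha' : a' ∈ Finset.Icc 1 k)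
    (hb' : b' ∈ Finset.Icc 1 k) (hne : a ≠ b)
    (h : R + delta n k a' - delta n k b' = R + delta n k a - delta n k b) : a' = a ∧ b' = b := by
  have key : ∀ j, ((if j = a' then 1 else 0) - if j = b' then 1 else 0 : ℂ) =
      (if j = a then 1 else 0) - if j = b then 1 else 0 := by
    intro j
    have := congrArg (fun S : Tableau n => S.entry k j) h
    simp only [entry_sub, entry_add, entry_delta_self hk.le ha, entry_delta_self hk.le hb,
      entry_delta_self hk.le ha', entry_delta_self hk.le hb'] at this
    linear_combination this
  have h1 := key a
  have h2 := key b
  rw [if_pos rfl, if_neg hne] at h1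
  rw [if_neg hne.symm, if_pos rfl] at h2
  constructor
  · by_contra hcon
    rw [if_neg (Ne.symm hcon)] at h1
    split_ifs at h1 <;> norm_num at h1
  · by_contra hcon
    rw [if_neg (Ne.symm hcon)] at h2
    split_ifs at h2 <;> norm_num at h2

variable {ρ : gln n →ₗ⁅ℂ⁆ Module.End ℂ (TableauSpace C L)}

theorem lie_E (k : ℕ) (hk : 1 ≤ k) (hkn : k < n) :
    ρ (E n (k + 1) k) * ρ (E n k (k + 1)) - ρ (E n k (k + 1)) * ρ (E n (k + 1) k) =
      ρ (E n (k + 1) (k + 1)) - ρ (E n k k) := by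
  have h := isTensorOperator_genMat ρ le_rfl ⟨k, hkn⟩ ⟨k - 1, by omega⟩ ⟨k - 1, by omega⟩ ⟨k, hkn⟩
  rw [if_pos rfl, if_pos rfl] at h
  simp only [genMat, Nat.sub_add_cancel hk] at h
  exact h

/-- The commutator of `E_{k+1,k}` with a weighted version of `E_{k,k+1}`. -/
theorem commutator_weighted (hC : C ⊆ relR n ∪ relR0 n) (hρ : ActsByGTFormulas C L ρ) {k : ℕ}
    (hk : 1 ≤ k) (hkn : k < n) {w : ℂ → ℂ} {X : Module.End ℂ (TableauSpace C L)}
    (hX : ∀ R ∈ tableaux C L, X (tab C L R) = ∑ a ∈ Finset.Icc 1 k,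
      (w (R.entry k a) * eCoeff R k a) • tab C L (R + delta n k a))
    (hR : R ∈ tableaux C L) :
    (ρ (E n (k + 1) k) * X - X * ρ (E n (k + 1) k)) (tab C L R) = (∑ a ∈ Finset.Icc 1 k,
      (w (R.entry k a) * resPlus (Finset.Icc 1 k) (R.entry k) (adjacentPoly R k) a -
        w (R.entry k a - 1) * resMinus (Finset.Icc 1 k) (R.entry k) (adjacentPoly R k) a)) •
          tab C L R := by
  set P : ℕ → ℕ → ℂ := fun a b => if R + delta n k a ∈ tableaux C L then
    eCoeff R k a * fCoeff (R + delta n k a) k b else 0 with hP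
  set Q : ℕ → ℕ → ℂ := fun a b => if R - delta n k b ∈ tableaux C L then
    fCoeff R k b * eCoeff (R - delta n k b) k a else 0 with hQ
  -- This is needed twice, for the given weight and for the constant weight `1`. If `E_{k+1,k}` acts
  -- before `X`, the argument of the weight is lowered exactly when `a = b`.
  have general : ∀ (w : ℂ → ℂ) (X : Module.End ℂ (TableauSpace C L)),
      (∀ R ∈ tableaux C L, X (tab C L R) = ∑ a ∈ Finset.Icc 1 k,
      (w (R.entry k a) * eCoeff R k a) • tab C L (R + delta n k a)) →
      (ρ (E n (k + 1) k) * X - X * ρ (E n (k + 1) k)) (tab C L R) =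
      ∑ a ∈ Finset.Icc 1 k, ∑ b ∈ Finset.Icc 1 k, (w (R.entry k a) * P a b -
        w (R.entry k a - if a = b then 1 else 0) * Q a b) •
          tab C L (R + delta n k a - delta n k b) := by
    intro w X hX
    have h1 : ρ (E n (k + 1) k) (X (tab C L R)) = ∑ a ∈ Finset.Icc 1 k, ∑ b ∈ Finset.Icc 1 k,
        (w (R.entry k a) * P a b) • tab C L (R + delta n k a - delta n k b) := by
      rw [hX R hR, map_sum]
      refine Finset.sum_congr rfl fun a _ => ?_
      rw [map_smul]
      by_cases hmem : R + delta n k a ∈ tableaux C L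
      · rw [(hρ _ hmem).2.1 k hk (by omega), Finset.smul_sum]
        refine Finset.sum_congr rfl fun b _ => ?_
        rw [smul_smul, hP]
        simp only [if_pos hmem, mul_assoc]
      · rw [tab_of_not_mem hmem, map_zero, smul_zero, Finset.sum_eq_zero]
        intro b _
        simp only [hP, if_neg hmem, mul_zero, zero_smul]
    have h2 : X (ρ (E n (k + 1) k) (tab C L R)) = ∑ a ∈ Finset.Icc 1 k, ∑ b ∈ Finset.Icc 1 k,
        (w (R.entry k a - if a = b then 1 else 0) * Q a b) •
          tab C L (R + delta n k a - delta n k b) := by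
      rw [(hρ R hR).2.1 k hk (by omega), map_sum, Finset.sum_comm]
      refine Finset.sum_congr rfl fun b hb => ?_
      rw [map_smul]
      by_cases hmem : R - delta n k b ∈ tableaux C L
      · rw [hX _ hmem, Finset.smul_sum]
        refine Finset.sum_congr rfl fun a _ => ?_
        rw [smul_smul, hQ, entry_sub, entry_delta_self hkn.le hb, sub_add_eq_add_sub]
        simp only [if_pos hmem]
        congr 1
        ring
      · rw [tab_of_not_mem hmem, map_zero, smul_zero, Finset.sum_eq_zero]
        intro b _
        simp only [hQ, if_neg hmem, mul_zero, zero_smul]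
    rw [LinearMap.sub_apply, Module.End.mul_apply, Module.End.mul_apply, h1, h2,
      ← Finset.sum_sub_distrib]
    refine Finset.sum_congr rfl fun a _ => ?_
    rw [← Finset.sum_sub_distrib]
    exact Finset.sum_congr rfl fun b _ => (sub_smul _ _ _).symm
  -- With weight `1` the commutator is `E_{k+1,k+1} - E_{kk}`, which is diagonal. A tableau `T(R +
  -- δ^{ka} - δ^{kb})` with `a ≠ b` arises from one pair only, so its coefficient is zero; for `a ≠
  -- b` a general weight merely multiplies this coefficient.
  have hoff : ∀ a ∈ Finset.Icc 1 k, ∀ b ∈ Finset.Icc 1 k, a ≠ b →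
      (P a b - Q a b) • tab C L (R + delta n k a - delta n k b) = 0 := by
    intro a ha b hb hab
    by_cases hmem : R + delta n k a - delta n k b ∈ tableaux C L
    · have h1 := general (fun _ => 1) (ρ (E n k (k + 1))) (by
        intro R hR
        rw [(hρ R hR).1 k hk (by omega)]
        simp)
      rw [lie_E k hk hkn, LinearMap.sub_apply, (hρ R hR).2.2 k hk hkn.le,
        (hρ R hR).2.2 (k + 1) (by omega) hkn, ← sub_smul] at h1
      have h2 := congrArg (fun f : TableauSpace C L => f ⟨_, hmem⟩) h1
      simp only [one_mul] at h2
      rw [Finsupp.smul_apply, tab_apply, if_neg, smul_zero, Finsupp.finsetSum_apply] at h2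
      · rw [Finset.sum_eq_single a, Finsupp.finsetSum_apply, Finset.sum_eq_single b,
          Finsupp.smul_apply, tab_apply, if_pos rfl, smul_eq_mul, mul_one] at h2
        · rw [← h2, zero_smul]
        · intro b' hb' hne
          rw [Finsupp.smul_apply, tab_apply, if_neg, smul_zero]
          exact fun e => hne (eq_of_add_delta_sub_delta_eq R hkn ha hb ha hb' hab e).2
        · exact fun h => absurd hb h
        · intro a' ha' hne
          rw [Finsupp.finsetSum_apply]
          refine Finset.sum_eq_zero fun b' hb' => ?_
          rw [Finsupp.smul_apply, tab_apply, if_neg, smul_zero]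
          exact fun e => hne (eq_of_add_delta_sub_delta_eq R hkn ha hb ha' hb' hab e).1
        · exact fun h => absurd ha h
      · intro e
        refine hab (eq_of_add_delta_sub_delta_eq R hkn ha hb ha ha hab ?_).2
        rw [add_sub_cancel_right]
        exact e
    · rw [tab_of_not_mem hmem, smul_zero]
  have hPd : ∀ a ∈ Finset.Icc 1 k,
      P a a = resPlus (Finset.Icc 1 k) (R.entry k) (adjacentPoly R k) a := by
    intro a ha
    by_cases hmem : R + delta n k a ∈ tableaux C L
    · simp only [hP, if_pos hmem]
      exact eCoeff_mul_fCoeff R hkn ha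
    · simp only [hP, if_neg hmem]
      rw [resPlus, eval_adjacentPoly_of_add_not_mem hC hR hkn hmem, zero_div, neg_zero]
  have hQd : ∀ a ∈ Finset.Icc 1 k,
      Q a a = resMinus (Finset.Icc 1 k) (R.entry k) (adjacentPoly R k) a := by
    intro a ha
    by_cases hmem : R - delta n k a ∈ tableaux C L
    · simp only [hQ, if_pos hmem]
      exact fCoeff_mul_eCoeff R hkn ha
    · simp only [hQ, if_neg hmem]
      rw [resMinus, eval_adjacentPoly_of_sub_not_mem hC hR hkn hmem, zero_div, neg_zero]
  rw [general w X hX, Finset.sum_smul]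
  refine Finset.sum_congr rfl fun a ha => ?_
  rw [Finset.sum_eq_single a]
  · rw [if_pos rfl, add_sub_cancel_right, hPd a ha, hQd a ha]
  · intro b hb hne
    rw [if_neg hne.symm, sub_zero, ← mul_sub, mul_smul, hoff a ha b hb hne.symm, smul_zero]
  · exact fun h => absurd ha h

/-- The relation `[E_{k+1,k}, E_{k,k+1}] = E_{k+1,k+1} - E_{kk}` in terms of residues. -/
theorem sum_residues (hC : C ⊆ relR n ∪ relR0 n) (hρ : ActsByGTFormulas C L ρ) {k : ℕ}
    (hk : 1 ≤ k) (hkn : k < n) (hR : R ∈ tableaux C L) :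
    ∑ a ∈ Finset.Icc 1 k, (resPlus (Finset.Icc 1 k) (R.entry k) (adjacentPoly R k) a -
      resMinus (Finset.Icc 1 k) (R.entry k) (adjacentPoly R k) a) =
    hCoeff R (k + 1) - hCoeff R k := by
  have h := commutator_weighted (w := fun _ => 1) (X := ρ (E n k (k + 1))) hC hρ hk hkn (by
        intro R hR
        rw [(hρ R hR).1 k hk (by omega)]
        simp) hR
  rw [lie_E k hk hkn, LinearMap.sub_apply, (hρ R hR).2.2 k hk hkn.le,
    (hρ R hR).2.2 (k + 1) (by omega) hkn, ← sub_smul] at h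
  simp only [one_mul] at h
  exact (smul_left_injective ℂ (tab_ne_zero hR) h).symm

end Commutator

/-! ### Spreading out a tableau -/

section Spread

/-- An integer depending on `x` which increases with `x`, such that of all pairs `x, x + 1` only
`x₀, x₀ + 1` are mapped to the same integer. -/
def spreadShift (x₀ x : ℂ) : ℤ :=
  ⌊(x - x₀).re⌋ - if ∃ d : ℤ, 0 < d ∧ x - x₀ = d then 1 else 0

theorem spreadShift_add (x₀ x : ℂ) (d : ℤ) :
    spreadShift x₀ (x + d) - spreadShift x₀ x = d +
      (if ∃ e : ℤ, 0 < e ∧ x - x₀ = e then 1 else 0) -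
      if ∃ e : ℤ, 0 < e ∧ x + d - x₀ = e then 1 else 0 := by
  have : ⌊(x + d - x₀).re⌋ = ⌊(x - x₀).re⌋ + d := by
    rw [← Int.floor_add_intCast]
    congr 1
    simp
    ring
  rw [spreadShift, spreadShift, this]
  ring

theorem spreadShift_mono (x₀ x : ℂ) {d : ℤ} (hd : 0 ≤ d) :
    spreadShift x₀ x ≤ spreadShift x₀ (x + d) := by
  have h := spreadShift_add x₀ x d
  rcases hd.lt_or_eq with h0 | rfl
  · split_ifs at h <;> omega
  · simp

theorem spreadShift_strict {x₀ x : ℂ} (hx : x ≠ x₀) :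
    spreadShift x₀ x < spreadShift x₀ (x + (1 : ℤ)) := by
  have h := spreadShift_add x₀ x 1
  by_cases h2 : ∃ e : ℤ, 0 < e ∧ x + (1 : ℤ) - x₀ = e
  · have h1 : ∃ e : ℤ, 0 < e ∧ x - x₀ = e := by
      obtain ⟨e, he, e1⟩ := h2
      have e2 : x - x₀ = ((e - 1 : ℤ) : ℂ) := by
        push_cast at e1 ⊢
        linear_combination e1
      refine ⟨e - 1, ?_, e2⟩
      rcases (show 0 ≤ e - 1 by omega).lt_or_eq with h0 | h0
      · exact h0
      · rw [← h0, Int.cast_zero, sub_eq_zero] at e2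
        exact absurd e2 hx
    rw [if_pos h1, if_pos h2] at h
    omega
  · rw [if_neg h2] at h
    split_ifs at h <;> omega

theorem spreadShift_self (x₀ : ℂ) : spreadShift x₀ x₀ = 0 := by
  rw [spreadShift, if_neg]
  · simp
  · rintro ⟨d, hd, e⟩
    rw [sub_self] at e
    have : d = 0 := by exact_mod_cast e.symm
    omega

theorem spreadShift_self_add_one (x₀ : ℂ) : spreadShift x₀ (x₀ + 1) = 0 := by
  rw [spreadShift, if_pos ⟨1, one_pos, by push_cast; ring⟩]
  simp

/-- The map spreading out the entries of a tableau. -/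
def spread (x₀ x : ℂ) : ℂ := x + spreadShift x₀ x

theorem spread_self (x₀ : ℂ) : spread x₀ x₀ = x₀ := by simp [spread, spreadShift_self]

theorem spread_self_add_one (x₀ : ℂ) : spread x₀ (x₀ + 1) = x₀ + 1 := by
  simp [spread, spreadShift_self_add_one]

theorem spread_add (x₀ x : ℂ) (d : ℤ) : spread x₀ (x + d) - spread x₀ x =
    (d + (spreadShift x₀ (x + d) - spreadShift x₀ x) : ℤ) := by
  rw [spread, spread]
  push_cast
  ring

theorem eq_add_of_spread_eq {x₀ x y : ℂ} {e : ℤ} (h : spread x₀ y = spread x₀ x + e) :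
    y = x + ((e + spreadShift x₀ x - spreadShift x₀ y : ℤ) : ℂ) := by
  rw [spread, spread] at h
  push_cast
  linear_combination h

theorem spread_lt {x₀ x : ℂ} {d : ℤ} (hd : 0 ≤ d) {e : ℤ}
    (h : spread x₀ (x + d) = spread x₀ x + e) : d ≤ e := by
  have h1 := spread_add x₀ x d
  rw [h, add_sub_cancel_left, Int.cast_inj] at h1
  have h2 := spreadShift_mono x₀ x hd
  omega

/-- The shifts are integers, so points with equal images differ by an integer; along such points the
map is strictly increasing. -/
theorem spread_injective (x₀ : ℂ) : Function.Injective (spread x₀) := by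
  have key : ∀ x (d : ℤ), 0 ≤ d → spread x₀ (x + d) = spread x₀ x → d = 0 := by
    intro x d hd h
    have := spread_lt (e := 0) hd (by simpa using h)
    omega
  intro x y h
  have e1 := eq_add_of_spread_eq (e := 0) (x := x) (y := y) (x₀ := x₀) (by simp [h])
  have e2 := eq_add_of_spread_eq (e := 0) (x := y) (y := x) (x₀ := x₀) (by simp [h])
  set d := 0 + spreadShift x₀ x - spreadShift x₀ y with hd
  have hd' : 0 + spreadShift x₀ y - spreadShift x₀ x = -d := by omega
  rw [hd'] at e2
  rcases le_total 0 d with h0 | h0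
  · rw [e1] at h
    have := key x d h0 h.symm
    rw [e1, this]
    simp
  · rw [e2] at h
    have := key y (-d) (by omega) h
    rw [e2, this]
    simp

/-- Integral distances never shrink, so a distance one comes from a distance one; and that is
enlarged by `spreadShift_strict` unless it starts at `x₀`. -/
theorem eq_of_spread_eq_add_one {x₀ x y : ℂ} (h : spread x₀ y = spread x₀ x + 1) : x = x₀ := by
  by_contra hx
  have e1 := eq_add_of_spread_eq (e := 1) (x := x) (y := y) (x₀ := x₀) (by simpa using h)
  set d := 1 + spreadShift x₀ x - spreadShift x₀ y with hd
  rcases le_or_gt d 0 with h0 | h0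
  · have h1 : x = y + ((-d : ℤ) : ℂ) := by
      rw [e1]; push_cast; ring
    have h2 : spread x₀ (y + ((-d : ℤ) : ℂ)) = spread x₀ y + ((-1 : ℤ) : ℂ) := by
      rw [← h1, h]; push_cast; ring
    have := spread_lt (by omega) h2
    omega
  · have h2 : spread x₀ (x + d) = spread x₀ x + (1 : ℤ) := by
      rw [← e1, h]; push_cast; ring
    have := spread_lt h0.le h2
    have h3 : d = 1 := by omega
    have h4 := spreadShift_strict hx
    rw [h3] at e1
    rw [← e1] at h4
    omega

end Spread

/-! ### Admissibility rules out double poles -/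

section DoubleZero

variable {n : ℕ} {C : Set (Relation n)} {L R : Tableau n}

theorem IsRealization.of_mem (hL : IsRealization C L) (hR : R ∈ tableaux C L) :
    IsRealization C R := by
  obtain ⟨⟨z, -, hz⟩, hS⟩ := hR
  refine ⟨hS, fun v w hvw hne => ?_⟩
  rw [← hL.2 v w hvw hne]
  constructor
  · rintro ⟨d, hd⟩
    rw [hz, hz] at hd
    exact ⟨d - z v + z w, by push_cast; linear_combination hd⟩
  · rintro ⟨d, hd⟩
    refine ⟨d + z v - z w, ?_⟩
    rw [hz, hz]
    push_cast
    linear_combination hd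

theorem IsRealization.mem_tableaux (hL : IsRealization C L) : L ∈ tableaux C L :=
  ⟨⟨fun _ => 0, fun _ _ => rfl, fun v => by simp⟩, hL.1⟩

/-- Nonnegative integral differences do not decrease, and integrality is preserved both ways. As the
top row is moved too, the result generally leaves the given set of tableaux, so admissibility must
be applied to a new realization. -/
theorem IsRealization.spread (hR : IsRealization C R) (x₀ : ℂ) :
    IsRealization C fun v => spread x₀ (R v) := by
  refine ⟨fun r hr => ?_, fun v w hvw hne => ?_⟩
  · obtain ⟨d, hd, hd0, hd1⟩ := hR.1 r hr
    have e : R r.src = R r.tgt + d := by rw [← hd]; ring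
    refine ⟨_, by beta_reduce; rw [e]; exact spread_add x₀ (R r.tgt) d, ?_, fun h => ?_⟩
    · have := spreadShift_mono x₀ (R r.tgt) hd0
      omega
    · have := spreadShift_mono x₀ (R r.tgt) hd0
      have := hd1 h
      omega
  · rw [← hR.2 v w hvw hne]
    constructor
    · rintro ⟨d, hd⟩
      refine ⟨d - spreadShift x₀ (R v) + spreadShift x₀ (R w), ?_⟩
      change R v + spreadShift x₀ (R v) - (R w + spreadShift x₀ (R w)) = d at hd
      push_cast
      linear_combination hd
    · rintro ⟨d, hd⟩
      refine ⟨d + spreadShift x₀ (R v) - spreadShift x₀ (R w), ?_⟩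
      change R v + spreadShift x₀ (R v) - (R w + spreadShift x₀ (R w)) = _
      push_cast
      linear_combination hd

theorem entry_spread (R : Tableau n) (x₀ : ℂ) {k j : ℕ} (hk : k ≤ n) (hj : j ∈ Finset.Icc 1 k) :
    Tableau.entry (fun v => spread x₀ (R v)) k j = spread x₀ (R.entry k j) := by
  rw [Finset.mem_Icc] at hj
  rw [entry_of_valid _ ⟨hj.1, hj.2, hk⟩, entry_of_valid _ ⟨hj.1, hj.2, hk⟩]

theorem Noncritical.injOn (hR : Noncritical R) {k : ℕ} (hk : k < n) :
    Set.InjOn (R.entry k) (Finset.Icc 1 k : Finset ℕ) := by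
  intro i hi j hj e
  rw [Finset.mem_coe, Finset.mem_Icc] at hi hj
  by_contra hne
  rw [entry_of_valid _ ⟨hi.1, hi.2, hk.le⟩, entry_of_valid _ ⟨hj.1, hj.2, hk.le⟩] at e
  refine hR ⟨(k, i), _⟩ ⟨(k, j), _⟩ rfl (Nat.le_sub_one_of_lt hk) ?_ e
  simpa [Subtype.ext_iff] using hne

open Polynomial in
theorem roots_prod_X_sub_C' {ι : Type*} (s : Finset ι) (u : ι → ℂ) :
    (∏ j ∈ s, (X - Polynomial.C (u j))).roots = s.val.map u := by
  have := roots_multiset_prod_X_sub_C (s.val.map u)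
  rwa [Multiset.map_map] at this

open Polynomial in
theorem sq_dvd_prod_congr {ι : Type*} {s t : Finset ι} {u u' v v' : ι → ℂ} {x : ℂ}
    (hu : ∀ j ∈ s, u j = x ↔ u' j = x) (hv : ∀ j ∈ t, v j = x ↔ v' j = x)
    (h : (X - Polynomial.C x) ^ 2 ∣
      (∏ j ∈ s, (X - Polynomial.C (u j))) * ∏ j ∈ t, (X - Polynomial.C (v j))) :
    (X - Polynomial.C x) ^ 2 ∣
      (∏ j ∈ s, (X - Polynomial.C (u' j))) * ∏ j ∈ t, (X - Polynomial.C (v' j)) := by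
  have h0 : ∀ (s : Finset ι) (u : ι → ℂ), ∏ j ∈ s, (X - Polynomial.C (u j)) ≠ 0 := fun s u =>
    Finset.prod_ne_zero_iff.2 fun j _ => X_sub_C_ne_zero _
  have hm : ∀ u v : ι → ℂ, ((∏ j ∈ s, (X - Polynomial.C (u j))) *
      ∏ j ∈ t, (X - Polynomial.C (v j))).rootMultiplicity x =
      (s.val.filter fun j => x = u j).card + (t.val.filter fun j => x = v j).card := by
    intro u v
    rw [← count_roots, roots_mul (mul_ne_zero (h0 _ _) (h0 _ _)), roots_prod_X_sub_C',
      roots_prod_X_sub_C', Multiset.count_add, Multiset.count_map, Multiset.count_map]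
  rw [← le_rootMultiplicity_iff (mul_ne_zero (h0 _ _) (h0 _ _)), hm] at h ⊢
  rw [Multiset.filter_congr fun j hj => by rw [eq_comm, ← hu j hj, eq_comm],
    Multiset.filter_congr (s := t.val) fun j hj => by rw [eq_comm, ← hv j hj, eq_comm]]
  exact h

open Polynomial in
theorem coeff_prod_X_sub_C {ι : Type*} (s t : Finset ι) (u v : ι → ℂ) {d : ℕ}
    (hd : s.card + t.card = d) (hpos : 0 < d) :
    ((∏ j ∈ s, (X - Polynomial.C (u j))) * ∏ j ∈ t, (X - Polynomial.C (v j))).coeff (d - 1) =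
      -(∑ j ∈ s, u j + ∑ j ∈ t, v j) := by
  have hm : ∀ (s : Finset ι) (u : ι → ℂ), (∏ j ∈ s, (X - Polynomial.C (u j))).Monic :=
    fun s u => monic_prod_of_monic _ _ fun _ _ => monic_X_sub_C _
  have hdeg : ((∏ j ∈ s, (X - Polynomial.C (u j))) *
      ∏ j ∈ t, (X - Polynomial.C (v j))).natDegree = d := by
    rw [(hm s u).natDegree_mul (hm t v), natDegree_prod_of_monic _ _ fun _ _ => monic_X_sub_C _,
      natDegree_prod_of_monic _ _ fun _ _ => monic_X_sub_C _]
    simp only [natDegree_X_sub_C, Finset.sum_const, smul_eq_mul, mul_one, hd]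
  have h1 := (hm s u).nextCoeff_mul (hm t v)
  rw [nextCoeff_of_natDegree_pos (by omega), hdeg, prod_X_sub_C_nextCoeff,
    prod_X_sub_C_nextCoeff] at h1
  rw [h1]
  ring

/-- For admissible `C` the obstructions to raising `r_{ka}` to the value of another entry of its row
come in pairs. -/
theorem sq_dvd_adjacentPoly (hC : C ⊆ relR n ∪ relR0 n) (hadm : Admissible C)
    (hL : IsRealization C L) (hR : R ∈ tableaux C L) {k : ℕ} (hk : 1 ≤ k) (hkn : k < n) {a j : ℕ}
    (ha : a ∈ Finset.Icc 1 k) (hj : j ∈ Finset.Icc 1 k) (h : R.entry k j = R.entry k a + 1) :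
    (Polynomial.X - Polynomial.C (R.entry k a)) ^ 2 ∣ adjacentPoly R k := by
  -- After spreading, the pair `x₀`, `x₀ + 1` is the only possible double node of row `k`, and
  -- `sq_dvd_of_unique` becomes applicable.
  set x₀ := R.entry k a with hx₀
  set R' : Tableau n := fun v => spread x₀ (R v) with hR'
  have hreal : IsRealization C R' := (hL.of_mem hR).spread x₀
  obtain ⟨hcrit, ρ', hρ'⟩ := hadm R' hreal
  have hmem := hreal.mem_tableaux
  have hent : ∀ {k j : ℕ}, k ≤ n → j ∈ Finset.Icc 1 k →
      R'.entry k j = spread x₀ (R.entry k j) := fun hk hj => entry_spread R x₀ hk hj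
  have ea : R'.entry k a = x₀ := by rw [hent hkn.le ha, ← hx₀, spread_self]
  have ej : R'.entry k j = R'.entry k a + 1 := by
    rw [ea, hent hkn.le hj, h, spread_self_add_one]
  have hne : j ≠ a := by
    rintro rfl
    simp at ej
  -- The raised tableau would have two equal entries in row `k`, against noncriticality. So some
  -- relation is tight, which gives the first zero.
  have hadd : R' + delta n k a ∉ tableaux C R' := by
    intro hmem'
    have := (hcrit _ hmem').injOn hkn (Finset.mem_coe.2 hj) (Finset.mem_coe.2 ha) (by
      rw [entry_add, entry_add, entry_delta_self hkn.le ha, entry_delta_self hkn.le ha,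
        if_neg hne, if_pos rfl, ej, add_zero])
    exact hne this
  have hdvd := sq_dvd_of_unique (s := Finset.Icc 1 k) (r := R'.entry k) (N := adjacentPoly R' k)
    ((hcrit R' hmem).injOn hkn) (adjacentPoly_monic R' k) (adjacentPoly_natDegree R' hk) ha hj ej
    (eval_adjacentPoly_of_add_not_mem hC hmem hkn hadd) (by
      intro b hb i hi e
      rw [hent hkn.le hi, hent hkn.le hb] at e
      refine ((hadm L hL).1 R hR).injOn hkn (Finset.mem_coe.2 hb) (Finset.mem_coe.2 ha) ?_
      exact eq_of_spread_eq_add_one e) (by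
      -- Both subleading coefficients are minus sums of roots. The shifts by one contribute `k - 1`
      -- and `k`, and the discrepancy is the constant `1` in the difference of the eigenvalues of
      -- `E_{k+1,k+1}` and `E_{kk}`.
      have hc : (Finset.Icc 1 k).card = k := by simp
      rw [sum_residues hC hρ' hk hkn hmem, adjacentPoly, nodePoly,
        coeff_prod_X_sub_C _ _ _ _ (by simp only [Nat.card_Icc]; omega) (by omega),
        coeff_prod_X_sub_C _ _ _ _ (by ring) (by omega), hCoeff, hCoeff]
      simp only [Finset.sum_sub_distrib, Finset.sum_const, Nat.card_Icc, nsmul_eq_mul, mul_one,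
        Nat.add_sub_cancel]
      push_cast [Nat.cast_sub hk]
      ring)
  rw [ea] at hdvd
  -- Spreading is injective and fixes `x₀` and `x₀ + 1`, so the multiplicity of the zero `x₀` is the
  -- same before and after.
  refine sq_dvd_prod_congr (fun i hi => ?_) (fun i hi => ?_) hdvd
  · rw [hent hkn hi]
    constructor
    · intro e
      exact spread_injective x₀ (by rw [e, spread_self])
    · intro e
      rw [e, spread_self]
  · rw [hent (by omega) hi, sub_eq_iff_eq_add, sub_eq_iff_eq_add]
    constructor
    · intro e
      exact spread_injective x₀ (by rw [e, spread_self_add_one])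
    · intro e
      rw [e, spread_self_add_one]

theorem defect_adjacentPoly_eq_zero (hC : C ⊆ relR n ∪ relR0 n) (hadm : Admissible C)
    (hL : IsRealization C L) (hR : R ∈ tableaux C L) {k : ℕ} (hk : 1 ≤ k) (hkn : k < n) :
    defect (Finset.Icc 1 k) (R.entry k) (adjacentPoly R k) = 0 :=
  defect_eq_zero (((hadm L hL).1 R hR).injOn hkn) (adjacentPoly_monic R k)
    (adjacentPoly_natDegree R hk) fun _ ha _ hj e =>
      sq_dvd_adjacentPoly hC hadm hL hR hk hkn ha hj e

end DoubleZero

/-! ### The action of the Gelfand-Tsetlin subalgebra -/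

section Action

open Matrix

variable {n : ℕ} {C : Set (Relation n)} {L R : Tableau n}
variable {ρ : gln n →ₗ⁅ℂ⁆ Module.End ℂ (TableauSpace C L)}

/-- `∏ (1 - (r_{kj} + c) z)` -/
def rowProd (R : Tableau n) (k : ℕ) (c : ℂ) : PowerSeries ℂ :=
  linProd (Finset.Icc 1 k) fun j => R.entry k j + c

/-- `∏ 1 / (1 - (r_{kj} + c) z)` -/
def rowInv (R : Tableau n) (k : ℕ) (c : ℂ) : PowerSeries ℂ :=
  invProd (Finset.Icc 1 k) fun j => R.entry k j + c

theorem rowProd_mul_rowInv (R : Tableau n) (k : ℕ) (c : ℂ) : rowProd R k c * rowInv R k c = 1 :=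
  linProd_mul_invProd _ _

theorem traceEigen_row (R : Tableau n) (k : ℕ) (c : ℂ) :
    traceEigen (Finset.Icc 1 k) (fun j => R.entry k j + c) = rowProd R k (c + 1) * rowInv R k c := by
  simp only [traceEigen, rowProd, rowInv, add_assoc]

/-- `1 - ∑ tr((M_k + b)^p) z^(p+1)` acts diagonally, by the expected series. -/
def TraceActs (ρ : gln n →ₗ⁅ℂ⁆ Module.End ℂ (TableauSpace C L)) (k : ℕ) : Prop :=
  ∀ R ∈ tableaux C L, ∀ b : ℂ,
    ActsBy (1 - PowerSeries.X * traceSeries (genMat ρ k + b • 1)) (tab C L R)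
      (rowProd R k (b + k) * rowInv R k (b + k - 1))

/-- The quasideterminant acts diagonally, by the expected series. -/
def QuasidetActs (ρ : gln n →ₗ⁅ℂ⁆ Module.End ℂ (TableauSpace C L)) (k : ℕ) : Prop :=
  ∀ R ∈ tableaux C L, ∀ b : ℂ,
    ActsBy (quasidetSeries b (genMat ρ (k + 1))) (tab C L R)
      (rowProd R (k + 1) (b + k) * rowInv R k (b + k))

/-- The eigenvalue of `tr(M_k²)`. -/
def traceSqEigen (R : Tableau n) (k : ℕ) : ℂ :=
  -PowerSeries.coeff 3 (traceEigen (Finset.Icc 1 k) fun j => R.entry k j + ((k : ℂ) - 1))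

theorem TraceActs.trace_sq {k : ℕ} (h : TraceActs ρ k) (hR : R ∈ tableaux C L) :
    (genMat ρ k ^ 2).trace (tab C L R) = traceSqEigen R k • tab C L R := by
  have := (h R hR 0).coeff_of_one_sub_X_mul 2
  rw [zero_smul, add_zero, traceSeries, PowerSeries.coeff_mk, zero_add] at this
  rw [traceSqEigen, traceEigen_row, sub_add_cancel, this]

theorem traceSqEigen_add_delta (R : Tableau n) {k a : ℕ} (hk : k ≤ n) (ha : a ∈ Finset.Icc 1 k) :
    traceSqEigen (R + delta n k a) k - traceSqEigen R k = 2 * R.entry k a + k := by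
  have h := coeff_three_traceEigen_sub ha (y := fun j => R.entry k j + ((k : ℂ) - 1))
    (y' := fun j => (R + delta n k a).entry k j + ((k : ℂ) - 1)) (by
      intro j hj
      rw [entry_add, entry_delta_self hk ha, if_neg (Finset.mem_erase.1 hj).1, add_zero])
  rw [entry_add, entry_delta_self hk ha, if_pos rfl, Nat.card_Icc, Nat.add_sub_cancel] at h
  rw [traceSqEigen, traceSqEigen]
  linear_combination h

theorem isTensorOperator_shift_pow {κ A : Type*} [Fintype κ] [DecidableEq κ] [Ring A] [Algebra ℂ A]
    {M : Matrix κ κ A} (hM : IsTensorOperator M M) (b : ℂ) (p : ℕ) :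
    IsTensorOperator M ((M + b • 1) ^ p) :=
  (hM.add ((IsTensorOperator.one M).smul b)).pow p

/-- The action of `∑_j ((M_k + b)^p)_{kj} E_{j,k+1}`. -/
theorem weighted_raising (hρ : ActsByGTFormulas C L ρ) {m : ℕ} (hm : m + 1 < n)
    (hT : TraceActs ρ (m + 1)) (b : ℂ) (p : ℕ) (hR : R ∈ tableaux C L) :
    ((genMat ρ (m + 1) + b • 1) ^ p *ᵥ lastCol (genMat ρ (m + 2))) (Fin.last m) (tab C L R) =
      ∑ a ∈ Finset.Icc 1 (m + 1), ((R.entry (m + 1) a + ((m + 1 : ℕ) + b)) ^ p *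
        eCoeff R (m + 1) a) • tab C L (R + delta n (m + 1) a) := by
  induction p generalizing R with
  | zero =>
    simp only [pow_zero, one_mul, Matrix.one_mulVec]
    exact (hρ R hR).1 (m + 1) (by omega) (by omega)
  | succ p ih =>
    set M := genMat ρ (m + 1) with hM
    set Ψ := (M + b • 1) ^ p *ᵥ lastCol (genMat ρ (m + 2)) with hΨ
    have hten : IsTensorOperator (genMat ρ (m + 2)) (genMat ρ (m + 2)) :=
      isTensorOperator_genMat ρ hm
    have hvec : IsVectorOperator M Ψ :=
      hten.lastCol.tensor_mulVec (isTensorOperator_shift_pow hten.topBlock b p)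
    -- Set `k = m + 1`. Raising `r_{ka}` changes the eigenvalue of `tr(M_k²)` by `2 r_{ka} + k`, so
    -- multiplication by `M_k` multiplies the term of index `a` by half of `2 r_{ka} + k + k`, that
    -- is by `r_{ka} + k`.
    have hc := commutator_trace_sq hvec (Fin.last m)
    rw [Fintype.card_fin] at hc
    have hsucc : ((M + b • 1) ^ (p + 1) *ᵥ lastCol (genMat ρ (m + 2))) (Fin.last m) =
        (M *ᵥ Ψ) (Fin.last m) + b • Ψ (Fin.last m) := by
      rw [pow_succ', ← Matrix.mulVec_mulVec, Matrix.add_mulVec, Matrix.smul_mulVec,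
        Matrix.one_mulVec]
      rfl
    have h2 : (2 : ℂ) • (M *ᵥ Ψ) (Fin.last m) (tab C L R) =
        (M ^ 2).trace (Ψ (Fin.last m) (tab C L R)) - Ψ (Fin.last m) ((M ^ 2).trace (tab C L R)) +
          ((m + 1 : ℕ) : ℂ) • Ψ (Fin.last m) (tab C L R) := by
      have := congrArg (fun X : Module.End ℂ (TableauSpace C L) => X (tab C L R)) hc
      simp only [LinearMap.sub_apply, Module.End.mul_apply] at this
      rw [this, two_smul, Module.End.natCast_apply, Nat.cast_smul_eq_nsmul]
      change _ = (2 : Module.End ℂ (TableauSpace C L)) _ - _ + _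
      rw [sub_add_cancel, Module.End.ofNat_apply, ofNat_smul_eq_nsmul, two_nsmul]
    have h3 : (M ^ 2).trace (Ψ (Fin.last m) (tab C L R)) -
        Ψ (Fin.last m) ((M ^ 2).trace (tab C L R)) = ∑ a ∈ Finset.Icc 1 (m + 1),
        ((2 * R.entry (m + 1) a + (m + 1 : ℕ)) * ((R.entry (m + 1) a + ((m + 1 : ℕ) + b)) ^ p *
        eCoeff R (m + 1) a)) • tab C L (R + delta n (m + 1) a) := by
      rw [hT.trace_sq hR, map_smul, ih hR, map_sum, Finset.smul_sum, ← Finset.sum_sub_distrib]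
      refine Finset.sum_congr rfl fun a ha => ?_
      rw [map_smul]
      by_cases hmem : R + delta n (m + 1) a ∈ tableaux C L
      · rw [hT.trace_sq hmem, smul_smul, smul_smul, ← sub_smul,
          ← traceSqEigen_add_delta R hm.le ha]
        congr 1
        ring
      · rw [tab_of_not_mem hmem, map_zero, smul_zero, smul_zero, smul_zero, sub_zero]
    rw [h3, ih hR, Finset.smul_sum, ← Finset.sum_add_distrib] at h2
    have h4 : (M *ᵥ Ψ) (Fin.last m) (tab C L R) = (2 : ℂ)⁻¹ • (2 : ℂ) •
        (M *ᵥ Ψ) (Fin.last m) (tab C L R) := by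
      rw [smul_smul, inv_mul_cancel₀ two_ne_zero, one_smul]
    rw [hsucc, LinearMap.add_apply, LinearMap.smul_apply, h4, h2, ih hR, Finset.smul_sum,
      Finset.smul_sum, ← Finset.sum_add_distrib]
    refine Finset.sum_congr rfl fun a _ => ?_
    simp only [smul_smul, ← add_smul]
    congr 1
    push_cast
    ring

theorem quasidetActs_zero (hn : 1 ≤ n) (hρ : ActsByGTFormulas C L ρ) : QuasidetActs ρ 0 := by
  intro R hR b
  rw [quasidetSeries_zero]
  have h1 : ActsBy (PowerSeries.C (genMat ρ 1 0 0 + algebraMap ℂ _ b)) (tab C L R)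
      (PowerSeries.C (R.entry 1 1 + b)) := by
    intro p
    rw [PowerSeries.coeff_C, PowerSeries.coeff_C]
    split_ifs
    · have h2 := (hρ R hR).2.2 1 le_rfl hn
      have h3 : hCoeff R 1 = R.entry 1 1 := by simp [hCoeff]
      rw [h3] at h2
      rw [LinearMap.add_apply, Module.algebraMap_end_apply, add_smul]
      congr 1
    · simp
  have h2 := (ActsBy.one (tab C L R)).sub h1.X_mul
  have e : (1 - PowerSeries.X * PowerSeries.C (R.entry 1 1 + b) : PowerSeries ℂ) =
      rowProd R (0 + 1) (b + (0 : ℕ)) * rowInv R 0 (b + (0 : ℕ)) := by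
    simp [rowProd, rowInv, linProd_eq_prod, invProd, mul_comm]
  rw [← e]
  exact h2

theorem traceActs_zero : TraceActs ρ 0 := by
  intro R hR b
  have e1 : traceSeries (genMat ρ 0 + b • 1) = 0 := by
    ext p : 1
    simp [traceSeries, Matrix.trace]
  have e2 : rowProd R 0 (b + (0 : ℕ)) * rowInv R 0 (b + (0 : ℕ) - 1) = 1 := by
    simp [rowProd, rowInv, linProd_eq_prod, invProd]
  rw [e1, e2]
  exact ActsBy.one_sub_X_mul_zero _

/-- `∑ (residues of N(t) / (q(t) q(t+1)) times powers of the poles shifted by c) z^p` -/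
def residueSeries (R : Tableau n) (k : ℕ) (c : ℂ) : PowerSeries ℂ :=
  PowerSeries.mk fun p => ∑ a ∈ Finset.Icc 1 k,
    (resPlus (Finset.Icc 1 k) (R.entry k) (adjacentPoly R k) a * (R.entry k a + c) ^ p -
      resMinus (Finset.Icc 1 k) (R.entry k) (adjacentPoly R k) a * (R.entry k a + c - 1) ^ p)

theorem one_sub_residueSeries {k : ℕ} (hk : 1 ≤ k)
    (h : defect (Finset.Icc 1 k) (R.entry k) (adjacentPoly R k) = 0) (c : ℂ) :
    (1 - PowerSeries.X * residueSeries R k c) * (rowProd R k c * rowProd R k (c - 1)) =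
      rowProd R (k + 1) c * rowProd R (k - 1) (c - 1) := by
  have h3 := residue_series (s := Finset.Icc 1 k) (r := R.entry k)
    (s₁ := Finset.Icc 1 (k + 1)) (s₂ := Finset.Icc 1 (k - 1))
    (u := R.entry (k + 1)) (w := R.entry (k - 1)) (by simp only [Nat.card_Icc]; omega) h c
  simp only [add_sub_assoc] at h3
  simp only [residueSeries, add_sub_assoc]
  exact h3

/-- The action of the commutator of `E_{k+1,k}` with `∑_j ((M_k + b)^p)_{kj} E_{j,k+1}`. -/
theorem commutatorActs (hC : C ⊆ relR n ∪ relR0 n) (hρ : ActsByGTFormulas C L ρ) {m : ℕ}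
    (hm : m + 1 < n) (hT : TraceActs ρ (m + 1)) (hR : R ∈ tableaux C L) (b : ℂ) :
    ActsBy (PowerSeries.mk fun p => lastRow (genMat ρ (m + 2)) (Fin.last m) *
      ((topBlock (genMat ρ (m + 2)) + b • 1) ^ p *ᵥ lastCol (genMat ρ (m + 2))) (Fin.last m) -
      ((topBlock (genMat ρ (m + 2)) + b • 1) ^ p *ᵥ lastCol (genMat ρ (m + 2))) (Fin.last m) *
        lastRow (genMat ρ (m + 2)) (Fin.last m)) (tab C L R)
      (residueSeries R (m + 1) ((m + 1 : ℕ) + b)) := by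
  intro p
  rw [PowerSeries.coeff_mk, residueSeries, PowerSeries.coeff_mk]
  refine (commutator_weighted hC hρ (k := m + 1) (by omega) hm
    (w := fun x => (x + ((m + 1 : ℕ) + b)) ^ p)
    (fun R hR => weighted_raising hρ hm hT b p hR) hR).trans ?_
  congr 1
  refine Finset.sum_congr rfl fun a _ => ?_
  rw [sub_add_eq_add_sub]
  ring

/-- For `k = m + 1` and `c = b + k`, the commutator series contributes rows `k + 1` at `c` and `k -
1` at `c - 1` over row `k` at `c` and at `c - 1`. The known eigenvalue, row `k` at `c - 1` over row
`k - 1` at `c - 1`, cancels all but row `k + 1` over row `k` at `c`. -/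
theorem quasidetActs_succ (hC : C ⊆ relR n ∪ relR0 n) (hadm : Admissible C)
    (hL : IsRealization C L) (hρ : ActsByGTFormulas C L ρ) {m : ℕ} (hm : m + 1 < n)
    (hT : TraceActs ρ (m + 1)) (hQ : QuasidetActs ρ m) : QuasidetActs ρ (m + 1) := by
  intro R hR b
  have h2 := (hQ R hR b).mul ((ActsBy.one (tab C L R)).sub
    (commutatorActs hC hρ hm hT hR b).X_mul)
  rw [← topBlock_genMat ρ (m + 1), ← quasidetSeries_succ b (isTensorOperator_genMat ρ hm)] at h2
  have h3 := one_sub_residueSeries (k := m + 1) (by omega)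
    (defect_adjacentPoly_eq_zero hC hadm hL hR (k := m + 1) (by omega) hm) ((m + 1 : ℕ) + b)
  have e1 : ((m + 1 : ℕ) : ℂ) + b = b + (m + 1 : ℕ) := add_comm _ _
  have e2 : b + ((m + 1 : ℕ) : ℂ) - 1 = b + m := by push_cast; ring
  have i1 := rowProd_mul_rowInv R (m + 1) (b + (m + 1 : ℕ))
  have i2 := rowProd_mul_rowInv R m (b + m)
  rw [e1] at h2 h3
  rw [e2, Nat.add_sub_cancel] at h3
  have e : rowProd R (m + 1 + 1) (b + (m + 1 : ℕ)) * rowInv R (m + 1) (b + (m + 1 : ℕ)) =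
      rowProd R (m + 1) (b + m) * rowInv R m (b + m) *
        (1 - PowerSeries.X * residueSeries R (m + 1) (b + (m + 1 : ℕ))) := by
    generalize residueSeries R (m + 1) (b + (m + 1 : ℕ)) = g at *
    generalize rowProd R (m + 1) (b + (m + 1 : ℕ)) = p1 at *
    generalize rowInv R (m + 1) (b + (m + 1 : ℕ)) = p2 at *
    generalize rowProd R m (b + m) = p3 at *
    generalize rowInv R m (b + m) = p4 at *
    generalize rowProd R (m + 1 + 1) (b + (m + 1 : ℕ)) = p5 at *
    generalize rowProd R (m + 1) (b + m) = p6 at *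
    linear_combination p6 * (1 - PowerSeries.X * g) * p4 * i1
      - (p5 * p2) * i2 - (p2 * p4) * h3
  rw [e]
  exact h2

/-- In `one_sub_traceSeries` all factors from row `m` cancel. The recursion uses both `b` and `b +
1`, which is why the eigenvalues are stated for every `b`. -/
theorem traceActs_succ {m : ℕ} (hm : m < n) (hT : TraceActs ρ m) (hQ : QuasidetActs ρ m) :
    TraceActs ρ (m + 1) := by
  intro R hR b
  rw [one_sub_traceSeries b (isTensorOperator_genMat ρ hm)]
  have i1 := rowProd_mul_rowInv R (m + 1) (b + m)
  have i2 := rowProd_mul_rowInv R m (b + m)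
  have i3 := rowProd_mul_rowInv R m (b + m + 1)
  have h1 : ActsBy (resolventSeries (genMat ρ (m + 1) + b • 1) (Fin.last m) (Fin.last m))
      (tab C L R) (1 * (rowInv R (m + 1) (b + m) * rowProd R m (b + m))) := by
    refine ActsBy.of_mul_right (y := quasidetSeries b (genMat ρ (m + 1))) ?_ (hQ R hR b) ?_
    · rw [mul_quasidetSeries]
      exact ActsBy.one _
    · linear_combination (rowProd R m (b + m) * rowInv R m (b + m)) * i1 + i2
  have h2 := h1.mul ((hQ R hR (b + 1)).mul (hT R hR (b + 1)))
  rw [topBlock_genMat]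
  have e1 : b + 1 + m - 1 = b + m := by ring
  have e2 : b + 1 + m = b + m + 1 := by ring
  have e3 : b + (m + 1 : ℕ) = b + m + 1 := by push_cast; ring
  rw [e1, e2] at h2
  rw [e3, add_sub_cancel_right]
  have e : rowProd R (m + 1) (b + m + 1) * rowInv R (m + 1) (b + m) =
      1 * (rowInv R (m + 1) (b + m) * rowProd R m (b + m)) *
        (rowProd R (m + 1) (b + m + 1) * rowInv R m (b + m + 1) *
          (rowProd R m (b + m + 1) * rowInv R m (b + m))) := by
    generalize rowProd R (m + 1) (b + m + 1) = p1 at *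
    generalize rowInv R (m + 1) (b + m) = p2 at *
    generalize rowProd R m (b + m) = p3 at *
    generalize rowInv R m (b + m) = p4 at *
    generalize rowProd R m (b + m + 1) = p5 at *
    generalize rowInv R m (b + m + 1) = p6 at *
    linear_combination (-(p1 * p2 * p5 * p6)) * i2 - (p1 * p2) * i3
  rw [e]
  exact h2

theorem acts_of_lt (hC : C ⊆ relR n ∪ relR0 n) (hadm : Admissible C)
    (hL : IsRealization C L) (hρ : ActsByGTFormulas C L ρ) (m : ℕ) (hm : m < n) :
    TraceActs ρ m ∧ QuasidetActs ρ m := by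
  induction m with
  | zero => exact ⟨traceActs_zero, quasidetActs_zero hm hρ⟩
  | succ m ih =>
    obtain ⟨h1, h2⟩ := ih (by omega)
    have h3 := traceActs_succ (by omega) h1 h2
    exact ⟨h3, quasidetActs_succ hC hadm hL hρ hm h3 h2⟩

theorem traceActs_of_le (hC : C ⊆ relR n ∪ relR0 n) (hadm : Admissible C)
    (hL : IsRealization C L) (hρ : ActsByGTFormulas C L ρ) {m : ℕ} (hm : m ≤ n) :
    TraceActs ρ m := by
  cases m with
  | zero => exact traceActs_zero
  | succ m =>
    obtain ⟨h1, h2⟩ := acts_of_lt hC hadm hL hρ m hm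
    exact traceActs_succ hm h1 h2

theorem uAction_genMat_pow (m p : ℕ) (i j : Fin m) :
    uAction ρ ((genMat (ι ℂ : gln n →ₗ⁅ℂ⁆ UGL n) m ^ p) i j) = (genMat ρ m ^ p) i j :=
  map_genMat_pow (ι ℂ : gln n →ₗ⁅ℂ⁆ UGL n) ρ (uAction ρ) (fun x => lift_ι_apply ℂ ρ x) m p i j

theorem uAction_cGen_eq_trace (m k : ℕ) :
    uAction ρ (cGen n m (k + 1)) = (genMat ρ m ^ (k + 1)).trace := by
  rw [cGen_eq_trace, Matrix.trace, Matrix.trace, map_sum]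
  exact Finset.sum_congr rfl fun i _ => uAction_genMat_pow m (k + 1) i i

/-- The generators `c_{mk}` of the Gelfand-Tsetlin subalgebra act diagonally. -/
theorem uAction_cGen (hC : C ⊆ relR n ∪ relR0 n) (hadm : Admissible C)
    (hL : IsRealization C L) (hρ : ActsByGTFormulas C L ρ) {m k : ℕ} (hk : 1 ≤ k) (hm : m ≤ n)
    (hR : R ∈ tableaux C L) :
    uAction ρ (cGen n m k) (tab C L R) = gammaAt m k R • tab C L R := by
  obtain ⟨k, rfl⟩ : ∃ l, k = l + 1 := ⟨k - 1, by omega⟩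
  have h1 := (traceActs_of_le hC hadm hL hρ hm R hR 0).coeff_of_one_sub_X_mul (k + 1)
  rw [zero_smul, add_zero, traceSeries, PowerSeries.coeff_mk, zero_add] at h1
  have h3 : gammaAt m (k + 1) R =
      -PowerSeries.coeff (k + 1 + 1) (rowProd R m m * rowInv R m (m - 1)) := by
    have e := traceEigen_row R m ((m : ℂ) - 1)
    rw [sub_add_cancel] at e
    rw [gammaAt, eval_gammaPoly_eq_coeff, ← e, traceEigen_eq_prod, traceEigen_eq_prod]
    congr 2
    rw [Fin.prod_univ_eq_prod_range (fun i => 1 - PowerSeries.X *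
      geomSeries (R.entry m (i + 1) + (m : ℂ) - 1)) m, Finset.range_eq_Ico,
      Finset.prod_Ico_add' (fun j => 1 - PowerSeries.X * geomSeries (R.entry m j + (m : ℂ) - 1))]
    simp only [add_sub_assoc]
    rfl
  rw [uAction_cGen_eq_trace, h1, h3]

end Action

/-! ### Finite generation -/

section Patterns

variable {n : ℕ} {C : Set (Relation n)} {L R S : Tableau n}

/-- The pairs of vertices in adjacent rows between which `≥` holds. -/
def pattern (R : Tableau n) : Set (Vertex n × Vertex n) :=
  {p | p.1.row = p.2.row + 1 ∧ ∃ d : ℤ, 0 ≤ d ∧ R p.1 - R p.2 = d}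

/-- The tableau shifted by an integral vector. -/
def shift (R : Tableau n) (z : Vertex n → ℤ) : Tableau n := fun v => R v + z v

theorem shift_sub (R : Tableau n) (z : Vertex n → ℤ) {v w : Vertex n} {d : ℤ}
    (h : R v - R w = d) : shift R z v - shift R z w = (d + z v - z w : ℤ) := by
  rw [shift, shift]
  push_cast
  linear_combination h

theorem mem_pattern_shift (R : Tableau n) (z : Vertex n → ℤ) {v w : Vertex n} :
    (v, w) ∈ pattern (shift R z) ↔
      v.row = w.row + 1 ∧ ∃ d : ℤ, 0 ≤ d + z v - z w ∧ R v - R w = d := by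
  refine and_congr_right fun _ => ⟨?_, ?_⟩
  · rintro ⟨d, hd, e⟩
    refine ⟨d - z v + z w, by omega, ?_⟩
    simp only [shift] at e
    push_cast
    linear_combination e
  · rintro ⟨d, hd, e⟩
    exact ⟨_, hd, shift_sub R z e⟩

theorem pattern_shift_eq_iff (R : Tableau n) (z z' : Vertex n → ℤ) :
    pattern (shift R z) = pattern (shift R z') ↔ ∀ v w : Vertex n, v.row = w.row + 1 →
      ∀ d : ℤ, R v - R w = d → (0 ≤ d + z v - z w ↔ 0 ≤ d + z' v - z' w) := by
  constructor
  · intro h v w hvw d hd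
    have := Set.ext_iff.1 h (v, w)
    rw [mem_pattern_shift, mem_pattern_shift] at this
    constructor
    · intro h0
      obtain ⟨-, d', h1, h2⟩ := this.1 ⟨hvw, d, h0, hd⟩
      rw [hd, Int.cast_inj] at h2
      rwa [h2]
    · intro h0
      obtain ⟨-, d', h1, h2⟩ := this.2 ⟨hvw, d, h0, hd⟩
      rw [hd, Int.cast_inj] at h2
      rwa [h2]
  · intro h
    ext ⟨v, w⟩
    rw [mem_pattern_shift, mem_pattern_shift]
    exact and_congr_right fun hvw => exists_congr fun d => and_congr_left fun hd => h v w hvw d hd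

theorem shift_zero (R : Tableau n) : shift R 0 = R := by
  ext v
  simp [shift]

theorem shift_shift (R : Tableau n) (z z' : Vertex n → ℤ) :
    shift (shift R z) z' = shift R (z + z') := by
  ext v
  simp only [shift, Pi.add_apply]
  push_cast
  ring

theorem shift_single (R : Tableau n) (v : Vertex n) :
    shift R (Pi.single v 1) = R + delta n v.1.1 v.1.2 := by
  ext w
  rw [shift, Pi.add_apply, delta]
  by_cases h : w = v
  · subst h
    simp
  · rw [Pi.single_eq_of_ne h, if_neg fun e => h (Subtype.ext e)]
    simp

theorem exists_shift_eq (hR : R ∈ tableaux C L) (hS : S ∈ tableaux C L) :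
    ∃ z : Vertex n → ℤ, (∀ v, v.row = n → z v = 0) ∧ S = shift R z := by
  obtain ⟨⟨z, hz, e⟩, -⟩ := hR
  obtain ⟨⟨z', hz', e'⟩, -⟩ := hS
  refine ⟨fun v => z' v - z v, fun v hv => by simp [hz v hv, hz' v hv], ?_⟩
  ext v
  rw [shift, e, e']
  push_cast
  ring

/-- Membership in `𝓑_C(T(L))` depends on the pattern only. -/
theorem shift_mem_of_pattern_eq (hC : C ⊆ relR n ∪ relR0 n) (hR : R ∈ tableaux C L)
    {z : Vertex n → ℤ} (hz : ∀ v, v.row = n → z v = 0) (h : pattern (shift R z) = pattern R) :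
    shift R z ∈ tableaux C L := by
  refine mem_tableaux_of_shift hR hz (fun v => rfl) fun r hr => ?_
  obtain ⟨d, hd, hd0, hd1⟩ := hR.2 r hr
  rw [← shift_zero R, shift_shift, zero_add, pattern_shift_eq_iff] at h
  refine ⟨_, shift_sub R z hd, ?_⟩
  rcases hC hr with (⟨hb, hrow⟩ | ⟨hb, hrow⟩) | ⟨hb, hs, ht, -⟩
  · have := h _ _ hrow d hd
    simp only [Pi.zero_apply] at this
    rw [hb]
    exact ⟨by omega, by simp⟩
  -- For integral differences, the strict relation `(i-1, j') > (i, j)` is the negation of `(i, j) ≥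
  -- (i-1, j')`, so the pattern decides it as well.
  · have := h _ _ hrow (-d) (by push_cast; linear_combination -hd)
    have := hd1 hb
    simp only [Pi.zero_apply] at *
    exact ⟨by omega, fun _ => by omega⟩
  · rw [hz _ hs, hz _ ht, hb]
    exact ⟨by omega, by simp⟩

instance (n : ℕ) : Finite (Vertex n) := by
  refine Finite.of_injective (fun v : Vertex n =>
    ((⟨v.1.1, by have := v.2.2.2; omega⟩, ⟨v.1.2, by have := v.2.2; omega⟩) :
      Fin (n + 1) × Fin (n + 1))) fun v w h => ?_
  simp only [Prod.mk.injEq, Fin.mk.injEq] at h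
  exact Subtype.ext (Prod.ext h.1 h.2)

/-- If `R` and `R + z` have the same pattern and `z ≥ 0` then some entry of `R` can be raised
towards `R + z` without changing the pattern. -/
theorem exists_raise {z : Vertex n → ℤ} (hz : 0 ≤ z) (hne : z ≠ 0)
    (h : pattern (shift R z) = pattern R) :
    ∃ v, 0 < z v ∧ pattern (shift R (Pi.single v 1)) = pattern R := by
  have hfin : {v | 0 < z v}.Finite := Set.toFinite _
  have hnon : {v | 0 < z v}.Nonempty := by
    by_contra hcon
    rw [Set.not_nonempty_iff_eq_empty, Set.eq_empty_iff_forall_notMem] at hcon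
    exact hne (funext fun v => le_antisymm (not_lt.1 (hcon v)) (hz v))
  -- Raising `v` can change the pattern only through an entry one larger in the row below or an
  -- equal entry in the row above. Such an entry would also have to be raised, since `R + z` has the
  -- old pattern; but it comes later in this lexicographic order.
  obtain ⟨v, hv, hmax⟩ := hfin.exists_maximalFor (fun v => toLex ((R v).re, v.row)) _ hnon
  have key : ∀ w, 0 < z w → ¬ ((R v).re < (R w).re ∨ (R v).re = (R w).re ∧ v.row < w.row) := by
    intro w hw hlt
    have h1 : toLex ((R v).re, v.row) < toLex ((R w).re, w.row) := Prod.Lex.toLex_lt_toLex.2 hlt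
    exact absurd (hmax hw h1.le) (not_le.2 h1)
  refine ⟨v, hv, ?_⟩
  have hv' : 0 < z v := hv
  rw [← shift_zero R, shift_shift, zero_add, pattern_shift_eq_iff] at h ⊢
  intro u w huw d hd
  have h1 := h u w huw d hd
  have hre : (R u).re = (R w).re + d := by
    have := congrArg Complex.re hd
    simp at this
    linarith
  simp only [Pi.zero_apply, Pi.single_apply] at h1 ⊢
  by_cases hu : u = v <;> by_cases hw : w = v
  · subst hu hw
    simp
  · subst hu
    rw [if_pos rfl, if_neg hw]
    by_contra hcon
    have hd1 : d = -1 := by omega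
    refine key w (by omega) (Or.inl ?_)
    rw [hre, hd1]
    simp
  · subst hw
    rw [if_pos rfl, if_neg hu]
    by_contra hcon
    have hd1 : d = 0 := by omega
    refine key u (by omega) (Or.inr ⟨?_, by omega⟩)
    rw [hre, hd1]
    simp
  · rw [if_neg hu, if_neg hw]

end Patterns

/-! ### Tableaux with the same pattern generate the same submodule -/

section Generation

variable {n : ℕ} {C : Set (Relation n)} {L R S : Tableau n}
variable {ρ : gln n →ₗ⁅ℂ⁆ Module.End ℂ (TableauSpace C L)}

/-- Applying `T - μ b` removes one eigenvector and rescales the others by nonzero factors. -/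
theorem mem_of_sum_eigenvectors_mem {V ι : Type*} [AddCommGroup V] [Module ℂ V]
    {N : Submodule ℂ V} {T : Module.End ℂ V} (hT : ∀ v ∈ N, T v ∈ N) {μ : ι → ℂ} (s : Finset ι)
    {y : ι → V} (hμ : Set.InjOn μ s) (hy : ∀ a ∈ s, T (y a) = μ a • y a)
    (h : ∑ a ∈ s, y a ∈ N) : ∀ a ∈ s, y a ∈ N := by
  induction s using Finset.induction_on generalizing y with
  | empty => simp
  | insert b s hb ih =>
    have h1 : ∑ a ∈ s, (μ a - μ b) • y a ∈ N := by
      have := N.sub_mem (hT _ h) (N.smul_mem (μ b) h)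
      rw [map_sum, Finset.smul_sum, ← Finset.sum_sub_distrib, Finset.sum_insert hb,
        hy b (Finset.mem_insert_self _ _), sub_self, zero_add] at this
      convert this using 1
      refine Finset.sum_congr rfl fun a ha => ?_
      rw [hy a (Finset.mem_insert_of_mem ha), sub_smul]
    have h2 : ∀ a ∈ s, y a ∈ N := by
      intro a ha
      have h3 := ih (hμ.mono (by simp)) (y := fun a => (μ a - μ b) • y a) (fun a ha => by
        rw [map_smul, hy a (Finset.mem_insert_of_mem ha), smul_comm]) h1 a ha
      refine (N.smul_mem_iff (sub_ne_zero.2 fun e => hb ?_)).1 h3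
      rw [← hμ (by simp [ha]) (by simp) e]
      exact ha
    intro a ha
    rcases Finset.mem_insert.1 ha with rfl | ha
    · rw [Finset.sum_insert hb] at h
      exact (N.add_mem_iff_left (N.sum_mem h2)).1 h
    · exact h2 a ha

variable {N : Submodule ℂ (TableauSpace C L)}

/-- The terms of `E_{k,k+1} T(R)` are separated by `c_{k2}`: its eigenvalues on them differ by `2
(r_{ki} - r_{kj})`, which is nonzero by noncriticality. -/
theorem eCoeff_smul_mem (hC : C ⊆ relR n ∪ relR0 n) (hadm : Admissible C)
    (hL : IsRealization C L) (hρ : ActsByGTFormulas C L ρ)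
    (hN : ∀ u, ∀ v ∈ N, uAction ρ u v ∈ N) (hR : R ∈ tableaux C L) (h : tab C L R ∈ N) {k a : ℕ}
    (hk : k < n) (ha : a ∈ Finset.Icc 1 k) : eCoeff R k a • tab C L (R + delta n k a) ∈ N := by
  have hk1 : 1 ≤ k := (Finset.mem_Icc.1 ha).1.trans (Finset.mem_Icc.1 ha).2
  have h1 := hN (uE n k (k + 1)) _ h
  rw [uE, uAction, lift_ι_apply, (hρ R hR).1 k hk1 (by omega)] at h1
  refine mem_of_sum_eigenvectors_mem (hN (cGen n k 2)) _
    (μ := fun a => traceSqEigen (R + delta n k a) k) ?_ ?_ h1 a ha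
  · intro i hi j hj e
    have h2 := traceSqEigen_add_delta R hk.le hi
    have h3 := traceSqEigen_add_delta R hk.le hj
    beta_reduce at e
    exact ((hadm L hL).1 R hR).injOn hk hi hj (by linear_combination (h3 - h2 + e) / 2)
  · intro i _
    by_cases hmem : R + delta n k i ∈ tableaux C L
    · rw [uAction_cGen_eq_trace, map_smul,
        (traceActs_of_le hC hadm hL hρ hk.le).trace_sq hmem, smul_comm]
    · simp [tab_of_not_mem hmem]

theorem fCoeff_smul_mem (hC : C ⊆ relR n ∪ relR0 n) (hadm : Admissible C)
    (hL : IsRealization C L) (hρ : ActsByGTFormulas C L ρ)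
    (hN : ∀ u, ∀ v ∈ N, uAction ρ u v ∈ N) (hR : R ∈ tableaux C L) (h : tab C L R ∈ N) {k a : ℕ}
    (hk : k < n) (ha : a ∈ Finset.Icc 1 k) : fCoeff R k a • tab C L (R - delta n k a) ∈ N := by
  have hk1 : 1 ≤ k := (Finset.mem_Icc.1 ha).1.trans (Finset.mem_Icc.1 ha).2
  have h1 := hN (uE n (k + 1) k) _ h
  rw [uE, uAction, lift_ι_apply, (hρ R hR).2.1 k hk1 (by omega)] at h1
  refine mem_of_sum_eigenvectors_mem (hN (cGen n k 2)) _
    (μ := fun a => traceSqEigen (R - delta n k a) k) ?_ ?_ h1 a ha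
  · intro i hi j hj e
    have h2 := traceSqEigen_add_delta (R - delta n k i) hk.le hi
    have h3 := traceSqEigen_add_delta (R - delta n k j) hk.le hj
    rw [sub_add_cancel, entry_sub, entry_delta_self hk.le hi, if_pos rfl] at h2
    rw [sub_add_cancel, entry_sub, entry_delta_self hk.le hj, if_pos rfl] at h3
    beta_reduce at e
    exact ((hadm L hL).1 R hR).injOn hk hi hj (by linear_combination (h3 - h2 - e) / 2)
  · intro i _
    by_cases hmem : R - delta n k i ∈ tableaux C L
    · rw [uAction_cGen_eq_trace, map_smul,
        (traceActs_of_le hC hadm hL hρ hk.le).trace_sq hmem, smul_comm]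
    · simp [tab_of_not_mem hmem]

theorem prod_erase_ne_zero (hR : Noncritical R) {k a : ℕ} (hk : k < n) (ha : a ∈ Finset.Icc 1 k) :
    ∏ j ∈ (Finset.Icc 1 k).erase a, (R.entry k a - R.entry k j) ≠ 0 := by
  refine Finset.prod_ne_zero_iff.2 fun j hj => sub_ne_zero.2 fun e => ?_
  rw [Finset.mem_erase] at hj
  exact hj.1 (hR.injOn hk ha hj.2 e).symm

/-- A vanishing factor of the raising coefficient is an equality with row `k + 1`, and raising would
destroy an inequality. A vanishing factor of the coefficient leading back means that raising has
created one. An unchanged pattern excludes both. -/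
theorem tab_raise_mem_iff (hC : C ⊆ relR n ∪ relR0 n) (hadm : Admissible C)
    (hL : IsRealization C L) (hρ : ActsByGTFormulas C L ρ)
    (hN : ∀ u, ∀ v ∈ N, uAction ρ u v ∈ N) (hR : R ∈ tableaux C L) {v : Vertex n} (hv : v.row < n)
    (h : pattern (shift R (Pi.single v 1)) = pattern R) :
    tab C L R ∈ N ↔ tab C L (shift R (Pi.single v 1)) ∈ N := by
  have hS : shift R (Pi.single v 1) ∈ tableaux C L := by
    refine shift_mem_of_pattern_eq hC hR (fun w hw => Pi.single_eq_of_ne ?_ _) h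
    rintro rfl
    omega
  have ha : v.1.2 ∈ Finset.Icc 1 v.row := Finset.mem_Icc.2 ⟨v.2.1, v.2.2.1⟩
  rw [← shift_zero R, shift_shift, zero_add, pattern_shift_eq_iff] at h
  rw [shift_single] at hS ⊢
  constructor
  · intro hm
    refine (N.smul_mem_iff ?_).1 (eCoeff_smul_mem hC hadm hL hρ hN hR hm hv ha)
    refine neg_ne_zero.2 (div_ne_zero ?_ (prod_erase_ne_zero ((hadm L hL).1 R hR) hv ha))
    refine Finset.prod_ne_zero_iff.2 fun j hj => sub_ne_zero.2 fun e => ?_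
    rw [Finset.mem_Icc] at hj
    rw [entry_eq, entry_of_valid R ⟨hj.1, hj.2, hv⟩] at e
    have h1 := h ⟨(v.row + 1, j), hj.1, hj.2, hv⟩ v rfl 0 (by rw [e]; simp)
    rw [Pi.single_eq_same, Pi.single_eq_of_ne] at h1
    · simp at h1
    · intro h2
      have h3 : v.row + 1 = v.row := congrArg Vertex.row h2
      omega
  · intro hm
    have h0 := fCoeff_smul_mem hC hadm hL hρ hN hS hm hv ha
    rw [add_sub_cancel_right] at h0
    refine (N.smul_mem_iff ?_).1 h0
    refine div_ne_zero ?_ (prod_erase_ne_zero ((hadm L hL).1 _ hS) hv ha)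
    refine Finset.prod_ne_zero_iff.2 fun j hj => sub_ne_zero.2 fun e => ?_
    rw [Finset.mem_Icc] at hj
    have hvr := v.2
    rw [entry_add, entry_add, entry_delta_self hv.le ha, if_pos rfl,
      entry_delta_of_ne hv.le ha (by omega), entry_eq, entry_of_valid R ⟨hj.1, hj.2, by omega⟩] at e
    have h1 := h v ⟨(v.row - 1, j), _⟩ (by simp only [Vertex.row]; omega) (-1) (by
      push_cast
      linear_combination e)
    rw [Pi.single_eq_same, Pi.single_eq_of_ne] at h1
    · simp at h1
    · intro h2
      have h3 : v.row - 1 = v.row := congrArg Vertex.row h2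
      have : v.row = v.1.1 := rfl
      omega

theorem tab_shift_mem_iff (hC : C ⊆ relR n ∪ relR0 n) (hadm : Admissible C)
    (hL : IsRealization C L) (hρ : ActsByGTFormulas C L ρ)
    (hN : ∀ u, ∀ v ∈ N, uAction ρ u v ∈ N) (hR : R ∈ tableaux C L) {z : Vertex n → ℤ}
    (hz0 : 0 ≤ z) (hz : ∀ v, v.row = n → z v = 0) (h : pattern (shift R z) = pattern R) :
    tab C L R ∈ N ↔ tab C L (shift R z) ∈ N := by
  have := Fintype.ofFinite (Vertex n)
  obtain ⟨d, hd⟩ : ∃ d : ℕ, ∑ v, z v = d :=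
    ⟨_, (Int.toNat_of_nonneg (Finset.sum_nonneg fun v _ => hz0 v)).symm⟩
  induction d generalizing R z with
  | zero =>
    have : z = 0 := by
      rw [Nat.cast_zero, Finset.sum_eq_zero_iff_of_nonneg fun v _ => hz0 v] at hd
      exact funext fun v => hd v (Finset.mem_univ v)
    rw [this, shift_zero]
  | succ d ih =>
    have hne : z ≠ 0 := by
      rintro rfl
      simp at hd
      omega
    obtain ⟨v, hv, hpat⟩ := exists_raise hz0 hne h
    have hvn : v.row < n := by
      refine lt_of_le_of_ne v.2.2.2 fun e => ?_
      rw [hz v e] at hv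
      exact lt_irrefl _ hv
    have htop : ∀ w : Vertex n, w.row = n → (Pi.single v 1 : Vertex n → ℤ) w = 0 := by
      intro w hw
      refine Pi.single_eq_of_ne ?_ _
      rintro rfl
      omega
    have e : shift (shift R (Pi.single v 1)) (z - Pi.single v 1) = shift R z := by
      rw [shift_shift, add_sub_cancel]
    rw [tab_raise_mem_iff hC hadm hL hρ hN hR hvn hpat, ← e]
    refine ih (shift_mem_of_pattern_eq hC hR htop hpat) (fun w => ?_)
      (fun w hw => by rw [Pi.sub_apply, hz w hw, htop w hw, sub_zero]) (by rw [e, h, hpat]) ?_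
    · have : 0 ≤ z w := hz0 w
      rw [Pi.zero_apply, Pi.sub_apply, Pi.single_apply]
      by_cases hw : w = v
      · rw [if_pos hw, hw]
        linarith
      · rw [if_neg hw, sub_zero]
        exact this
    · simp only [Pi.sub_apply, Finset.sum_sub_distrib, hd, Finset.sum_pi_single', Finset.mem_univ,
        if_true]
      push_cast
      ring

/-- The tableau `R + max(z, 0) = S + max(-z, 0)` lies above both `R` and `S = R + z` and has their
pattern, so one can go up from `R` and down to `S`. -/
theorem tab_mem_of_pattern_eq (hC : C ⊆ relR n ∪ relR0 n) (hadm : Admissible C)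
    (hL : IsRealization C L) (hρ : ActsByGTFormulas C L ρ)
    (hN : ∀ u, ∀ v ∈ N, uAction ρ u v ∈ N) (hR : R ∈ tableaux C L) (hS : S ∈ tableaux C L)
    (h : pattern S = pattern R) (hm : tab C L R ∈ N) : tab C L S ∈ N := by
  obtain ⟨z, hz, rfl⟩ := exists_shift_eq hR hS
  have h' := h
  rw [← shift_zero R, shift_shift, zero_add, pattern_shift_eq_iff] at h
  have e : shift (shift R z) (fun v => max (-z v) 0) = shift R fun v => max (z v) 0 := by
    rw [shift_shift]
    congr 1
    ext v
    simp only [Pi.add_apply]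
    omega
  have hpat : pattern (shift R fun v => max (z v) 0) = pattern R := by
    conv_rhs => rw [← shift_zero R]
    rw [pattern_shift_eq_iff]
    intro v w hvw d hd
    have := h v w hvw d hd
    simp only [Pi.zero_apply] at this ⊢
    omega
  rw [tab_shift_mem_iff hC hadm hL hρ hN hR (z := fun v => max (z v) 0)
    (fun v => le_max_right _ _) (fun v hv => by simp [hz v hv]) hpat, ← e] at hm
  exact (tab_shift_mem_iff hC hadm hL hρ hN hS (z := fun v => max (-z v) 0) (fun v => le_max_right _ _)
    (fun v hv => by simp [hz v hv]) (by rw [e, hpat, h'])).2 hm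

/-- A pattern is a subset of a finite set, so one tableau for each occurring pattern suffices. -/
theorem exists_finset_span_eq_top (hC : C ⊆ relR n ∪ relR0 n) (hadm : Admissible C)
    (hL : IsRealization C L) (hρ : ActsByGTFormulas C L ρ) :
    ∃ S : Finset (TableauSpace C L),
      Submodule.span ℂ {v | ∃ u : UGL n, ∃ s ∈ S, v = uAction ρ u s} = ⊤ := by
  set Ω : tableaux C L → Set (Vertex n × Vertex n) := fun R => pattern R.1
  choose g hg using fun ω : Set.range Ω => ω.2
  refine ⟨(Set.toFinite (Set.range fun ω => tab C L (g ω).1)).toFinset, ?_⟩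
  set N := Submodule.span ℂ {v | ∃ u : UGL n, ∃ s ∈ (Set.toFinite (Set.range fun ω =>
    tab C L (g ω).1)).toFinset, v = uAction ρ u s} with hN
  have hstable : ∀ u, ∀ v ∈ N, uAction ρ u v ∈ N := by
    intro u v hv
    refine Submodule.span_induction (p := fun v _ => uAction ρ u v ∈ N) ?_ ?_ ?_ ?_ hv
    · rintro _ ⟨u', s, hs, rfl⟩
      refine Submodule.subset_span ⟨u * u', s, hs, ?_⟩
      rw [map_mul, Module.End.mul_apply]
    · rw [map_zero]
      exact N.zero_mem
    · intro x y _ _ hx hy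
      rw [map_add]
      exact N.add_mem hx hy
    · intro c x _ hx
      rw [map_smul]
      exact N.smul_mem c hx
  have htab : ∀ R ∈ tableaux C L, tab C L R ∈ N := by
    intro R hR
    refine tab_mem_of_pattern_eq hC hadm hL hρ hstable
      (g ⟨Ω ⟨R, hR⟩, Set.mem_range_self _⟩).2 hR ?_ ?_
    · exact (hg ⟨Ω ⟨R, hR⟩, Set.mem_range_self _⟩).symm
    · refine Submodule.subset_span ⟨1, tab C L (g ⟨Ω ⟨R, hR⟩, Set.mem_range_self _⟩).1, ?_, ?_⟩
      · rw [Set.Finite.mem_toFinset]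
        exact ⟨_, rfl⟩
      · rw [map_one, Module.End.one_apply]
  rw [eq_top_iff]
  intro v _
  rw [← Finsupp.sum_single v]
  refine N.sum_mem fun R _ => ?_
  have := N.smul_mem (v R) (htab R.1 R.2)
  rwa [tab_of_mem R.2, Finsupp.smul_single_one] at this

end Generation

/-! ### Tableaux are determined by the multisets of their rows -/

section Order

variable {n : ℕ} {C : Set (Relation n)} {L R S : Tableau n}

theorem IsRealization.shift {z : Vertex n → ℤ} (hR : IsRealization C R)
    (hz : Satisfies (shift R z) C) : IsRealization C (shift R z) := by
  refine ⟨hz, fun v w hvw hne => ?_⟩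
  rw [← hR.2 v w hvw hne]
  constructor
  · rintro ⟨d, hd⟩
    refine ⟨d - z v + z w, ?_⟩
    simp only [GelfandTsetlin.shift] at hd
    push_cast
    linear_combination hd
  · rintro ⟨d, hd⟩
    exact ⟨_, shift_sub R z hd⟩

/-- Two tableaux in `𝓑_C(T(L))` order the entries of a row in the same way. -/
theorem pos_of_pos (hadm : Admissible C) (hL : IsRealization C L) (hR : R ∈ tableaux C L)
    {z : Vertex n → ℤ} (hS : shift R z ∈ tableaux C L) {v w : Vertex n} (hvw : v.row = w.row)
    (hv : v.row < n) {d : ℤ} (hd : R v - R w = d) (h : 0 < d) : 0 < d + z v - z w := by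
  have hne : v ≠ w := by
    rintro rfl
    rw [sub_self] at hd
    have : d = 0 := by exact_mod_cast hd.symm
    omega
  have hcrit := (hadm L hL).1 _ hS v w hvw (by omega) hne
  have h0 : d + z v - z w ≠ 0 := by
    intro e
    have := shift_sub R z hd
    rw [e, Int.cast_zero, sub_eq_zero] at this
    exact hcrit this
  by_contra hcon
  -- `R + y` is the entrywise minimum of `R` and a constant translate of `R + z`, so it satisfies
  -- all relations. If the order were reversed, its entries at `v` and `w` would be equal. Its top
  -- row may differ from that of `R`, hence the appeal to a new realization.
  set y : Vertex n → ℤ := fun u => min 0 (z u - d - z v) with hy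
  have hreal : IsRealization C (GelfandTsetlin.shift R y) := by
    refine (hL.of_mem hR).shift fun r hr => ?_
    obtain ⟨e, he, he0, he1⟩ := hR.2 r hr
    obtain ⟨e', he', he0', he1'⟩ := hS.2 r hr
    rw [shift_sub R z he, Int.cast_inj] at he'
    refine ⟨_, shift_sub R y he, ?_, fun hs => ?_⟩
    · simp only [hy]
      omega
    · have := he1 hs
      have := he1' hs
      simp only [hy]
      omega
  refine (hadm _ hreal).1 _ hreal.mem_tableaux v w hvw (by omega) hne ?_
  have h1 := shift_sub R y hd
  have h2 : d + y v - y w = 0 := by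
    simp only [hy]
    omega
  rwa [h2, Int.cast_zero, sub_eq_zero] at h1

/-- Among the entries of the row that go up, take one with largest real part. It moves to the old
value of another entry, which must itself go up because the order is kept, and that entry has larger
real part. -/
theorem shift_nonpos (hadm : Admissible C) (hL : IsRealization C L) (hR : R ∈ tableaux C L)
    {z : Vertex n → ℤ} (hS : shift R z ∈ tableaux C L) {k : ℕ} (hk : k < n)
    (h : ∀ v : Vertex n, v.row = k → ∃ w : Vertex n, w.row = k ∧ shift R z v = R w)
    {v : Vertex n} (hv : v.row = k) : z v ≤ 0 := by
  by_contra hcon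
  have hfin : {v : Vertex n | v.row = k ∧ 0 < z v}.Finite := Set.toFinite _
  obtain ⟨u, ⟨hu, hzu⟩, hmax⟩ := hfin.exists_maximalFor (fun v => (R v).re) _
    ⟨v, hv, not_le.1 hcon⟩
  obtain ⟨w, hw, e⟩ := h u hu
  have hd : R w - R u = z u := by
    rw [← e, shift]
    ring
  have h1 := pos_of_pos hadm hL hR hS (hw.trans hu.symm) (hw.trans_lt hk) hd hzu
  have hre : (R w).re = (R u).re + z u := by
    have := congrArg Complex.re hd
    simp at this
    linarith
  have hpos : (0 : ℝ) < z u := by exact_mod_cast hzu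
  have h2 : (R w).re ≤ (R u).re := hmax (j := w) ⟨hw, by omega⟩ (by linarith)
  linarith

theorem row_eq_of_map_eq (hadm : Admissible C) (hL : IsRealization C L) (hR : R ∈ tableaux C L)
    (hS : S ∈ tableaux C L) {k : ℕ} (hk : k < n)
    (h : (Finset.Icc 1 k).val.map (R.entry k) = (Finset.Icc 1 k).val.map (S.entry k)) {j : ℕ}
    (hj : j ∈ Finset.Icc 1 k) : R.entry k j = S.entry k j := by
  have key : ∀ {R S : Tableau n}, (Finset.Icc 1 k).val.map (R.entry k) =
      (Finset.Icc 1 k).val.map (S.entry k) → ∀ v : Vertex n, v.row = k →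
      ∃ w : Vertex n, w.row = k ∧ S v = R w := by
    intro R S h v hv
    have h1 : S v ∈ (Finset.Icc 1 k).val.map (R.entry k) := by
      rw [h, Multiset.mem_map]
      refine ⟨v.1.2, Finset.mem_Icc.2 ⟨v.2.1, hv ▸ v.2.2.1⟩, ?_⟩
      rw [← hv, entry_eq]
    obtain ⟨i, hi, e⟩ := Multiset.mem_map.1 h1
    rw [Finset.mem_val, Finset.mem_Icc] at hi
    rw [entry_of_valid R ⟨hi.1, hi.2, hk.le⟩] at e
    exact ⟨⟨(k, i), hi.1, hi.2, hk.le⟩, rfl, e.symm⟩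
  obtain ⟨z, hz, rfl⟩ := exists_shift_eq hR hS
  rw [Finset.mem_Icc] at hj
  have e : shift (shift R z) (-z) = R := by rw [shift_shift, add_neg_cancel, shift_zero]
  have h1 := shift_nonpos hadm hL hR hS hk (key h) (v := ⟨(k, j), hj.1, hj.2, hk.le⟩) rfl
  have h2 := shift_nonpos hadm hL hS (z := -z) (e.symm ▸ hR) hk (by rw [e]; exact key h.symm)
    (v := ⟨(k, j), hj.1, hj.2, hk.le⟩) rfl
  rw [Pi.neg_apply] at h2
  have h3 : z ⟨(k, j), hj.1, hj.2, hk.le⟩ = 0 := by omega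
  rw [entry_of_valid R ⟨hj.1, hj.2, hk.le⟩, entry_of_valid _ ⟨hj.1, hj.2, hk.le⟩, shift, h3]
  simp

/-- The eigenvalues of `((M_{m+1})^p)_{m+1,m+1}` on `T(R)`. -/
def cornerSeries (R : Tableau n) (m : ℕ) : PowerSeries ℂ := rowInv R (m + 1) m * rowProd R m m

theorem rowProd_congr {k : ℕ} (h : ∀ j ∈ Finset.Icc 1 k, R.entry k j = S.entry k j) (c : ℂ) :
    rowProd R k c = rowProd S k c := by
  rw [rowProd, rowProd, linProd_eq_prod, linProd_eq_prod]
  exact Finset.prod_congr rfl fun j hj => by rw [h j hj]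

theorem map_eq_map_of_rowProd_eq {k : ℕ} {c : ℂ} (h : rowProd R k c = rowProd S k c) :
    (Finset.Icc 1 k).val.map (R.entry k) = (Finset.Icc 1 k).val.map (S.entry k) := by
  have := congrArg (Multiset.map fun x => x - c) (map_eq_map_of_linProd_eq h)
  simpa only [Multiset.map_map, Function.comp_def, add_sub_cancel_right] using this

/-- Tableaux in `𝓑_C(T(L))` are separated by the eigenvalues of the corner entries. -/
theorem eq_of_cornerSeries_eq (hadm : Admissible C) (hL : IsRealization C L)
    (hR : R ∈ tableaux C L) (hS : S ∈ tableaux C L)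
    (h : ∀ m < n, cornerSeries R m = cornerSeries S m) : R = S := by
  have key : ∀ k < n, ∀ j ∈ Finset.Icc 1 k, R.entry k j = S.entry k j := by
    intro k
    induction k with
    | zero => simp
    | succ k ih =>
      intro hk j hj
      -- The series is the quotient of the products for rows `k` and `k + 1`, so once row `k` is
      -- known it determines row `k + 1` as a multiset.
      refine row_eq_of_map_eq hadm hL hR hS hk (map_eq_map_of_rowProd_eq (c := k) ?_) hj
      have h1 := h k (by omega)
      rw [cornerSeries, cornerSeries, rowProd_congr (ih (by omega))] at h1
      have h2 := rowProd_mul_rowInv R (k + 1) k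
      have h3 := rowProd_mul_rowInv S (k + 1) k
      have h4 := rowProd_mul_rowInv S k k
      linear_combination (-(rowProd S (k + 1) k * rowProd R (k + 1) k * rowInv S k k)) * h1 +
        rowProd S (k + 1) k * rowProd S k k * rowInv S k k * h2 -
        rowProd R (k + 1) k * rowProd S k k * rowInv S k k * h3 +
        (rowProd S (k + 1) k - rowProd R (k + 1) k) * h4
  refine tableau_ext fun k j hk hj => ?_
  rcases hk.lt_or_eq with hk | rfl
  · exact key k hk j hj
  -- The top row, which may be critical, is common to all tableaux and need not be recovered.
  · obtain ⟨z, hz, rfl⟩ := exists_shift_eq hR hS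
    rw [Finset.mem_Icc] at hj
    rw [entry_of_valid R ⟨hj.1, hj.2, le_rfl⟩, entry_of_valid _ ⟨hj.1, hj.2, le_rfl⟩, shift,
      hz _ rfl]
    simp

end Order

/-! ### The corner entries commute with the Gelfand-Tsetlin subalgebra -/

section Corner

variable {n : ℕ}

/-- `((M_{m+1})^p)_{m+1,m+1}` -/
def corner (n m p : ℕ) : UGL n :=
  (genMat (ι ℂ : gln n →ₗ⁅ℂ⁆ UGL n) (m + 1) ^ p) (Fin.last m) (Fin.last m)

theorem genMat_pow_mem_subU (m p : ℕ) (i j : Fin m) :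
    (genMat (ι ℂ : gln n →ₗ⁅ℂ⁆ UGL n) m ^ p) i j ∈ subU n m := by
  induction p generalizing i with
  | zero =>
    rw [pow_zero, Matrix.one_apply]
    split_ifs
    · exact one_mem _
    · exact zero_mem _
  | succ p ih =>
    rw [pow_succ', Matrix.mul_apply]
    refine sum_mem fun l _ => mul_mem (Algebra.subset_adjoin ?_) (ih l)
    exact ⟨i + 1, l + 1, by omega, by omega, by omega, by omega, rfl⟩

theorem corner_commute_of_le {m m' : ℕ} (hm : m < n) (hm' : m' ≤ m) (p : ℕ) {x : UGL n}
    (hx : x ∈ subU n m') : Commute (corner n m p) x := by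
  refine Algebra.adjoin_induction (p := fun x _ => Commute (corner n m p) x) ?_ ?_ ?_ ?_ hx
  · rintro _ ⟨i, j, hi, hi', hj, hj', rfl⟩
    have h := (isTensorOperator_genMat (ι ℂ : gln n →ₗ⁅ℂ⁆ UGL n) (Nat.succ_le_of_lt hm)).pow p
      ⟨i - 1, by omega⟩ ⟨j - 1, by omega⟩ (Fin.last m) (Fin.last m)
    rw [if_neg, if_neg, sub_self, sub_eq_zero] at h
    · simp only [genMat, Nat.sub_add_cancel hi, Nat.sub_add_cancel hj] at h
      exact h.symm
    · rw [Fin.ext_iff]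
      simp only [Fin.val_last]
      omega
    · rw [Fin.ext_iff]
      simp only [Fin.val_last]
      omega
  · intro c
    exact Algebra.commutes' c _ |>.symm
  · intro x y _ _ hx hy
    exact hx.add_right hy
  · intro x y _ _ hx hy
    exact hx.mul_right hy

/-- For `m' ≤ m` the corner entry is invariant under `𝔤𝔩_m` and commutes with all of `U_{m'}`. For
`m' > m` it lies in `U_{m'}` and commutes with the center. -/
theorem corner_commute {m : ℕ} (hm : m < n) (p : ℕ) {g : UGL n} (hg : g ∈ Gam n) :
    Commute (corner n m p) g := by
  refine Algebra.adjoin_induction (p := fun x _ => Commute (corner n m p) x) ?_ ?_ ?_ ?_ hg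
  · rintro x ⟨m', -, -, hx⟩
    rcases Nat.lt_or_ge m m' with h | h
    · exact (hx.2 _ (subU_mono n h (genMat_pow_mem_subU (m + 1) p _ _))).symm
    · exact corner_commute_of_le hm h p hx.1
  · intro c
    exact Algebra.commutes' c _ |>.symm
  · intro x y _ _ hx hy
    exact hx.add_right hy
  · intro x y _ _ hx hy
    exact hx.mul_right hy

end Corner

/-! ### The decomposition under the Gelfand-Tsetlin subalgebra -/

section Decomposition

variable {n : ℕ} {C : Set (Relation n)} {L R S : Tableau n}
variable {ρ : gln n →ₗ⁅ℂ⁆ Module.End ℂ (TableauSpace C L)}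

theorem QuasidetActs.corner {m : ℕ} (h : QuasidetActs ρ m) (hR : R ∈ tableaux C L) (p : ℕ) :
    uAction ρ (corner n m p) (tab C L R) = PowerSeries.coeff p (cornerSeries R m) • tab C L R := by
  have i1 := rowProd_mul_rowInv R (m + 1) (0 + m)
  have i2 := rowProd_mul_rowInv R m (0 + m)
  have h1 : ActsBy (resolventSeries (genMat ρ (m + 1) + (0 : ℂ) • 1) (Fin.last m) (Fin.last m))
      (tab C L R) (1 * (rowInv R (m + 1) (0 + m) * rowProd R m (0 + m))) := by
    refine ActsBy.of_mul_right (y := quasidetSeries 0 (genMat ρ (m + 1))) ?_ (h R hR 0) ?_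
    · rw [mul_quasidetSeries]
      exact ActsBy.one _
    · linear_combination (rowProd R m (0 + m) * rowInv R m (0 + m)) * i1 + i2
  have h2 := h1 p
  rw [zero_smul, add_zero, one_mul, zero_add] at h2
  rw [GelfandTsetlin.corner, uAction_genMat_pow, cornerSeries, ← h2]
  simp [resolventSeries]

theorem quasidetActs (hC : C ⊆ relR n ∪ relR0 n) (hadm : Admissible C)
    (hL : IsRealization C L) (hρ : ActsByGTFormulas C L ρ) {m : ℕ} (hm : m < n) :
    QuasidetActs ρ m := (acts_of_lt hC hadm hL hρ m hm).2

theorem corner_apply (hC : C ⊆ relR n ∪ relR0 n) (hadm : Admissible C)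
    (hL : IsRealization C L) (hρ : ActsByGTFormulas C L ρ) {m : ℕ} (hm : m < n) (p : ℕ)
    (v : TableauSpace C L) (R : tableaux C L) :
    uAction ρ (corner n m p) v R = PowerSeries.coeff p (cornerSeries R.1 m) * v R := by
  induction v using Finsupp.induction_linear with
  | zero => simp
  | add v w hv hw => rw [map_add, Finsupp.add_apply, hv, hw, Finsupp.add_apply, mul_add]
  | single S c =>
    have h := (quasidetActs hC hadm hL hρ hm).corner S.2 p
    rw [tab_of_mem S.2] at h
    rw [← mul_one c, ← smul_eq_mul c, ← Finsupp.smul_single, map_smul, h, Finsupp.smul_apply,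
      Finsupp.smul_apply, Finsupp.smul_apply, Finsupp.single_apply]
    split_ifs with e
    · rw [← e]
      simp [mul_comm]
    · simp

/-- The Gelfand-Tsetlin subalgebra acts diagonally. -/
theorem uAction_gam_apply (hC : C ⊆ relR n ∪ relR0 n) (hadm : Admissible C)
    (hL : IsRealization C L) (hρ : ActsByGTFormulas C L ρ) {g : UGL n} (hg : g ∈ Gam n)
    (R : tableaux C L) :
    uAction ρ g (tab C L R.1) = uAction ρ g (tab C L R.1) R • tab C L R.1 := by
  ext S
  by_cases h : uAction ρ g (tab C L R.1) S = 0
  · rw [h, Finsupp.smul_apply, tab_apply]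
    split_ifs with e
    · rw [← Subtype.ext e] at h
      rw [h, zero_smul]
    · rw [smul_zero]
  -- If `T(S)` occurs in `g T(R)`, then commuting `g` with the corner entries shows that these have
  -- the same eigenvalues on both tableaux.
  · have e : R.1 = S.1 := by
      refine eq_of_cornerSeries_eq hadm hL R.2 S.2 fun m hm => ?_
      ext p
      have h1 := corner_apply hC hadm hL hρ hm p (uAction ρ g (tab C L R.1)) S
      rw [← Module.End.mul_apply, ← map_mul, corner_commute hm p hg, map_mul,
        Module.End.mul_apply, (quasidetActs hC hadm hL hρ hm).corner R.2 p, map_smul,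
        Finsupp.smul_apply, smul_eq_mul] at h1
      exact mul_right_cancel₀ h h1
    rw [← Subtype.ext e, Finsupp.smul_apply, tab_apply, if_pos rfl, smul_eq_mul, mul_one]

/-- The character of the Gelfand-Tsetlin subalgebra on a common eigenvector `T(R)`. -/
def character (ρ : gln n →ₗ⁅ℂ⁆ Module.End ℂ (TableauSpace C L)) (R : tableaux C L)
    (h : ∀ g ∈ Gam n, uAction ρ g (tab C L R.1) = uAction ρ g (tab C L R.1) R • tab C L R.1) :
    Gam n →+* ℂ where
  toFun g := uAction ρ (g : UGL n) (tab C L R.1) R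
  map_one' := by
    rw [OneMemClass.coe_one, map_one, Module.End.one_apply, tab_apply, if_pos rfl]
  map_mul' a b := by
    rw [MulMemClass.coe_mul, map_mul, Module.End.mul_apply, h b b.2, map_smul, Finsupp.smul_apply,
      Finsupp.smul_apply, smul_eq_mul, tab_apply, if_pos rfl, smul_eq_mul, mul_one, mul_comm]
  map_zero' := by
    rw [ZeroMemClass.coe_zero, map_zero, LinearMap.zero_apply, Finsupp.zero_apply]
  map_add' a b := by
    rw [AddMemClass.coe_add, map_add, LinearMap.add_apply, Finsupp.add_apply]

theorem character_apply (h : ∀ R : tableaux C L, ∀ g ∈ Gam n,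
    uAction ρ g (tab C L R.1) = uAction ρ g (tab C L R.1) R • tab C L R.1)
    (g : Gam n) (v : TableauSpace C L) (R : tableaux C L) :
    uAction ρ (g : UGL n) v R = character ρ R (h R) g * v R := by
  induction v using Finsupp.induction_linear with
  | zero => simp
  | add v w hv hw => rw [map_add, Finsupp.add_apply, hv, hw, Finsupp.add_apply, mul_add]
  | single S c =>
    have h1 := h S g g.2
    rw [tab_of_mem S.2] at h1
    rw [← mul_one c, ← smul_eq_mul c, ← Finsupp.smul_single, map_smul, h1, Finsupp.smul_apply,
      Finsupp.smul_apply, Finsupp.smul_apply, Finsupp.single_apply]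
    split_ifs with e
    · subst e
      change _ = uAction ρ (g : UGL n) (tab C L S.1) S * _
      rw [tab_of_mem S.2]
      simp [mul_comm]
    · simp

theorem character_surjective (R : tableaux C L)
    (h : ∀ g ∈ Gam n, uAction ρ g (tab C L R.1) = uAction ρ g (tab C L R.1) R • tab C L R.1) :
    Function.Surjective (character ρ R h) := by
  intro c
  refine ⟨⟨algebraMap ℂ (UGL n) c, (Gam n).algebraMap_mem c⟩, ?_⟩
  change uAction ρ (algebraMap ℂ (UGL n) c) (tab C L R.1) R = c
  rw [AlgHom.commutes, Module.algebraMap_end_apply, Finsupp.smul_apply, tab_apply, if_pos rfl,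
    smul_eq_mul, mul_one]

/-- The maximal ideal of the Gelfand-Tsetlin subalgebra which annihilates `T(R)`. -/
def annihilatorIdeal (ρ : gln n →ₗ⁅ℂ⁆ Module.End ℂ (TableauSpace C L)) (R : tableaux C L)
    (h : ∀ g ∈ Gam n, uAction ρ g (tab C L R.1) = uAction ρ g (tab C L R.1) R • tab C L R.1) :
    MaximalSpectrum (Gam n) :=
  ⟨RingHom.ker (character ρ R h),
    RingHom.ker_isMaximal_of_surjective _ (character_surjective R h)⟩

theorem tab_mem_gtSpace (h : ∀ R : tableaux C L, ∀ g ∈ Gam n,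
    uAction ρ g (tab C L R.1) = uAction ρ g (tab C L R.1) R • tab C L R.1) (R : tableaux C L) :
    tab C L R.1 ∈ gtSpace ρ (annihilatorIdeal ρ R (h R)) := by
  refine ⟨1, fun a ha => ?_⟩
  rw [pow_one] at ha
  have h1 : character ρ R (h R) a = 0 := ha
  rw [h R a a.2]
  change character ρ R (h R) a • _ = _
  rw [h1, zero_smul]

/-- If `T(R)` occurs in a vector killed by `𝔪 ^ k`, the character of `T(R)` vanishes on `a ^ k`,
hence on `a`, for each `a ∈ 𝔪`. So `𝔪` lies in its kernel and equals it by maximality. -/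
theorem gtSpace_le_supported (h : ∀ R : tableaux C L, ∀ g ∈ Gam n,
    uAction ρ g (tab C L R.1) = uAction ρ g (tab C L R.1) R • tab C L R.1)
    (𝔪 : MaximalSpectrum (Gam n)) :
    gtSpace ρ 𝔪 ≤ Finsupp.supported ℂ ℂ {R | annihilatorIdeal ρ R (h R) = 𝔪} := by
  rintro v ⟨k, hk⟩
  rw [Finsupp.mem_supported]
  intro R hR
  rw [Finset.mem_coe, Finsupp.mem_support_iff] at hR
  refine MaximalSpectrum.ext (𝔪.isMaximal.eq_of_le
    (annihilatorIdeal ρ R (h R)).isMaximal.ne_top fun a ha => ?_).symm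
  have h1 := character_apply h (a ^ k) v R
  rw [hk _ (Ideal.pow_mem_pow ha k), Finsupp.zero_apply, map_pow] at h1
  exact eq_zero_of_pow_eq_zero ((mul_eq_zero.1 h1.symm).resolve_right hR)

theorem isInternal_gtSpace (h : ∀ R : tableaux C L, ∀ g ∈ Gam n,
    uAction ρ g (tab C L R.1) = uAction ρ g (tab C L R.1) R • tab C L R.1) :
    DirectSum.IsInternal (gtSpace ρ) := by
  rw [DirectSum.isInternal_submodule_iff_iSupIndep_and_iSup_eq_top]
  constructor
  · refine iSupIndep.mono ?_ (gtSpace_le_supported h)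
    refine fun 𝔪 => Disjoint.mono_right (iSup₂_le fun 𝔪' hne => ?_)
      (Finsupp.disjoint_supported_supported
        (t := {R | annihilatorIdeal ρ R (h R) ≠ 𝔪}) (Set.disjoint_left.2 fun R hR hR' => hR' hR))
    refine Finsupp.supported_mono fun R hR => ?_
    change annihilatorIdeal ρ R (h R) ≠ 𝔪
    rwa [show annihilatorIdeal ρ R (h R) = 𝔪' from hR]
  · rw [eq_top_iff]
    intro v _
    rw [← Finsupp.sum_single v]
    refine Submodule.sum_mem _ fun R _ => ?_
    have h1 := Submodule.smul_mem _ (v R)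
      (Submodule.mem_iSup_of_mem (annihilatorIdeal ρ R (h R)) (tab_mem_gtSpace h R))
    rwa [tab_of_mem R.2, Finsupp.smul_single_one] at h1

theorem isGelfandTsetlinModule (hC : C ⊆ relR n ∪ relR0 n) (hadm : Admissible C)
    (hL : IsRealization C L) (hρ : ActsByGTFormulas C L ρ) : IsGelfandTsetlinModule ρ :=
  ⟨exists_finset_span_eq_top hC hadm hL hρ,
    isInternal_gtSpace fun R _ hg => uAction_gam_apply hC hadm hL hρ hg R⟩

end Decomposition

end GelfandTsetlin

end

theorem mainTheorem5 (n : ℕ) (hn : 2 ≤ n)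
    (C : Set (GelfandTsetlin.Relation n))
    (hC : C ⊆ GelfandTsetlin.relR n ∪ GelfandTsetlin.relR0 n)
    (hadm : GelfandTsetlin.Admissible C)
    (L : GelfandTsetlin.Tableau n) (hL : GelfandTsetlin.IsRealization C L)
    (ρ : GelfandTsetlin.gln n →ₗ⁅ℂ⁆ Module.End ℂ (GelfandTsetlin.TableauSpace C L))
    (hρ : GelfandTsetlin.ActsByGTFormulas C L ρ) :
    GelfandTsetlin.IsGelfandTsetlinModule ρ ∧
      ∀ m k : ℕ, 1 ≤ k → k ≤ m → m ≤ n → ∀ R ∈ GelfandTsetlin.tableaux C L,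
        GelfandTsetlin.uAction ρ (GelfandTsetlin.cGen n m k) (GelfandTsetlin.tab C L R) =
          GelfandTsetlin.gammaAt m k R • GelfandTsetlin.tab C L R :=
  ⟨GelfandTsetlin.isGelfandTsetlinModule hC hadm hL hρ, fun _ _ hk _ hm _ hR =>
    GelfandTsetlin.uAction_cGen hC hadm hL hρ hk hm hR⟩
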